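/- Let $N$ be an infinitely generated free nilpotent group of nilpotency class $c \ge 2$, that is, $N \cong F/\gamma_{c+1}(F)$ where $F$ is a free group of infinite rank. For $a \in N$ let $\tau_a \in \mathrm{Aut}\,N$ be the conjugation $z \mapsto aza^{-1}$, and let $\mathrm{Inn}\,N=\{\tau_a : a\in N\}$, which is a free nilpotent group of class $c-1$. For $k \ge 1$ let $\mathrm{IA}_k(N)$ be the kernel of the natural homomorphism $\mathrm{Aut}\,N \to \mathrm{Aut}(N/\gamma_{k+1}(N))$. Let $x$ be a primitive element of $N$ (a member of some basis of $N$), let $1 \le k \le c-1$, and let $\mathrm{IA}_k(N)_{(x)}$ be the group of all $\sigma\in \mathrm{IA}_k(N)$ with $\sigma(x)=x$. Then: (a) $\mathrm{IA}_k(N)_{(x)}$ is definable in the group $\mathrm{Aut}\,N$ with the parameter $\tau_x$ by a formula of full second-order logic. (b) There is a basis $X$ of $\mathrm{Inn}\,N$ (as a free nilpotent group of class $c-1$) with $\tau_x\in X$. For every such $X$, let $P_{(\tau_x)}$ be the group of all $\rho\in\mathrm{Aut}\,N$ that permute $X$ under the conjugation action $\tau\mapsto\rho\tau\rho^{-1}$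 and fix $\tau_x$ under it. Then there is an element $\pi^*\in P_{(\tau_x)}$ which acts on $X\setminus\{\tau_x\}$ with infinitely many orbits, all of them infinite, and for every such $\pi^*$ $$\mathrm{IA}_k(N)_{(x)}=\langle\, \rho\eta\rho^{-1} : \rho\in P_{(\tau_x)},\ \eta\in \mathrm{IA}_k(N),\ \eta\pi^*=\pi^*\eta \,\rangle .$$ -/

import Mathlib

/-! ### Full second-order logic -/

namespace SecondOrder

/-- Formulas of full second-order logic over a first-order language `L`. A formula of type
`Formula L n Γ` has its free element variables among `n` variables indexed by `Fin n`, and its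
free relation variables among `Γ.length` variables, the `i`-th of which has arity `Γ.get i`.
A quantifier binds the variable with index `0`. -/
inductive Formula (L : FirstOrder.Language.{0, 0}) : ℕ → List ℕ → Type
  | falsum {n : ℕ} {Γ : List ℕ} : Formula L n Γ
  | equal {n : ℕ} {Γ : List ℕ} (s t : L.Term (Fin n)) : Formula L n Γ
  | rel {n : ℕ} {Γ : List ℕ} {m : ℕ} (R : L.Relations m) (ts : Fin m → L.Term (Fin n)) :
      Formula L n Γ
  | mem {n : ℕ} {Γ : List ℕ} (i : Fin Γ.length) (ts : Fin (Γ.get i) → L.Term (Fin n)) :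
      Formula L n Γ
  | imp {n : ℕ} {Γ : List ℕ} (φ ψ : Formula L n Γ) : Formula L n Γ
  | allElem {n : ℕ} {Γ : List ℕ} (φ : Formula L (n + 1) Γ) : Formula L n Γ
  | allRel {n : ℕ} {Γ : List ℕ} (m : ℕ) (φ : Formula L n (m :: Γ)) : Formula L n Γ

/-- Assignments of relations on `M` to the relation variables of the context `Γ`. -/
abbrev RelAssignment (M : Type*) (Γ : List ℕ) : Type _ :=
  (i : Fin Γ.length) → Set (Fin (Γ.get i) → M)

/-- The assignment for the empty context. -/
def RelAssignment.nil (M : Type*) : RelAssignment M [] := fun i => i.elim0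

/-- Extend an assignment by the value `R` of a new relation variable with index `0`. -/
def RelAssignment.cons {M : Type*} {Γ : List ℕ} {m : ℕ} (R : Set (Fin m → M))
    (V : RelAssignment M Γ) : RelAssignment M (m :: Γ) :=
  Fin.cons (α := fun i : Fin (Γ.length + 1) => Set (Fin ((m :: Γ).get i) → M)) R V

/-- Full (standard) semantics: relation quantifiers range over all relations on `M`. -/
def Formula.Realize {L : FirstOrder.Language.{0, 0}} {M : Type*} [L.Structure M] :
    {n : ℕ} → {Γ : List ℕ} → Formula L n Γ → (Fin n → M) → RelAssignment M Γ → Prop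
  | _, _, .falsum, _, _ => False
  | _, _, .equal s t, v, _ => s.realize v = t.realize v
  | _, _, .rel R ts, v, _ => FirstOrder.Language.Structure.RelMap R (fun j => (ts j).realize v)
  | _, _, .mem i ts, v, V => (fun j => (ts j).realize v) ∈ V i
  | _, _, .imp φ ψ, v, V => φ.Realize v V → ψ.Realize v V
  | _, _, .allElem φ, v, V => ∀ a : M, φ.Realize (Fin.cons a v : Fin _ → M) V
  | _, _, .allRel m φ, v, V => ∀ R : Set (Fin m → M), φ.Realize v (V.cons R)

/-- `S ⊆ M` is definable in the `L`-structure `M`, by means of second-order logic, with the tuple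
of parameters `a`: it is the solution set of `φ(v, a)` for some second-order formula `φ`. -/
def DefinableWith (L : FirstOrder.Language.{0, 0}) {M : Type*} [L.Structure M] {m : ℕ} (a : Fin m → M)
    (S : Set M) : Prop :=
  ∃ φ : Formula L (m + 1) [],
    ∀ b : M, b ∈ S ↔ φ.Realize (Fin.cons b a : Fin (m + 1) → M) (RelAssignment.nil M)

end SecondOrder

/-- The function symbols of the language of groups. -/
inductive GroupFunc : ℕ → Type
  | mul : GroupFunc 2
  | inv : GroupFunc 1
  | one : GroupFunc 0

/-- The language of groups. -/
def groupLanguage : FirstOrder.Language.{0, 0} where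
  Functions := GroupFunc
  Relations := fun _ => Empty

/-- Every group is a structure for the language of groups. -/
instance groupStructure (G : Type*) [Group G] : groupLanguage.Structure G where
  funMap := fun {_} f =>
    match f with
    | GroupFunc.mul => fun v => v 0 * v 1
    | GroupFunc.inv => fun v => (v 0)⁻¹
    | GroupFunc.one => fun _ => 1
  RelMap := fun {_} r => nomatch r

/-! ### Free nilpotent groups and their automorphisms

The group `γ_{k+1}(G)` is `(⊤ : Subgroup G).lowerCentralSeries k` (Mathlib counts from `0`). -/

namespace FreeNilpotent

/-- `B` is a basis of the subgroup `H` of `G` as a free nilpotent group of class `d`: it generates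
`H`, and the homomorphism `F → G` from the free group `F` on `B` which extends the
inclusion `B → G` has kernel `γ_{d+1}(F)`; so `H ≅ F / γ_{d+1}(F)` through `B`. -/
def IsBasisOf {G : Type*} [Group G] (d : ℕ) (B : Set G) (H : Subgroup G) : Prop :=
  Subgroup.closure B = H ∧
    (FreeGroup.lift (Subtype.val : B → G)).ker =
      (⊤ : Subgroup (FreeGroup B)).lowerCentralSeries d

/-- `N` is an infinitely generated free nilpotent group of class `c`. -/
def IsInfinitelyGenerated (c : ℕ) (N : Type*) [Group N] : Prop :=
  ∃ B : Set N, B.Infinite ∧ IsBasisOf c B ⊤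

variable {N : Type*} [Group N]

/-- `x` belongs to some basis of the free nilpotent group `N` of class `c`. -/
def IsPrimitive (c : ℕ) (x : N) : Prop :=
  ∃ B : Set N, IsBasisOf c B ⊤ ∧ x ∈ B

/-- The homomorphism `Aut G → Aut (G / K)` for a characteristic subgroup `K`. -/
def quotientAut (K : Subgroup N) [hK : K.Characteristic] : MulAut N →* MulAut (N ⧸ K) where
  toFun σ := QuotientGroup.congr K K σ (Subgroup.characteristic_iff_map_eq.mp hK σ)
  map_one' := by
    ext z
    induction z using QuotientGroup.induction_on
    rfl
  map_mul' σ ρ := by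
    ext z
    induction z using QuotientGroup.induction_on
    rfl

/-- `IA_k(N)`, the kernel of `Aut N → Aut (N / γ_{k+1}(N))`. -/
def IA (N : Type*) [Group N] (k : ℕ) : Subgroup (MulAut N) :=
  (quotientAut ((⊤ : Subgroup N).lowerCentralSeries k)).ker

/-- `IA_k(N)_(x)`, the elements of `IA_k(N)` which fix `x`. -/
def stabIA (k : ℕ) (x : N) : Subgroup (MulAut N) :=
  IA N k ⊓ MulAction.stabilizer (MulAut N) x

/-- `X` is a basis set of conjugations: a basis of the group `Inn N` of inner automorphisms of
the free nilpotent group `N` of class `c` (`Inn N` is free nilpotent of class `c - 1`). -/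
def IsConjBasis (c : ℕ) (X : Set (MulAut N)) : Prop :=
  IsBasisOf (c - 1) X (MulAut.conj : N →* MulAut N).range

/-- `Sym X`: the automorphisms `ρ` of `N` which permute `X` under conjugation `τ ↦ ρ τ ρ⁻¹`. -/
def symConj (X : Set (MulAut N)) : Subgroup (MulAut N) :=
  Subgroup.normalizer X

/-- `(Sym X)_(τ)`: the elements of `Sym X` which fix `τ` under the conjugation action. -/
def symConjStab (X : Set (MulAut N)) (τ : MulAut N) : Subgroup (MulAut N) where
  carrier := {ρ | ρ ∈ symConj X ∧ ρ * τ * ρ⁻¹ = τ}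
  one_mem' := ⟨one_mem _, by simp⟩
  mul_mem' {a b} ha hb := ⟨mul_mem ha.1 hb.1, by
    calc a * b * τ * (a * b)⁻¹ = a * (b * τ * b⁻¹) * a⁻¹ := by group
      _ = τ := by rw [hb.2, ha.2]⟩
  inv_mem' {a} ha := ⟨inv_mem ha.1, by
    calc a⁻¹ * τ * a⁻¹⁻¹ = a⁻¹ * (a * τ * a⁻¹) * a := by rw [ha.2, inv_inv]
      _ = τ := by group⟩

/-- The orbit of `τ` under the conjugation action of the powers of `π`. -/
def conjOrbit (π τ : MulAut N) : Set (MulAut N) :=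
  Set.range fun n : ℤ => π ^ n * τ * (π ^ n)⁻¹

/-- `π` is an element of `Sym X` which fixes `τ` under the conjugation action and acts on
`X \ {τ}` with infinitely many orbits, all of them infinite. -/
def IsPiStar (X : Set (MulAut N)) (τ π : MulAut N) : Prop :=
  π ∈ symConjStab X τ ∧
    (∀ υ ∈ X \ {τ}, (conjOrbit π υ).Infinite) ∧
    (conjOrbit π '' (X \ {τ})).Infinite

end FreeNilpotent

open FreeNilpotent

/-! Two facts about N carry the proof. First, its center lies in γ_c(N)
(`mem_lowerCentralSeries_of_commutator_mem`). This rests on Magnus' theorem that γ_n of a free group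
consists of the elements whose Magnus expansion is 1 up to degree n - 1; it is proved with Lyndon
brackets, whose least words can be read off from the expansion. Consequently IA_k(N) fixes the
center pointwise. Second, arbitrary lifts to N of a basis of Inn N have the universal property of a
basis with respect to maps into N (`IsInnBasis.isRelBasis`). Lifting one element of each orbit of π*
and applying powers of π* gives a family consisting of x and elements b(j,n), with π*(b(j,n)) =
b(j,n+1) and π*(x) = xz, z central. On γ_2(N), therefore, π* acts as the pure shift of the family.

The right side of (b) fixes x. If η in IA_k(N) commutes with π*, then x⁻¹η(x) is an element of
γ_2(N) fixed by the shift. A high power of the shift moves the finite support of an element off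
itself, so such an element is trivial (`IsRelBasis.eq_one_of_shift_fixed`). An element ρ that fixes
τ_x moves x only by a central factor, so ρηρ⁻¹ fixes x as well.

The right side contains all of IA_k(N)_(x), by descending induction on l ≥ k. Modulo γ_{l+2}, a
value b⁻¹σ(b) is a product of commutators with at most l + 1 letters. If the basis is colored with
enough colors, each of these commutators avoids some color other than that of b. So σ is, modulo
IA_{l+1}(N), a product of automorphisms that ignore one color (`IsRelBasis.stabIA_le_of_colors`).
Each of these acts on a moiety of the basis, and an infinite swindle applies
(`IsRelBasis.mem_of_moiety`): it is the quotient of two automorphisms which repeat it on infinitely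
many copies of the moiety. Up to permutations of the basis, both commute with the shift.

For (a), every ingredient of (b) is expressed inside Aut N. Inn N is generated by the conjugates of
τ_x; the center lies in γ_{k+1}(N), so IA_k(N) is visible from the action on Inn N; and being a
basis is replaced by an extension property for maps from X to Inn N (`IsInnBasis`), which is
sufficient for (b). As (b) holds for all X and π*, the formula may quantify over them universally.
-/

open scoped commutatorElement

/-! ### Lyndon words -/

namespace Lyndon

section Words

variable {α : Type*} [LinearOrder α]

theorem append_lt_append_iff (p : List α) {s t : List α} : p ++ s < p ++ t ↔ s < t := by
  induction p with
  | nil => simp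
  | cons a p ih => simpa [List.cons_lt_cons_iff] using ih

theorem lt_append_self (u : List α) {t : List α} (ht : t ≠ []) : u < u ++ t := by
  conv_lhs => rw [← List.append_nil u]
  rw [append_lt_append_iff]
  cases t with
  | nil => exact absurd rfl ht
  | cons a t => exact List.nil_lt_cons a t

theorem le_append_self (u t : List α) : u ≤ u ++ t := by
  rcases eq_or_ne t [] with rfl | ht
  · simp
  · exact (lt_append_self u ht).le

/-- If `u < v`, then `u` is a prefix of `v`, or `u` and `v` differ at some position. -/
theorem isPrefix_or_forall_lt {u v : List α} (h : u < v) :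
    u <+: v ∨ ∀ s t, u ++ s < v ++ t := by
  induction u generalizing v with
  | nil => exact Or.inl (List.nil_prefix)
  | cons a u ih =>
    cases v with
    | nil => exact absurd h (List.not_lt_nil _)
    | cons b v =>
      rw [List.cons_lt_cons_iff] at h
      rcases h with h | ⟨rfl, h⟩
      · right
        intro s t
        rw [List.cons_append, List.cons_append, List.cons_lt_cons_iff]
        exact Or.inl h
      · rcases ih h with h | h
        · left
          exact (List.cons_prefix_cons).2 ⟨rfl, h⟩
        · right
          intro s t
          rw [List.cons_append, List.cons_append, List.cons_lt_cons_iff]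
          exact Or.inr ⟨rfl, h s t⟩

theorem append_lt_append_of_length_lt {u v : List α} (h : u < v) (hl : v.length < u.length)
    (s t : List α) : u ++ s < v ++ t := by
  rcases isPrefix_or_forall_lt h with h | h
  · exact absurd h.length_le (by omega)
  · exact h s t

theorem append_lt_append_of_length_eq {u v : List α} (h : u < v) (hl : v.length = u.length)
    (s t : List α) : u ++ s < v ++ t := by
  rcases isPrefix_or_forall_lt h with h' | h'
  · exact absurd (h'.eq_of_length hl.symm) h.ne
  · exact h' s t

/-- The words of length at most `n` are well-founded in the lexicographic order. -/
theorem acc_lt [WellFoundedLT α] (n : ℕ) (l : List α) (hl : l.length ≤ n) :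
    Acc (fun x y : List α => x < y ∧ x.length ≤ n) l := by
  induction n generalizing l with
  | zero =>
    obtain rfl := List.length_eq_zero_iff.1 (Nat.le_zero.1 hl)
    exact Acc.intro _ fun x hx => absurd hx.1 (List.not_lt_nil _)
  | succ n ih =>
    -- Induction on the first letter, then on the tail. The bound on lengths is essential: b > ab >
    -- aab > ... descends forever.
    have key : ∀ a : α, ∀ t : List α, t.length ≤ n →
        Acc (fun x y : List α => x < y ∧ x.length ≤ n + 1) (a :: t) := by
      intro a
      induction a using WellFoundedLT.induction with
      | _ a iha =>
      intro t ht
      have hacc := ih t ht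
      induction hacc with
      | intro t _ iht =>
      refine Acc.intro _ fun x hx => ?_
      cases x with
      | nil => exact Acc.intro _ fun y hy => absurd hy.1 (List.not_lt_nil _)
      | cons b s =>
        have hs : s.length ≤ n := by simpa using hx.2
        rcases List.cons_lt_cons_iff.1 hx.1 with h | ⟨rfl, h⟩
        · exact iha b h s hs
        · exact iht s ⟨h, hs⟩ hs
    cases l with
    | nil => exact Acc.intro _ fun y hy => absurd hy.1 (List.not_lt_nil _)
    | cons a t => exact key a t (by simpa using hl)

/-- A Lyndon word: a nonempty word which is smaller than its proper nonempty suffixes. -/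
def IsLyndon (l : List α) : Prop :=
  l ≠ [] ∧ ∀ p s, p ≠ [] → s ≠ [] → l = p ++ s → l < s

/-- `u ++ v` is the standard factorization of a word: `v` is its least proper nonempty suffix. -/
def IsStd (u v : List α) : Prop :=
  u ≠ [] ∧ v ≠ [] ∧ ∀ p s, p ≠ [] → s ≠ [] → u ++ v = p ++ s → v ≤ s

theorem exists_min_suffix (t : List α) (ht : t ≠ []) :
    ∃ p v, t = p ++ v ∧ v ≠ [] ∧ ∀ q s, s ≠ [] → t = q ++ s → v ≤ s := by
  induction t with
  | nil => exact absurd rfl ht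
  | cons a t ih =>
    rcases eq_or_ne t [] with rfl | h
    · refine ⟨[], [a], rfl, by simp, fun q s hs h => ?_⟩
      cases q with
      | nil => exact h.le
      | cons b q => simp_all
    · obtain ⟨p, v, hpv, hv, hmin⟩ := ih h
      rcases le_total v (a :: t) with hle | hle
      · refine ⟨a :: p, v, by simp [hpv], hv, fun q s hs h => ?_⟩
        cases q with
        | nil => exact hle.trans_eq h
        | cons b q => exact hmin q s hs (by simpa using (List.cons.inj h).2)
      · refine ⟨[], a :: t, rfl, by simp, fun q s hs h => ?_⟩
        cases q with
        | nil => exact h.le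
        | cons b q => exact hle.trans (hmin q s hs (by simpa using (List.cons.inj h).2))

theorem exists_isStd (a b : α) (t : List α) : ∃ u v, a :: b :: t = u ++ v ∧ IsStd u v := by
  obtain ⟨p, v, hpv, hv, hmin⟩ := exists_min_suffix (b :: t) (by simp)
  refine ⟨a :: p, v, by simp [hpv], by simp, hv, fun q s hq hs h => ?_⟩
  cases q with
  | nil => exact absurd rfl hq
  | cons c q =>
    refine hmin q s hs ?_
    rw [hpv]
    simpa using (List.cons.inj h).2

theorem exists_isStd_of_length {l : List α} (hl : 2 ≤ l.length) :
    ∃ u v, l = u ++ v ∧ IsStd u v := by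
  match l, hl with
  | a :: b :: t, _ => exact exists_isStd a b t

theorem IsStd.unique {u v u' v' : List α} (h : IsStd u v) (h' : IsStd u' v')
    (e : u ++ v = u' ++ v') : u = u' ∧ v = v' := by
  have hv : v = v' := le_antisymm (h.2.2 u' v' h'.1 h'.2.1 e) (h'.2.2 u v h.1 h.2.1 e.symm)
  subst hv
  exact ⟨List.append_cancel_right e, rfl⟩

theorem IsStd.lyndon_right {u v : List α} (h : IsStd u v) : IsLyndon v := by
  refine ⟨h.2.1, fun p s hp hs e => lt_of_le_of_ne ?_ ?_⟩
  · exact h.2.2 (u ++ p) s (by simp [hp]) hs (by simp [e])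
  · intro e'
    have := congrArg List.length e
    rw [e', List.length_append] at this
    exact hp (List.length_eq_zero_iff.1 (by omega))

/-- Suppose a proper suffix s of u has s < u. As uv < sv, s must be a prefix of u, say u = st.
Cancelling s leaves tv < v, against the minimality of v among the suffixes. -/
theorem IsStd.lyndon_left {u v : List α} (h : IsStd u v) (hl : IsLyndon (u ++ v)) :
    IsLyndon u := by
  refine ⟨h.1, fun p s hp hs e => ?_⟩
  by_contra hlt
  have hlen : s.length < u.length := by
    have h1 := congrArg List.length e
    have h2 := List.length_pos_iff.2 hp
    rw [List.length_append] at h1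
    omega
  have hsu : s < u := lt_of_le_of_ne (not_lt.1 hlt) (by rintro rfl; omega)
  have h1 : u ++ v < s ++ v := hl.2 p (s ++ v) hp (by simp [hs]) (by simp [e])
  rcases isPrefix_or_forall_lt hsu with ⟨t, ht⟩ | h'
  · have htne : t ≠ [] := by
      rintro rfl
      simp at ht
      rw [ht] at hlen
      omega
    have h2 : t ++ v < v := by
      rw [← ht, List.append_assoc, append_lt_append_iff] at h1
      exact h1
    exact absurd h2 (not_lt.2 (h.2.2 s (t ++ v) hs (by simp [htne]) (by simp [← ht])))
  · exact absurd h1 (not_lt.2 (h' v v).le)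

theorem isLyndon_singleton (a : α) : IsLyndon [a] := by
  refine ⟨by simp, fun p s hp hs e => ?_⟩
  have := congrArg List.length e
  have h1 := List.length_pos_iff.2 hp
  have h2 := List.length_pos_iff.2 hs
  simp at this
  omega

theorem IsLyndon.append_lt {u v : List α} (hv : IsLyndon v) (hu : u ≠ [])
    (h : u < v) : u ++ v < v := by
  rcases isPrefix_or_forall_lt h with ⟨t, ht⟩ | h'
  · have htne : t ≠ [] := by
      rintro rfl
      simp [← ht] at h
    have := hv.2 u t hu htne ht.symm
    conv_rhs => rw [← ht]
    rwa [append_lt_append_iff]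
  · simpa using h' v []

theorem IsLyndon.append {u v : List α} (hu : IsLyndon u) (hv : IsLyndon v) (h : u < v) :
    IsLyndon (u ++ v) := by
  have huv := hv.append_lt hu.1 h
  refine ⟨by simp [hu.1], fun p s hp hs e => ?_⟩
  rw [List.append_eq_append_iff] at e
  rcases e with ⟨q, rfl, hq⟩ | ⟨q, rfl, rfl⟩
  · rcases eq_or_ne q [] with rfl | hqne
    · simp at hq
      rwa [← hq]
    · exact huv.trans (hv.2 q s hqne hs hq)
  · rcases eq_or_ne q [] with rfl | hqne
    · simpa using huv
    · have h1 := hu.2 p q hp hqne rfl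
      refine append_lt_append_of_length_lt h1 ?_ v v
      have := List.length_pos_iff.2 hp
      rw [List.length_append]
      omega

theorem IsStd.lt {u v : List α} (h : IsStd u v) (hl : IsLyndon (u ++ v)) : u < v :=
  (lt_append_self u h.2.1).trans (hl.2 u v h.1 h.2.1 rfl)

/-- `u ++ v` is a standard factorization if `u` is a letter, or the right factor of `u` is at
least `v`. -/
theorem isStd_of_le {u v : List α} (hu : u ≠ []) (hv : IsLyndon v)
    (h : ∀ u' u'', u = u' ++ u'' → IsStd u' u'' → v ≤ u'') : IsStd u v := by
  refine ⟨hu, hv.1, fun p s hp hs e => ?_⟩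
  rw [List.append_eq_append_iff] at e
  rcases e with ⟨q, rfl, hq⟩ | ⟨q, rfl, rfl⟩
  · rcases eq_or_ne q [] with rfl | hqne
    · simp at hq
      rw [← hq]
    · exact (hv.2 q s hqne hs hq).le
  · rcases eq_or_ne q [] with rfl | hqne
    · simp
    · have hlen : 2 ≤ (p ++ q).length := by
        have h1 := List.length_pos_iff.2 hp
        have h2 := List.length_pos_iff.2 hqne
        rw [List.length_append]
        omega
      obtain ⟨u', u'', e, hstd⟩ := exists_isStd_of_length hlen
      exact (h u' u'' e hstd).trans ((hstd.2.2 p q hp hqne e.symm).trans (le_append_self q v))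

end Words

/-! ### Iterated commutators along standard factorizations -/

section Brackets

variable {α : Type*} [LinearOrder α] {G : Type*} [Group G]

theorem exists_split (a b : α) (t : List α) :
    ∃ w : List α × List α, a :: b :: t = w.1 ++ w.2 ∧ IsStd w.1 w.2 := by
  obtain ⟨u, v, h⟩ := exists_isStd a b t
  exact ⟨(u, v), h⟩

/-- The iterated commutator given by the standard factorization of a word. -/
noncomputable def bracket (g : α → G) : List α → G
  | [] => 1
  | [a] => g a
  | a :: b :: t =>
    ⁅bracket g (Classical.choose (exists_split a b t)).1,
      bracket g (Classical.choose (exists_split a b t)).2⁆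
termination_by l => l.length
decreasing_by
  · have h := Classical.choose_spec (exists_split a b t)
    have h1 := congrArg List.length h.1
    have h2 := List.length_pos_iff.2 h.2.2.1
    rw [List.length_append] at h1
    omega
  · have h := Classical.choose_spec (exists_split a b t)
    have h1 := congrArg List.length h.1
    have h2 := List.length_pos_iff.2 h.2.1
    rw [List.length_append] at h1
    omega

theorem bracket_singleton (g : α → G) (a : α) : bracket g [a] = g a := by
  rw [bracket]

/-- Standard factorizations are unique, so the one chosen in the definition is the given one. -/
theorem bracket_append (g : α → G) {u v : List α} (h : IsStd u v) :
    bracket g (u ++ v) = ⁅bracket g u, bracket g v⁆ := by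
  obtain ⟨a, b, t, e⟩ : ∃ a b t, u ++ v = a :: b :: t := by
    obtain ⟨a, u, rfl⟩ := List.exists_cons_of_ne_nil h.1
    cases u with
    | nil =>
      obtain ⟨b, v, rfl⟩ := List.exists_cons_of_ne_nil h.2.1
      exact ⟨a, b, v, rfl⟩
    | cons b u => exact ⟨a, b, u ++ v, rfl⟩
  rw [e, bracket]
  have hs := Classical.choose_spec (exists_split a b t)
  obtain ⟨h1, h2⟩ := h.unique hs.2 (e.trans hs.1)
  rw [← h1, ← h2]

end Brackets

end Lyndon

/-! ### Commutators modulo the lower central series -/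

namespace LowerCentral

variable {G : Type*} [Group G]

/-- The lower central series `γ_i(G)`, counted from `1`. -/
abbrev gam (G : Type*) [Group G] (i : ℕ) : Subgroup G := (⊤ : Subgroup G).lowerCentralSeries (i - 1)

theorem gam_antitone : Antitone (gam G) := fun _ _ h =>
  (⊤ : Subgroup G).lowerCentralSeries_antitone (Nat.sub_le_sub_right h 1)

theorem three_subgroups {A B C K : Subgroup G} [K.Normal] (h1 : ⁅⁅B, C⁆, A⁆ ≤ K)
    (h2 : ⁅⁅C, A⁆, B⁆ ≤ K) : ⁅⁅A, B⁆, C⁆ ≤ K := by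
  have key : ∀ H : Subgroup G, H ≤ K ↔ H.map (QuotientGroup.mk' K) = ⊥ := fun H => by
    rw [Subgroup.map_eq_bot_iff, QuotientGroup.ker_mk']
  rw [key, Subgroup.map_commutator, Subgroup.map_commutator] at h1 h2 ⊢
  exact Subgroup.commutator_commutator_eq_bot_of_rotate h1 h2

theorem commutator_lowerCentralSeries_le (m n : ℕ) :
    ⁅(⊤ : Subgroup G).lowerCentralSeries m, (⊤ : Subgroup G).lowerCentralSeries n⁆ ≤
      (⊤ : Subgroup G).lowerCentralSeries (m + n + 1) := by
  induction n generalizing m with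
  | zero => exact le_rfl
  | succ n ih =>
    rw [Subgroup.commutator_comm, Subgroup.lowerCentralSeries_succ]
    refine three_subgroups ?_ ?_
    · rw [Subgroup.commutator_comm ⊤]
      refine (ih (m + 1)).trans (Subgroup.lowerCentralSeries_antitone _ (by omega))
    · exact Subgroup.commutator_mono (ih m) le_rfl

theorem commutator_mem_gam {i j n : ℕ} (hi : 1 ≤ i) (hj : 1 ≤ j) (hn : n ≤ i + j) {a b : G}
    (ha : a ∈ gam G i) (hb : b ∈ gam G j) : ⁅a, b⁆ ∈ gam G n :=
  (⊤ : Subgroup G).lowerCentralSeries_antitone (by omega : n - 1 ≤ (i - 1) + (j - 1) + 1)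
    (commutator_lowerCentralSeries_le (i - 1) (j - 1) (Subgroup.commutator_mem_commutator ha hb))

theorem map_gam_le {H : Type*} [Group H] (f : G →* H) (i : ℕ) {a : G} (ha : a ∈ gam G i) :
    f a ∈ gam H i := by
  have : f a ∈ ((⊤ : Subgroup G).lowerCentralSeries (i - 1)).map f := Subgroup.mem_map_of_mem f ha
  rw [Subgroup.map_lowerCentralSeries] at this
  exact Subgroup.lowerCentralSeries_mono _ le_top this

theorem gam_quotient (n : ℕ) : gam (G ⧸ gam G n) n = ⊥ := by
  have h := (⊤ : Subgroup G).map_lowerCentralSeries (QuotientGroup.mk' (gam G n)) (n - 1)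
  rw [Subgroup.map_top_of_surjective _ (QuotientGroup.mk'_surjective _)] at h
  refine h.symm.trans ?_
  rw [Subgroup.map_eq_bot_iff, QuotientGroup.ker_mk']

theorem commute_of_gam_eq_bot {n : ℕ} (hn : 1 ≤ n) (h : gam G (n + 1) = ⊥) {a : G}
    (ha : a ∈ gam G n) (b : G) : Commute a b := by
  rw [← commutatorElement_eq_one_iff_commute, ← Subgroup.mem_bot, ← h]
  exact commutator_mem_gam hn le_rfl le_rfl ha (Subgroup.mem_top b)

/-- This is the Hall–Witt identity: commutators of weight n are central, so the conjugations in it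
disappear and the factors can be rearranged. -/
theorem jacobi_of_gam_eq_bot {i j k n : ℕ} (hi : 1 ≤ i) (hj : 1 ≤ j) (hk : 1 ≤ k)
    (hn : n = i + j + k) (h : gam G (n + 1) = ⊥) {a b c : G} (ha : a ∈ gam G i)
    (hb : b ∈ gam G j) (hc : c ∈ gam G k) : ⁅⁅a, b⁆, c⁆ = ⁅⁅a, c⁆, b⁆ * ⁅a, ⁅b, c⁆⁆ := by
  have hcent : ∀ {x : G}, x ∈ gam G n → ∀ y, Commute x y := fun hx =>
    commute_of_gam_eq_bot (by omega) h hx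
  -- The conjugate bcb⁻¹ is [b,c]c, and the extra factor [[a,b],[b,c]] has weight i + 2j + k > n.
  have key : ∀ {i j k : ℕ}, 1 ≤ i → 1 ≤ j → 1 ≤ k → n = i + j + k → ∀ {a b c : G},
      a ∈ gam G i → b ∈ gam G j → c ∈ gam G k → ⁅⁅a, b⁆, b * c * b⁻¹⁆ = ⁅⁅a, b⁆, c⁆ := by
    intro i j k hi hj hk hn a b c ha hb hc
    have hab : ⁅a, b⁆ ∈ gam G (i + j) := commutator_mem_gam hi hj le_rfl ha hb
    have hbc : ⁅b, c⁆ ∈ gam G (j + k) := commutator_mem_gam hj hk le_rfl hb hc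
    have h1 : ⁅⁅a, b⁆, ⁅b, c⁆⁆ = 1 := by
      rw [← Subgroup.mem_bot, ← h]
      exact commutator_mem_gam (by omega) (by omega) (by omega) hab hbc
    have h2 : ⁅⁅a, b⁆, c⁆ ∈ gam G n := commutator_mem_gam (by omega) hk (by omega) hab hc
    have e : b * c * b⁻¹ = ⁅b, c⁆ * c := by simp [commutatorElement_def]
    rw [e, commutatorElement_mul_right_eq_mul_conj, h1, one_mul, mul_assoc,
      (hcent h2 _).eq, mul_inv_cancel_left]
  have hac : ⁅a, c⁆ ∈ gam G (i + k) := commutator_mem_gam hi hk le_rfl ha hc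
  have hacb : ⁅⁅a, c⁆, b⁆ ∈ gam G n := commutator_mem_gam (by omega) hj (by omega) hac hb
  have hw := commutatorElement_commutatorElement_conj_mul a b c
  rw [key hi hj hk hn ha hb hc, key hj hk hi (by omega) hb hc ha, key hk hi hj (by omega) hc ha hb]
    at hw
  have e1 : ⁅⁅b, c⁆, a⁆ = ⁅a, ⁅b, c⁆⁆⁻¹ := (commutatorElement_inv _ _).symm
  have e2 : ⁅⁅c, a⁆, b⁆ = ⁅⁅a, c⁆, b⁆⁻¹ := by
    rw [← commutatorElement_inv a c, commutatorElement_inv_left, ← commutatorElement_inv ⁅a, c⁆ b,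
      mul_assoc, (hcent hacb _).inv_left.eq, inv_mul_cancel_left]
  rw [e1, e2, mul_assoc, mul_eq_one_iff_eq_inv, mul_inv_rev, inv_inv, inv_inv] at hw
  exact hw

/-- The Jacobi identity modulo `γ_{n+1}(G)`. -/
theorem jacobi_mem {i j k n : ℕ} (hi : 1 ≤ i) (hj : 1 ≤ j) (hk : 1 ≤ k)
    (hn : n = i + j + k) {T : Subgroup G} (hT : gam G (n + 1) ≤ T) {a b c : G}
    (ha : a ∈ gam G i) (hb : b ∈ gam G j) (hc : c ∈ gam G k) (h1 : ⁅⁅a, c⁆, b⁆ ∈ T)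
    (h2 : ⁅a, ⁅b, c⁆⁆ ∈ T) : ⁅⁅a, b⁆, c⁆ ∈ T := by
  have h := jacobi_of_gam_eq_bot hi hj hk hn (gam_quotient (G := G) (n + 1))
    (map_gam_le (QuotientGroup.mk' _) i ha) (map_gam_le (QuotientGroup.mk' _) j hb)
    (map_gam_le (QuotientGroup.mk' _) k hc)
  rw [← map_commutatorElement, ← map_commutatorElement, ← map_commutatorElement,
    ← map_commutatorElement, ← map_commutatorElement, ← map_commutatorElement, ← map_mul] at h
  have h' := hT (QuotientGroup.eq.1 h.symm)
  exact (Subgroup.mul_mem_cancel_left _ (inv_mem (mul_mem h1 h2))).1 h'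

theorem conj_mem_of_gam_le {n : ℕ} (hn : 1 ≤ n) {T : Subgroup G} (hT : gam G (n + 1) ≤ T) {a : G}
    (ha : a ∈ gam G n) (haT : a ∈ T) (b : G) : b * a * b⁻¹ ∈ T := by
  have e : b * a * b⁻¹ = ⁅b, a⁆ * a := by simp [commutatorElement_def]
  rw [e]
  exact mul_mem (hT (commutator_mem_gam le_rfl hn (by omega) (Subgroup.mem_top b) ha)) haT

/-- Commutators are additive in the left argument modulo `γ_{i+j+1}(G)`. -/
theorem commutator_closure_left_mem {i j : ℕ} (hi : 1 ≤ i) (hj : 1 ≤ j) {T : Subgroup G}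
    (hT : gam G (i + j + 1) ≤ T) {A : Set G} (hA : A ⊆ gam G i) {b : G} (hb : b ∈ gam G j)
    (h : ∀ a ∈ A, ⁅a, b⁆ ∈ T) {a : G} (ha : a ∈ Subgroup.closure A ⊔ gam G (i + 1)) :
    ⁅a, b⁆ ∈ T := by
  have e : Subgroup.closure A ⊔ gam G (i + 1) = Subgroup.closure (A ∪ gam G (i + 1)) := by
    rw [Subgroup.closure_union, Subgroup.closure_eq]
  rw [e] at ha
  suffices hs : a ∈ gam G i ∧ ⁅a, b⁆ ∈ T from hs.2
  induction ha using Subgroup.closure_induction with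
  | mem x hx =>
    rcases hx with hx | hx
    · exact ⟨hA hx, h x hx⟩
    · exact ⟨gam_antitone (Nat.le_succ i) hx,
        hT (commutator_mem_gam (by omega) hj (by omega) hx hb)⟩
  | one => simp [one_mem]
  | mul x y _ _ hx hy =>
    refine ⟨mul_mem hx.1 hy.1, ?_⟩
    rw [commutatorElement_mul_left_eq_conj_mul]
    exact mul_mem (conj_mem_of_gam_le (by omega) hT
      (commutator_mem_gam hi hj le_rfl hy.1 hb) hy.2 x) hx.2
  | inv x _ hx =>
    refine ⟨inv_mem hx.1, ?_⟩
    rw [commutatorElement_inv_left, ← commutatorElement_inv]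
    have := conj_mem_of_gam_le (by omega) hT
      (inv_mem (commutator_mem_gam hi hj le_rfl hx.1 hb)) (inv_mem hx.2) x⁻¹
    simpa using this

theorem commutator_closure_right_mem {i j : ℕ} (hi : 1 ≤ i) (hj : 1 ≤ j) {T : Subgroup G}
    (hT : gam G (i + j + 1) ≤ T) {B : Set G} (hB : B ⊆ gam G j) {a : G} (ha : a ∈ gam G i)
    (h : ∀ b ∈ B, ⁅a, b⁆ ∈ T) {b : G} (hb : b ∈ Subgroup.closure B ⊔ gam G (j + 1)) :
    ⁅a, b⁆ ∈ T := by
  rw [← commutatorElement_inv, inv_mem_iff]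
  refine commutator_closure_left_mem hj hi (by rwa [Nat.add_comm j i]) hB ha (fun x hx => ?_) hb
  rw [← commutatorElement_inv, inv_mem_iff]
  exact h x hx

end LowerCentral

/-! ### Lyndon brackets generate the lower central quotients -/

namespace Lyndon

open LowerCentral

variable {α : Type*} [LinearOrder α] {G : Type*} [Group G] (g : α → G)

theorem bracket_mem_gam {n : ℕ} {l : List α} (hl : l.length = n) (hne : l ≠ []) :
    bracket g l ∈ gam G n := by
  induction n using Nat.strong_induction_on generalizing l with
  | _ n ih =>
  rcases Nat.lt_or_ge l.length 2 with h | h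
  · have h0 := List.length_pos_iff.2 hne
    obtain rfl : n = 1 := by omega
    exact Subgroup.mem_top _
  · obtain ⟨u, v, rfl, hstd⟩ := exists_isStd_of_length h
    have hu := List.length_pos_iff.2 hstd.1
    have hv := List.length_pos_iff.2 hstd.2.1
    rw [List.length_append] at hl
    rw [bracket_append g hstd]
    exact commutator_mem_gam hu hv hl.ge (ih _ (by omega) rfl hstd.1)
      (ih _ (by omega) rfl hstd.2.1)

/-- The subgroup generated, modulo `γ_{n+1}(G)`, by the brackets of the Lyndon words `w` of
length `n` with `l ≤ w < v`. -/
def span (n : ℕ) (l v : List α) : Subgroup G :=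
  Subgroup.closure (bracket g '' {w | IsLyndon w ∧ w.length = n ∧ l ≤ w ∧ w < v}) ⊔ gam G (n + 1)

theorem bracket_image_subset {n : ℕ} {W : Set (List α)} (hn : 1 ≤ n)
    (hW : ∀ w ∈ W, w.length = n) : bracket g '' W ⊆ gam G n := by
  rintro _ ⟨w, hw, rfl⟩
  refine bracket_mem_gam g (hW w hw) ?_
  rintro rfl
  have := hW [] hw
  simp at this
  omega

theorem span_mono {n : ℕ} {l l' v v' : List α} (hl : l' ≤ l) (hv : v ≤ v') :
    span g n l v ≤ span g n l' v' :=
  sup_le_sup_right (Subgroup.closure_mono (Set.image_mono fun _ hw => by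
    exact ⟨hw.1, hw.2.1, hl.trans hw.2.2.1, hw.2.2.2.trans_le hv⟩)) _

/-- If uv is not a standard factorization, then u = pq with q < v, and the Jacobi identity replaces
[[p,q],v] by [[p,v],q] and [p,[q,v]]. The inner commutators have smaller total length and expand
into brackets of Lyndon words w < v. The resulting commutators of w with q or p have larger factor
below v, so the induction on v applies. The lower bound in the span gives p < w in the second case.
-/
theorem commutator_bracket_mem_span [WellFoundedLT α] {n : ℕ} {u v : List α} (hu : IsLyndon u)
    (hv : IsLyndon v) (huv : u < v) (hn : u.length + v.length = n) :
    ⁅bracket g u, bracket g v⁆ ∈ span g n (u ++ v) v := by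
  induction n using Nat.strong_induction_on generalizing u v with
  | _ n ihn =>
  have hacc := acc_lt n v (by omega)
  induction hacc generalizing u with
  | intro v _ ihv =>
  have hulen := List.length_pos_iff.2 hu.1
  have hvlen := List.length_pos_iff.2 hv.1
  by_cases hstd : IsStd u v
  · rw [← bracket_append g hstd]
    exact Subgroup.mem_sup_left (Subgroup.subset_closure ⟨u ++ v,
      ⟨hu.append hv huv, by simpa using hn, le_rfl, hv.append_lt hu.1 huv⟩, rfl⟩)
  · have : ¬ ∀ u' u'', u = u' ++ u'' → IsStd u' u'' → v ≤ u'' :=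
      fun h => hstd (isStd_of_le hu.1 hv h)
    push Not at this
    obtain ⟨p, q, rfl, hpq, hqv⟩ := this
    have hp := hpq.lyndon_left hu
    have hq := hpq.lyndon_right
    have hplen := List.length_pos_iff.2 hp.1
    have hqlen := List.length_pos_iff.2 hq.1
    have hpltq := hpq.lt hu
    have hpv := hpltq.trans hqv
    rw [List.length_append] at hn hulen
    rw [bracket_append g hpq]
    refine jacobi_mem (i := p.length) (j := q.length) (k := v.length) hplen hqlen hvlen hn.symm
      le_sup_right (bracket_mem_gam g rfl hp.1) (bracket_mem_gam g rfl hq.1)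
      (bracket_mem_gam g rfl hv.1) ?_ ?_
    · have h1 := ihn (p.length + v.length) (by omega) hp hv hpv rfl
      refine commutator_closure_left_mem (i := p.length + v.length) (j := q.length) (by omega) hqlen
        ?_ (bracket_image_subset g (by omega) fun w hw => hw.2.1) (bracket_mem_gam g rfl hq.1)
        ?_ h1
      · rw [show p.length + v.length + q.length = n by omega]
        exact le_sup_right
      · rintro _ ⟨w, ⟨hw, hwlen, hlw, hwv⟩, rfl⟩
        rcases lt_trichotomy w q with h | h | h
        · refine span_mono g ?_ hqv.le
            (ihv q ⟨hqv, by omega⟩ hw hq h (by omega))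
          -- Lower bound for the new words: pqv < pvq ≤ wq, the latter because pv ≤ w have equal
          -- length.
          have h2 : q ++ v < v ++ q :=
            (hv.append_lt hq.1 hqv).trans (lt_append_self v hq.1)
          calc p ++ q ++ v = p ++ (q ++ v) := by simp
            _ ≤ p ++ (v ++ q) := ((append_lt_append_iff p).2 h2).le
            _ = (p ++ v) ++ q := by simp
            _ ≤ w ++ q := by
              rcases hlw.eq_or_lt with h3 | h3
              · rw [h3]
              · exact (append_lt_append_of_length_eq h3 (by simp [hwlen]) q q).le
        · rw [h, commutatorElement_self]
          exact one_mem _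
        · rw [← commutatorElement_inv, inv_mem_iff]
          refine span_mono g ?_ hwv.le (ihv w ⟨hwv, by omega⟩ hq hw h (by omega))
          have h2 : p ++ q < q := hu.2 p q hp.1 hq.1 rfl
          exact (append_lt_append_of_length_lt h2 (by simp; omega) v w).le
    · have h1 := ihn (q.length + v.length) (by omega) hq hv hqv rfl
      refine commutator_closure_right_mem (i := p.length) (j := q.length + v.length) hplen
        (by omega) ?_ (bracket_image_subset g (by omega) fun w hw => hw.2.1)
        (bracket_mem_gam g rfl hp.1) ?_ h1
      · rw [show p.length + (q.length + v.length) = n by omega]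
        exact le_sup_right
      · rintro _ ⟨w, ⟨hw, hwlen, hlw, hwv⟩, rfl⟩
        have hpw : p < w := (hpltq.trans_le (le_append_self q v)).trans_le hlw
        refine span_mono g ?_ hwv.le (ihv w ⟨hwv, by omega⟩ hp hw hpw (by omega))
        rw [List.append_assoc]
        rcases hlw.eq_or_lt with h3 | h3
        · rw [h3]
        · exact ((append_lt_append_iff p).2 h3).le

/-- The brackets of the Lyndon words of length `n` generate `γ_n(G)` modulo `γ_{n+1}(G)`. -/
theorem gam_le_closure_bracket [WellFoundedLT α] (hg : Subgroup.closure (Set.range g) = ⊤) {n : ℕ}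
    (hn : 1 ≤ n) : gam G n ≤
      Subgroup.closure (bracket g '' {w | IsLyndon w ∧ w.length = n}) ⊔ gam G (n + 1) := by
  induction n, hn using Nat.le_induction with
  | base =>
    refine le_trans ?_ le_sup_left
    rw [gam, Nat.sub_self, Subgroup.lowerCentralSeries_zero, ← hg]
    refine Subgroup.closure_mono ?_
    rintro _ ⟨a, rfl⟩
    exact ⟨[a], ⟨isLyndon_singleton a, rfl⟩, bracket_singleton g a⟩
  | succ n hn ih =>
    have e : gam G (n + 1) = ⁅gam G n, ⊤⁆ := by
      obtain ⟨m, rfl⟩ : ∃ m, n = m + 1 := ⟨n - 1, by omega⟩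
      rfl
    rw [e, Subgroup.commutator_le]
    intro a ha b _
    refine commutator_closure_left_mem (j := 1) hn le_rfl le_sup_right
      (bracket_image_subset g hn fun w hw => hw.2) (Subgroup.mem_top b) ?_ (ih ha)
    rintro _ ⟨w, ⟨hw, hwlen⟩, rfl⟩
    refine commutator_closure_right_mem (j := 1) (B := Set.range g) hn le_rfl le_sup_right
      (fun _ _ => Subgroup.mem_top _) (bracket_mem_gam g hwlen hw.1) ?_
      (Subgroup.mem_sup_left (hg ▸ Subgroup.mem_top b))
    rintro _ ⟨x, rfl⟩
    have hle : ∀ l v, span g (n + 1) l v ≤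
        Subgroup.closure (bracket g '' {w | IsLyndon w ∧ w.length = n + 1}) ⊔
          gam G (n + 1 + 1) := fun l v =>
      sup_le_sup_right (Subgroup.closure_mono (Set.image_mono fun _ hw => by
        exact ⟨hw.1, hw.2.1⟩)) _
    have hx := isLyndon_singleton x
    rw [← bracket_singleton g x]
    rcases lt_trichotomy w [x] with h | h | h
    · exact hle _ _ (commutator_bracket_mem_span g hw hx h (by simp [hwlen]))
    · rw [h, commutatorElement_self]
      exact one_mem _
    · rw [← commutatorElement_inv, inv_mem_iff]
      exact hle _ _ (commutator_bracket_mem_span g hx hw h (by simp [hwlen, Nat.add_comm]))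

end Lyndon

/-! ### The Magnus embedding -/

/-- Formal power series with integral coefficients in noncommuting variables from `α`. -/
structure NCSeries (α : Type*) where
  /-- The coefficients. -/
  coeff : List α → ℤ

namespace NCSeries

variable {α : Type*}

@[ext]
theorem ext {f g : NCSeries α} (h : ∀ w, f.coeff w = g.coeff w) : f = g := by
  cases f
  cases g
  congr
  funext w
  exact h w

/-- The left division by a variable. -/
def leftDiv (a : α) (f : NCSeries α) : NCSeries α := ⟨fun w => f.coeff (a :: w)⟩

/-- The coefficients of a product. -/
def mulCoeff (f g : NCSeries α) : List α → ℤ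
  | [] => f.coeff [] * g.coeff []
  -- The product rule a⁻¹(fg) = f(∅)·a⁻¹g + (a⁻¹f)g for left division; the recursion avoids sums
  -- over the splittings of a word.
  | a :: w => f.coeff [] * g.coeff (a :: w) + mulCoeff (leftDiv a f) g w

instance : Zero (NCSeries α) := ⟨⟨fun _ => 0⟩⟩
instance : One (NCSeries α) := ⟨⟨fun w => if w.isEmpty then 1 else 0⟩⟩
instance : Add (NCSeries α) := ⟨fun f g => ⟨fun w => f.coeff w + g.coeff w⟩⟩
instance : Neg (NCSeries α) := ⟨fun f => ⟨fun w => -f.coeff w⟩⟩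
instance : Mul (NCSeries α) := ⟨fun f g => ⟨mulCoeff f g⟩⟩

@[simp] theorem coeff_zero (w : List α) : (0 : NCSeries α).coeff w = 0 := rfl
@[simp] theorem coeff_add (f g : NCSeries α) (w : List α) :
    (f + g).coeff w = f.coeff w + g.coeff w := rfl
@[simp] theorem coeff_neg (f : NCSeries α) (w : List α) : (-f).coeff w = -f.coeff w := rfl
@[simp] theorem coeff_one_nil : (1 : NCSeries α).coeff [] = 1 := rfl
@[simp] theorem coeff_one_cons (a : α) (w : List α) : (1 : NCSeries α).coeff (a :: w) = 0 := rfl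
@[simp] theorem coeff_leftDiv (a : α) (f : NCSeries α) (w : List α) :
    (leftDiv a f).coeff w = f.coeff (a :: w) := rfl
@[simp] theorem coeff_mul_nil (f g : NCSeries α) :
    (f * g).coeff [] = f.coeff [] * g.coeff [] := rfl
@[simp] theorem coeff_mul_cons (f g : NCSeries α) (a : α) (w : List α) :
    (f * g).coeff (a :: w) = f.coeff [] * g.coeff (a :: w) + (leftDiv a f * g).coeff w := rfl

theorem coeff_add_mul (f g h : NCSeries α) (w : List α) :
    ((f + g) * h).coeff w = (f * h).coeff w + (g * h).coeff w := by
  induction w generalizing f g with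
  | nil => simp [add_mul]
  | cons a w ih =>
    have e : leftDiv a (f + g) = leftDiv a f + leftDiv a g := rfl
    rw [coeff_mul_cons, coeff_mul_cons, coeff_mul_cons, e, ih, coeff_add]
    ring

theorem coeff_mul_add (f g h : NCSeries α) (w : List α) :
    (f * (g + h)).coeff w = (f * g).coeff w + (f * h).coeff w := by
  induction w generalizing f with
  | nil => simp [mul_add]
  | cons a w ih =>
    rw [coeff_mul_cons, coeff_mul_cons, coeff_mul_cons, ih, coeff_add]
    ring

theorem coeff_zero_mul (f : NCSeries α) (w : List α) : (0 * f).coeff w = 0 := by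
  induction w with
  | nil => simp
  | cons a w ih =>
    have e : leftDiv a (0 : NCSeries α) = 0 := rfl
    rw [coeff_mul_cons, e, ih]
    simp

theorem coeff_mul_zero (f : NCSeries α) (w : List α) : (f * 0).coeff w = 0 := by
  induction w generalizing f with
  | nil => simp
  | cons a w ih => simp [ih]

theorem coeff_one_mul (f : NCSeries α) (w : List α) : (1 * f).coeff w = f.coeff w := by
  cases w with
  | nil => simp
  | cons a w =>
    have e : leftDiv a (1 : NCSeries α) = 0 := rfl
    rw [coeff_mul_cons, e, coeff_zero_mul]
    simp

theorem coeff_mul_one (f : NCSeries α) (w : List α) : (f * 1).coeff w = f.coeff w := by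
  induction w generalizing f with
  | nil => simp
  | cons a w ih => simp [ih]

theorem coeff_smul_mul (n : ℤ) (f g : NCSeries α) (w : List α) :
    ((⟨fun w => n * f.coeff w⟩ : NCSeries α) * g).coeff w = n * (f * g).coeff w := by
  induction w generalizing f with
  | nil => simp [mul_assoc]
  | cons a w ih =>
    rw [coeff_mul_cons, coeff_mul_cons]
    have := ih (leftDiv a f)
    rw [mul_add, ← this]
    simp only [mul_assoc]
    rfl

theorem coeff_mul_assoc (f g h : NCSeries α) (w : List α) :
    (f * g * h).coeff w = (f * (g * h)).coeff w := by
  induction w generalizing f with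
  | nil => simp [mul_assoc]
  | cons a w ih =>
    have e : leftDiv a (f * g) =
        ⟨fun w => f.coeff [] * (leftDiv a g).coeff w⟩ + leftDiv a f * g := rfl
    rw [coeff_mul_cons, coeff_mul_cons, e, coeff_add_mul, coeff_smul_mul, ih, coeff_mul_cons,
      coeff_mul_nil]
    ring

instance : Ring (NCSeries α) where
  add_assoc f g h := ext fun w => add_assoc _ _ _
  zero_add f := ext fun w => zero_add _
  add_zero f := ext fun w => add_zero _
  add_comm f g := ext fun w => add_comm _ _
  neg_add_cancel f := ext fun w => neg_add_cancel _
  nsmul := nsmulRec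
  zsmul := zsmulRec
  left_distrib f g h := ext (coeff_mul_add f g h)
  right_distrib f g h := ext (coeff_add_mul f g h)
  zero_mul f := ext (coeff_zero_mul f)
  mul_zero f := ext (coeff_mul_zero f)
  one_mul f := ext (coeff_one_mul f)
  mul_one f := ext (coeff_mul_one f)
  mul_assoc f g h := ext (coeff_mul_assoc f g h)

@[simp] theorem coeff_sub (f g : NCSeries α) (w : List α) :
    (f - g).coeff w = f.coeff w - g.coeff w := by
  rw [sub_eq_add_neg, coeff_add, coeff_neg, sub_eq_add_neg]

/-- The series without terms of degree less than `n`. -/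
def HasOrder (n : ℕ) (f : NCSeries α) : Prop := ∀ w : List α, w.length < n → f.coeff w = 0

theorem HasOrder.mono {m n : ℕ} (h : m ≤ n) {f : NCSeries α} (hf : HasOrder n f) : HasOrder m f :=
  fun w hw => hf w (hw.trans_le h)

theorem hasOrder_zero (f : NCSeries α) : HasOrder 0 f := fun _ h => absurd h (Nat.not_lt_zero _)

theorem HasOrder.add {n : ℕ} {f g : NCSeries α} (hf : HasOrder n f) (hg : HasOrder n g) :
    HasOrder n (f + g) := fun w hw => by rw [coeff_add, hf w hw, hg w hw, add_zero]

theorem HasOrder.neg {n : ℕ} {f : NCSeries α} (hf : HasOrder n f) : HasOrder n (-f) :=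
  fun w hw => by rw [coeff_neg, hf w hw, neg_zero]

theorem HasOrder.sub {n : ℕ} {f g : NCSeries α} (hf : HasOrder n f) (hg : HasOrder n g) :
    HasOrder n (f - g) := fun w hw => by rw [coeff_sub, hf w hw, hg w hw, sub_zero]

theorem coeff_mul_of_hasOrder_right {f g : NCSeries α} {v : List α} (hg : HasOrder v.length g) :
    (f * g).coeff v = f.coeff [] * g.coeff v := by
  induction v generalizing f with
  | nil => rfl
  | cons a v ih =>
    rw [coeff_mul_cons, ih (hg.mono (by simp)), hg v (by simp), mul_zero, add_zero]

/-- Only the splitting at u contributes: an earlier one meets a vanishing coefficient of f, a later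
one a vanishing coefficient of g. -/
theorem coeff_mul_append {f g : NCSeries α} {u v : List α} (hf : HasOrder u.length f)
    (hg : HasOrder v.length g) : (f * g).coeff (u ++ v) = f.coeff u * g.coeff v := by
  induction u generalizing f with
  | nil => exact coeff_mul_of_hasOrder_right hg
  | cons a u ih =>
    rw [List.cons_append, coeff_mul_cons, hf [] (by simp), zero_mul, zero_add, ih]
    · rfl
    · intro w hw
      exact hf (a :: w) (by simpa using hw)

theorem HasOrder.mul {i j : ℕ} {f g : NCSeries α} (hf : HasOrder i f) (hg : HasOrder j g) :
    HasOrder (i + j) (f * g) := by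
  intro w hw
  rw [← List.take_append_drop i w]
  rcases lt_or_ge w.length i with h | h
  · rw [List.take_of_length_le h.le, List.drop_of_length_le h.le,
      coeff_mul_append (v := []) (hf.mono h.le) (hasOrder_zero g), hf w h, zero_mul]
  · have h1 : (w.take i).length = i := List.length_take_of_le h
    have h2 : (w.drop i).length < j := by rw [List.length_drop]; omega
    rw [coeff_mul_append (hf.mono h1.le) (hg.mono h2.le), hg _ h2, mul_zero]

theorem HasOrder.mul_right {i : ℕ} {f : NCSeries α} (hf : HasOrder i f) (g : NCSeries α) :
    HasOrder i (f * g) := by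
  simpa using hf.mul (hasOrder_zero g)

theorem coeff_mul_of_hasOrder_left {f g : NCSeries α} {u : List α} (hf : HasOrder u.length f) :
    (f * g).coeff u = f.coeff u * g.coeff [] := by
  have := coeff_mul_append (v := []) hf (hasOrder_zero g)
  rwa [List.append_nil] at this

variable [DecidableEq α]

/-- A variable. -/
def X (a : α) : NCSeries α := ⟨fun w => if w = [a] then 1 else 0⟩

/-- The inverse of `1 + X a`. -/
def invOneAddX (a : α) : NCSeries α :=
  ⟨fun w => w.foldr (fun b n => if b = a then -n else 0) 1⟩

theorem leftDiv_X (a b : α) : leftDiv b (X a) = if b = a then 1 else 0 := by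
  ext w
  split_ifs with h
  · subst h
    cases w <;> simp [X]
  · simp [X, h]

theorem leftDiv_invOneAddX (a b : α) :
    leftDiv b (invOneAddX a) = if b = a then -invOneAddX a else 0 := by
  ext w
  split_ifs with h <;> simp [invOneAddX, h]

theorem one_add_X_mul_inv (a : α) : (1 + X a) * invOneAddX a = 1 := by
  rw [add_mul, one_mul]
  ext w
  cases w with
  | nil => simp [X, invOneAddX]
  | cons b w =>
    have h := congrArg (fun f => f.coeff w) (leftDiv_invOneAddX a b)
    simp only [coeff_leftDiv] at h
    rw [coeff_add, coeff_mul_cons, h, leftDiv_X]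
    split_ifs <;> simp [X]

theorem inv_mul_one_add_X (a : α) : invOneAddX a * (1 + X a) = 1 := by
  rw [mul_add, mul_one]
  ext w
  induction w with
  | nil => simp [X, invOneAddX]
  | cons b w ih =>
    have h := congrArg (fun f => f.coeff w) (leftDiv_invOneAddX a b)
    have h' := congrArg (fun f => f.coeff w) (leftDiv_X a b)
    simp only [coeff_leftDiv] at h h'
    rw [coeff_add, coeff_mul_cons, h, h', leftDiv_invOneAddX]
    rw [coeff_add] at ih
    split_ifs
    · rw [neg_mul, coeff_neg, coeff_neg, coeff_one_cons, ← ih]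
      simp [invOneAddX]
    · simp

/-- The unit `1 + X a`. -/
def oneAddX (a : α) : (NCSeries α)ˣ := ⟨1 + X a, invOneAddX a, one_add_X_mul_inv a, inv_mul_one_add_X a⟩

/-- The Magnus embedding. -/
def magnus : FreeGroup α →* (NCSeries α)ˣ := FreeGroup.lift oneAddX

/-- The deviation of the Magnus embedding from `1`. -/
def dev (g : FreeGroup α) : NCSeries α := (magnus g : NCSeries α) - 1

theorem dev_of (a : α) : dev (FreeGroup.of a) = X a := by
  simp [dev, magnus, oneAddX]

theorem dev_one : dev (1 : FreeGroup α) = 0 := by simp [dev]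

theorem dev_mul (g h : FreeGroup α) : dev (g * h) = dev g + dev h + dev g * dev h := by
  simp only [dev, map_mul, Units.val_mul]
  noncomm_ring

theorem dev_inv (g : FreeGroup α) :
    dev g⁻¹ = -dev g + dev g * dev g * (↑(magnus g)⁻¹ : NCSeries α) := by
  have h : (magnus g : NCSeries α) * (↑(magnus g)⁻¹ : NCSeries α) = 1 := Units.mul_inv _
  simp only [dev, map_inv, sub_mul, mul_sub, one_mul, mul_one, mul_assoc, h]
  abel

/-- Write [g,h] - 1 = (gh - hg)(hg)⁻¹; the constant and linear parts of gh - hg cancel. -/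
theorem dev_commutator (g h : FreeGroup α) :
    dev ⁅g, h⁆ = (dev g * dev h - dev h * dev g) * (magnus (h * g)⁻¹ : NCSeries α) := by
  have h1 : (magnus (h * g) : NCSeries α) * (magnus (h * g)⁻¹ : NCSeries α) = 1 := by
    rw [← Units.val_mul, ← map_mul]
    simp
  have h2 : dev g * dev h - dev h * dev g =
      (magnus (g * h) : NCSeries α) - (magnus (h * g) : NCSeries α) := by
    simp only [dev, map_mul, Units.val_mul]
    noncomm_ring
  rw [h2, sub_mul, h1, dev, ← Units.val_mul, ← map_mul]
  simp [commutatorElement_def, mul_assoc]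

/-- The dimension subgroups of the free group. -/
def dimSubgroup (n : ℕ) : Subgroup (FreeGroup α) where
  carrier := {g | HasOrder n (dev g)}
  one_mem' := by
    intro w _
    rw [dev_one, coeff_zero]
  mul_mem' {g h} hg hh := by
    change HasOrder n _
    rw [dev_mul]
    exact (hg.add hh).add (hg.mul_right _)
  inv_mem' {g} hg := by
    change HasOrder n _
    rw [dev_inv]
    exact hg.neg.add ((hg.mul_right _).mul_right _)

theorem mem_dimSubgroup {n : ℕ} {g : FreeGroup α} : g ∈ dimSubgroup n ↔ HasOrder n (dev g) :=
  Iff.rfl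

theorem mem_dimSubgroup_one (g : FreeGroup α) : g ∈ dimSubgroup 1 := by
  induction g using FreeGroup.induction_on with
  | C1 => exact one_mem _
  | of a =>
    intro w hw
    obtain rfl := List.length_eq_zero_iff.1 (Nat.lt_one_iff.1 hw)
    simp [dev_of, X]
  | inv_of a ha => exact inv_mem ha
  | mul g h hg hh => exact mul_mem hg hh

theorem coeff_magnus_nil (g : FreeGroup α) : (magnus g : NCSeries α).coeff [] = 1 := by
  have := mem_dimSubgroup_one g [] (by simp)
  rw [dev, coeff_sub, coeff_one_nil] at this
  omega

/-- Every deviation has order at least 1, so the product of the two deviations starts in degree n +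
1. Coefficients of leading terms are thus additive. -/
theorem coeff_dev_mul {n : ℕ} {g h : FreeGroup α} (hg : g ∈ dimSubgroup n)
    {w : List α} (hw : w.length = n) :
    (dev (g * h)).coeff w = (dev g).coeff w + (dev h).coeff w := by
  rw [dev_mul, coeff_add, coeff_add,
    (HasOrder.mul hg (mem_dimSubgroup_one h)) w (by omega), add_zero]

theorem coeff_dev_inv {n : ℕ} {g : FreeGroup α} (hg : g ∈ dimSubgroup n)
    {w : List α} (hw : w.length = n) : (dev g⁻¹).coeff w = -(dev g).coeff w := by
  rw [dev_inv, coeff_add, coeff_neg,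
    ((HasOrder.mul hg (mem_dimSubgroup_one g)).mul_right _) w (by omega), add_zero]

theorem coeff_dev_zpow {n : ℕ} {g : FreeGroup α} (hg : g ∈ dimSubgroup n)
    {w : List α} (hw : w.length = n) (k : ℤ) : (dev (g ^ k)).coeff w = k * (dev g).coeff w := by
  induction k using Int.induction_on with
  | zero => simp [dev_one]
  | succ k ih => rw [zpow_add_one, coeff_dev_mul (zpow_mem hg _) hw, ih]; ring
  | pred k ih =>
    rw [zpow_sub_one, coeff_dev_mul (zpow_mem hg _) hw, ih, coeff_dev_inv hg hw]; ring

theorem commutator_mem_dimSubgroup {i j : ℕ} {g h : FreeGroup α} (hg : g ∈ dimSubgroup i)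
    (hh : h ∈ dimSubgroup j) : ⁅g, h⁆ ∈ dimSubgroup (i + j) := by
  rw [mem_dimSubgroup, dev_commutator]
  refine HasOrder.mul_right (HasOrder.sub (HasOrder.mul hg hh) ?_) _
  rw [Nat.add_comm]
  exact HasOrder.mul hh hg

/-- In degree i + j the commutator becomes the Lie bracket of the leading terms, since the unit
factor has constant term 1. The same word has to be split in two ways, after i and after j letters.
-/
theorem coeff_dev_commutator {i j : ℕ} {g h : FreeGroup α} (hg : g ∈ dimSubgroup i)
    (hh : h ∈ dimSubgroup j) {u v u' v' : List α} (hu : u.length = i) (hv : v.length = j)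
    (hu' : u'.length = i) (hv' : v'.length = j) (e : u ++ v = v' ++ u') :
    (dev ⁅g, h⁆).coeff (u ++ v) =
      (dev g).coeff u * (dev h).coeff v - (dev h).coeff v' * (dev g).coeff u' := by
  subst hu hv
  rw [dev_commutator, coeff_mul_of_hasOrder_left, coeff_magnus_nil, mul_one, coeff_sub,
    coeff_mul_append hg hh, e]
  · rw [coeff_mul_append]
    · exact HasOrder.mono hv'.le hh
    · exact HasOrder.mono hu'.le hg
  · rw [List.length_append]
    refine HasOrder.sub (HasOrder.mul hg hh) ?_
    rw [Nat.add_comm]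
    exact HasOrder.mul hh hg

end NCSeries

/-! ### Magnus' theorem on dimension subgroups -/

namespace Lyndon

open LowerCentral NCSeries

section

variable {α : Type*} [DecidableEq α]

theorem gam_le_dimSubgroup (n : ℕ) : gam (FreeGroup α) n ≤ dimSubgroup n := by
  rcases Nat.eq_zero_or_pos n with rfl | hn
  · exact fun g _ => hasOrder_zero _
  · induction n, hn using Nat.le_induction with
    | base => exact fun g _ => mem_dimSubgroup_one g
    | succ n hn ih =>
      obtain ⟨m, rfl⟩ : ∃ m, n = m + 1 := ⟨n - 1, by omega⟩
      change ⁅gam (FreeGroup α) (m + 1), ⊤⁆ ≤ _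
      rw [Subgroup.commutator_le]
      exact fun g hg h _ => commutator_mem_dimSubgroup (ih hg) (mem_dimSubgroup_one h)

end

variable {α : Type*} [LinearOrder α]

/-- The bracket of a Lyndon word in the free group. -/
noncomputable abbrev freeBracket (l : List α) : FreeGroup α := bracket FreeGroup.of l

theorem freeBracket_mem_dimSubgroup {l : List α} (hl : l ≠ []) :
    freeBracket l ∈ dimSubgroup l.length :=
  gam_le_dimSubgroup _ (bracket_mem_gam _ rfl hl)

theorem append_lt_append_cases {u v u' v' : List α} (hu : u'.length = u.length)
    (h : u' ++ v' < u ++ v) : u' < u ∨ u' = u ∧ v' < v := by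
  rcases lt_trichotomy u' u with h' | h' | h'
  · exact Or.inl h'
  · subst h'
    exact Or.inr ⟨rfl, (append_lt_append_iff _).1 h⟩
  · exact absurd h (append_lt_append_of_length_eq h' hu v v').not_gt

/-- The term of least degree of the bracket of a Lyndon word `l` is `l` plus greater words. -/
theorem coeff_dev_freeBracket {n : ℕ} {l : List α} (hl : IsLyndon l) (hn : l.length = n) :
    (dev (freeBracket l)).coeff l = 1 ∧
      ∀ w, w.length = n → w < l → (dev (freeBracket l)).coeff w = 0 := by
  induction n using Nat.strong_induction_on generalizing l with
  | _ n ih =>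
  rcases Nat.lt_or_ge l.length 2 with h | h
  · have h0 := List.length_pos_iff.2 hl.1
    obtain ⟨a, rfl⟩ := List.length_eq_one_iff.1 (by omega : l.length = 1)
    rw [freeBracket, bracket_singleton, dev_of]
    refine ⟨by simp [X], fun w _ hw => ?_⟩
    simp [X, hw.ne]
  · obtain ⟨u, v, rfl, hstd⟩ := exists_isStd_of_length h
    have hu := hstd.lyndon_left hl
    have hv := hstd.lyndon_right
    have hulen := List.length_pos_iff.2 hu.1
    have hvlen := List.length_pos_iff.2 hv.1
    rw [List.length_append] at hn
    obtain ⟨hu1, hu2⟩ := ih u.length (by omega) hu rfl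
    obtain ⟨hv1, hv2⟩ := ih v.length (by omega) hv rfl
    have hlt : u ++ v < v ++ u :=
      (hv.append_lt hu.1 (hstd.lt hl)).trans (lt_append_self v hu.1)
    have hsplit : ∀ w : List α, w.length = n → ∃ v' u', w = v' ++ u' ∧ v'.length = v.length ∧
        u'.length = u.length := fun w hw =>
      ⟨w.take v.length, w.drop v.length, (List.take_append_drop _ _).symm,
        List.length_take_of_le (by omega), by rw [List.length_drop]; omega⟩
    -- The subtracted term of the Lie bracket starts at vu, which is greater than uv, so it does not
    -- interfere.
    have hsecond : ∀ v' u' : List α, v'.length = v.length → v' ++ u' ≤ u ++ v →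
        u'.length = u.length →
        (dev (freeBracket v)).coeff v' * (dev (freeBracket u)).coeff u' = 0 := by
      intro v' u' hv' hle hu'
      rcases append_lt_append_cases hv' (hle.trans_lt hlt) with h1 | ⟨_, h1⟩
      · rw [hv2 v' hv' h1, zero_mul]
      · rw [hu2 u' hu' h1, mul_zero]
    rw [freeBracket, bracket_append _ hstd]
    have hcoeff := fun u₁ v₁ u' v' => coeff_dev_commutator (freeBracket_mem_dimSubgroup hu.1)
      (freeBracket_mem_dimSubgroup hv.1) (u := u₁) (v := v₁) (u' := u') (v' := v')
    constructor
    · obtain ⟨v', u', e, hv', hu'⟩ := hsplit (u ++ v) (by simpa using hn)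
      rw [hcoeff u v u' v' rfl rfl hu' hv' e, hu1, hv1, hsecond v' u' hv' e.ge hu']
      simp
    · intro w hw hwlt
      obtain ⟨v', u', e, hv', hu'⟩ := hsplit w hw
      have hw1 : (w.take u.length).length = u.length := List.length_take_of_le (by omega)
      have hw2 : (w.drop u.length).length = v.length := by rw [List.length_drop]; omega
      have hw12 := List.take_append_drop u.length w
      rw [← hw12, hcoeff _ _ u' v' hw1 hw2 hu' hv' (hw12.trans e),
        hsecond v' u' hv' (e ▸ hwlt.le) hu', sub_zero]
      rw [← hw12] at hwlt
      rcases append_lt_append_cases hw1 hwlt with h1 | ⟨_, h1⟩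
      · rw [hu2 _ hw1 h1, zero_mul]
      · rw [hv2 _ hw2 h1, mul_zero]

/-- Triangularity: the coefficient at the least word a of s is the exponent of the bracket of a,
because the brackets of greater words do not involve a. It vanishes when g has order n + 1, so a can
be discarded. -/
theorem mem_gam_of_mem_closure_finset {n : ℕ} (hn : 1 ≤ n) (s : Finset (List α))
    (hs : ∀ w ∈ s, IsLyndon w ∧ w.length = n) {g : FreeGroup α}
    (hg : g ∈ Subgroup.closure (freeBracket '' (s : Set (List α))) ⊔ gam (FreeGroup α) (n + 1))
    (hdim : g ∈ dimSubgroup (n + 1)) : g ∈ gam (FreeGroup α) (n + 1) := by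
  induction s using Finset.induction_on_min generalizing g with
  | empty => simpa using hg
  | insert a s ha ih =>
    have hs' : ∀ w ∈ s, IsLyndon w ∧ w.length = n := fun w hw => hs w (Finset.mem_insert_of_mem hw)
    obtain ⟨hal, halen⟩ := hs a (Finset.mem_insert_self a s)
    set C := Subgroup.closure (freeBracket '' (s : Set (List α))) ⊔ gam (FreeGroup α) (n + 1)
      with hC
    have hCle : C ≤ gam (FreeGroup α) n := by
      refine sup_le ?_ (gam_antitone (Nat.le_succ n))
      rw [Subgroup.closure_le]
      exact bracket_image_subset _ hn fun w hw => (hs' w hw).2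
    have hnormal : C.Normal :=
      ⟨fun x hx y => conj_mem_of_gam_le hn le_sup_right (hCle hx) hx y⟩
    have he : Subgroup.closure (freeBracket '' ((insert a s : Finset (List α)) : Set (List α))) ⊔
        gam (FreeGroup α) (n + 1) = Subgroup.zpowers (freeBracket a) ⊔ C := by
      rw [Finset.coe_insert, Set.image_insert_eq, Set.insert_eq, Subgroup.closure_union,
        ← Subgroup.zpowers_eq_closure, sup_assoc]
    rw [he] at hg
    obtain ⟨y, hy, h, hh, rfl⟩ := Subgroup.mem_sup_of_normal_right.1 hg
    obtain ⟨k, rfl⟩ := Subgroup.mem_zpowers_iff.1 hy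
    have hadim : freeBracket a ∈ dimSubgroup n := halen ▸ freeBracket_mem_dimSubgroup hal.1
    have hh0 : h ∈ dimSubgroup n ∧ (dev h).coeff a = 0 := by
      let K : Subgroup (FreeGroup α) :=
        { carrier := {h | h ∈ dimSubgroup n ∧ (dev h).coeff a = 0}
          one_mem' := ⟨one_mem _, by rw [dev_one, coeff_zero]⟩
          mul_mem' := fun {x y} hx hy => ⟨mul_mem hx.1 hy.1, by
            rw [coeff_dev_mul hx.1 halen, hx.2, hy.2, add_zero]⟩
          inv_mem' := fun {x} hx => ⟨inv_mem hx.1, by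
            rw [coeff_dev_inv hx.1 halen, hx.2, neg_zero]⟩ }
      suffices hCK : C ≤ K from hCK hh
      refine sup_le ?_ fun x hx => ?_
      · rw [Subgroup.closure_le]
        rintro _ ⟨w, hw, rfl⟩
        obtain ⟨hwl, hwlen⟩ := hs' w hw
        exact ⟨hwlen ▸ freeBracket_mem_dimSubgroup hwl.1,
          (coeff_dev_freeBracket hwl hwlen).2 a halen (ha w hw)⟩
      · have hx' := gam_le_dimSubgroup _ hx
        exact ⟨HasOrder.mono (Nat.le_succ n) hx', hx' a (by omega)⟩
    have hk : k = 0 := by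
      have h1 := hdim a (by omega)
      rw [coeff_dev_mul (zpow_mem hadim k) halen, coeff_dev_zpow hadim halen, hh0.2,
        (coeff_dev_freeBracket hal halen).1] at h1
      simpa using h1
    subst hk
    rw [zpow_zero, one_mul] at hdim ⊢
    exact ih hs' hh hdim

theorem exists_finset_of_mem_closure {G : Type*} [Group G] {ι : Type*} (f : ι → G) {S : Set ι}
    {g : G} (hg : g ∈ Subgroup.closure (f '' S)) :
    ∃ s : Finset ι, (s : Set ι) ⊆ S ∧ g ∈ Subgroup.closure (f '' (s : Set ι)) := by
  classical
  induction hg using Subgroup.closure_induction with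
  | mem x hx =>
    obtain ⟨i, hi, rfl⟩ := hx
    exact ⟨{i}, by simpa using hi, Subgroup.subset_closure ⟨i, by simp, rfl⟩⟩
  | one => exact ⟨∅, by simp, one_mem _⟩
  | mul x y _ _ hx hy =>
    obtain ⟨s, hs, hx⟩ := hx
    obtain ⟨t, ht, hy⟩ := hy
    refine ⟨s ∪ t, by simp [hs, ht], mul_mem ?_ ?_⟩
    · exact Subgroup.closure_mono (Set.image_mono (by simp)) hx
    · exact Subgroup.closure_mono (Set.image_mono (by simp)) hy
  | inv x _ hx =>
    obtain ⟨s, hs, hx⟩ := hx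
    exact ⟨s, hs, inv_mem hx⟩

/-- **Magnus' theorem**: the dimension subgroups of a free group are the terms of its lower
central series. -/
theorem dimSubgroup_le_gam [WellFoundedLT α] (n : ℕ) :
    dimSubgroup n ≤ gam (FreeGroup α) n := by
  rcases Nat.eq_zero_or_pos n with rfl | hn
  · exact fun g _ => Subgroup.mem_top g
  · induction n, hn using Nat.le_induction with
    | base => exact fun g _ => Subgroup.mem_top g
    | succ n hn ih =>
      intro g hg
      have h1 := gam_le_closure_bracket (FreeGroup.of : α → FreeGroup α)
        (FreeGroup.closure_range_of α) hn (ih (HasOrder.mono (Nat.le_succ n) hg))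
      obtain ⟨x, hx, y, hy, rfl⟩ := Subgroup.mem_sup_of_normal_right.1 h1
      obtain ⟨s, hs, hx⟩ := exists_finset_of_mem_closure _ hx
      exact mem_gam_of_mem_closure_finset hn s (fun w hw => hs hw)
        (mul_mem (Subgroup.mem_sup_left hx) (Subgroup.mem_sup_right hy)) hg

end Lyndon

/-! ### The center of a free nilpotent group -/

namespace FreeNilpotent

open LowerCentral NCSeries

/-- The center of `F / γ_{c+1}(F)` for a free group `F` of rank at least two lies in `γ_c`. -/
theorem mem_lowerCentralSeries_of_commutator_mem {α : Type*} [Nontrivial α] {c : ℕ}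
    {w : FreeGroup α}
    (h : ∀ a, ⁅w, FreeGroup.of a⁆ ∈ (⊤ : Subgroup (FreeGroup α)).lowerCentralSeries c) :
    w ∈ (⊤ : Subgroup (FreeGroup α)).lowerCentralSeries (c - 1) := by
  obtain ⟨_, _⟩ := exists_wellFoundedLT α
  suffices hs : ∀ m, m ≤ c → w ∈ dimSubgroup m from Lyndon.dimSubgroup_le_gam c (hs c le_rfl)
  intro m hm
  rcases Nat.eq_zero_or_pos m with rfl | hpos
  · exact hasOrder_zero _
  · induction m, hpos using Nat.le_induction with
    | base => exact mem_dimSubgroup_one w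
    | succ m hpos ih =>
      have ih := ih (by omega)
      intro l hl
      rcases Nat.lt_or_ge l.length m with hlm | hlm
      · exact ih l hlm
      · have hlen : l.length = m := by omega
        obtain ⟨b, t, rfl⟩ := List.exists_cons_of_length_pos (by omega : 0 < l.length)
        obtain ⟨a, ha⟩ := exists_ne b
        -- In the leading term of [w,a] the coefficient at bta is that of w at bt: the other summand
        -- begins with a, and a ≠ b.
        have h1 := Lyndon.gam_le_dimSubgroup (c + 1) (h a) ((b :: t) ++ [a]) (by simp at hlen ⊢; omega)
        rw [coeff_dev_commutator ih (mem_dimSubgroup_one (FreeGroup.of a)) (u' := t ++ [a])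
          (v' := [b]) hlen rfl (by simpa using hlen) rfl (by simp), dev_of] at h1
        simpa [X, ha.symm] using h1

end FreeNilpotent

/-! ### Bases of free nilpotent groups -/

namespace LowerCentral

/-- The lower central series of `G`, counted from `0`. -/
abbrev lcs (G : Type*) [Group G] (k : ℕ) : Subgroup G := (⊤ : Subgroup G).lowerCentralSeries k

variable {G H : Type*} [Group G] [Group H]

theorem commutator_mem_lcs {i j n : ℕ} (hn : n ≤ i + j + 1) {a b : G} (ha : a ∈ lcs G i)
    (hb : b ∈ lcs G j) : ⁅a, b⁆ ∈ lcs G n :=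
  Subgroup.lowerCentralSeries_antitone _ hn
    (commutator_lowerCentralSeries_le i j (Subgroup.commutator_mem_commutator ha hb))

theorem lcs_le {m n : ℕ} (h : m ≤ n) : lcs G n ≤ lcs G m :=
  Subgroup.lowerCentralSeries_antitone _ h

theorem lcs_eq_bot_of_le {m n : ℕ} (h : m ≤ n) (hm : lcs G m = ⊥) : lcs G n = ⊥ :=
  le_bot_iff.1 ((lcs_le h).trans hm.le)

theorem lcs_eq_bot_of_comm {A : Type*} [CommGroup A] {c : ℕ} (hc : 1 ≤ c) : lcs A c = ⊥ := by
  refine lcs_eq_bot_of_le hc ?_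
  rw [lcs, Subgroup.lowerCentralSeries_succ, Subgroup.commutator_eq_bot_iff_le_centralizer]
  intro a _
  rw [Subgroup.mem_centralizer_iff]
  exact fun b _ => mul_comm b a

theorem map_mem_lcs (f : G →* H) {k : ℕ} {a : G} (ha : a ∈ lcs G k) : f a ∈ lcs H k :=
  map_gam_le f (k + 1) ha

theorem lcs_map_of_surjective (f : G →* H) (hf : Function.Surjective f) (k : ℕ) :
    (lcs G k).map f = lcs H k := by
  rw [lcs, Subgroup.map_lowerCentralSeries, Subgroup.map_top_of_surjective _ hf]

theorem mem_center_of_lcs_succ_eq_bot {k : ℕ} (h : lcs G (k + 1) = ⊥) {z : G} (hz : z ∈ lcs G k) :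
    z ∈ Subgroup.center G := by
  rw [Subgroup.mem_center_iff]
  intro g
  have h1 : ⁅z, g⁆ ∈ lcs G (k + 1) := commutator_mem_lcs (j := 0) le_rfl hz (Subgroup.mem_top g)
  rw [h, Subgroup.mem_bot, commutatorElement_eq_one_iff_mul_comm] at h1
  exact h1.symm

/-- Two homomorphisms which agree modulo `γ_{j+1}(H)` agree on `γ_{i+1}(G)` modulo
`γ_{i+j+1}(H)`. -/
theorem hom_agree {f g : G →* H} {j : ℕ} (h : ∀ a, (f a)⁻¹ * g a ∈ lcs H j) (i : ℕ) {a : G}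
    (ha : a ∈ lcs G i) : (f a)⁻¹ * g a ∈ lcs H (i + j) := by
  induction i generalizing a with
  | zero => simpa using h a
  | succ i ih =>
    -- In this quotient the error u at a is central, and the error v at b commutes with the image of
    -- a.
    set q := QuotientGroup.mk' (lcs H (i + 1 + j)) with hq
    have hbot : lcs (H ⧸ lcs H (i + 1 + j)) (i + 1 + j) = ⊥ := gam_quotient (i + 1 + j + 1)
    suffices hs : lcs G (i + 1) ≤ (q.comp f).eqLocus (q.comp g) from QuotientGroup.eq.1 (hs ha)
    change ⁅lcs G i, ⊤⁆ ≤ _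
    rw [Subgroup.commutator_le]
    intro a ha b _
    change q (f ⁅a, b⁆) = q (g ⁅a, b⁆)
    simp only [map_commutatorElement]
    have hu := map_mem_lcs q (ih ha)
    have hv := map_mem_lcs q (h b)
    have hA := map_mem_lcs q (map_mem_lcs f ha)
    rw [map_mul, map_inv] at hu hv
    obtain ⟨u, e⟩ : ∃ u, u = (q (f a))⁻¹ * q (g a) := ⟨_, rfl⟩
    obtain ⟨v, e'⟩ : ∃ v, v = (q (f b))⁻¹ * q (g b) := ⟨_, rfl⟩
    rw [← e] at hu
    rw [← e'] at hv
    have hga : q (g a) = q (f a) * u := by rw [e, mul_inv_cancel_left]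
    have hgb : q (g b) = q (f b) * v := by rw [e', mul_inv_cancel_left]
    have h1 : ∀ w : H ⧸ lcs H (i + 1 + j), ⁅u, w⁆ = 1 := fun w => by
      rw [← Subgroup.mem_bot, ← hbot]
      exact commutator_mem_lcs (j := 0) (by omega) hu (Subgroup.mem_top w)
    have h2 : ⁅q (f a), v⁆ = 1 := by
      rw [← Subgroup.mem_bot, ← hbot]
      exact commutator_mem_lcs (by omega) hA hv
    rw [hga, hgb, commutatorElement_mul_left_eq_conj_mul, h1,
      commutatorElement_mul_right_eq_mul_conj, h2]
    simp

/-- An endomorphism of a nilpotent group which is the identity modulo the derived subgroup is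
bijective. -/
theorem bijective_of_agree {c : ℕ} (hc : lcs G c = ⊥) {f : G →* G}
    (h : ∀ a, a⁻¹ * f a ∈ lcs G 1) : Function.Bijective f := by
  have key : ∀ i, ∀ a ∈ lcs G i, a⁻¹ * f a ∈ lcs G (i + 1) := fun i a ha =>
    hom_agree (f := MonoidHom.id G) (g := f) h i ha
  constructor
  · rw [injective_iff_map_eq_one]
    intro a ha
    have : ∀ i, a ∈ lcs G i := by
      intro i
      induction i with
      | zero => exact Subgroup.mem_top a
      | succ i ih => simpa [ha] using key i a ih
    simpa [hc] using this c
  · rw [← MonoidHom.range_eq_top]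
    have : ∀ i ≤ c, lcs G (c - i) ≤ f.range := by
      intro i
      induction i with
      | zero => intro _; simp [hc]
      | succ i ih =>
        intro hi a ha
        have h1 := ih (by omega) (show a⁻¹ * f a ∈ lcs G (c - i) by
          rw [show c - i = c - (i + 1) + 1 by omega]
          exact key _ a ha)
        have h2 := (Subgroup.mul_mem_cancel_right _ (⟨a, rfl⟩ : f a ∈ f.range)).1 h1
        exact inv_mem_iff.1 h2
    have h0 := this c le_rfl
    rw [Nat.sub_self] at h0
    exact top_le_iff.1 h0

end LowerCentral

namespace FreeNilpotent

open LowerCentral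

variable {N : Type*} [Group N]

theorem lift_surjective {B : Set N} (hB : Subgroup.closure B = ⊤) :
    Function.Surjective (FreeGroup.lift (Subtype.val : B → N)) := by
  rw [← MonoidHom.range_eq_top, FreeGroup.range_lift_eq_closure, Subtype.range_val, hB]

theorem IsBasisOf.lcs_eq_bot {c : ℕ} {B : Set N} (hB : IsBasisOf c B ⊤) : lcs N c = ⊥ := by
  rw [← lcs_map_of_surjective _ (lift_surjective hB.1), Subgroup.map_eq_bot_iff, hB.2]

/-- The universal property of free nilpotent groups. -/
theorem IsBasisOf.exists_hom {c : ℕ} {B : Set N} (hB : IsBasisOf c B ⊤) {G : Type*} [Group G]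
    (hG : lcs G c = ⊥) (f : B → G) : ∃ φ : N →* G, ∀ b : B, φ b = f b := by
  have hker : (FreeGroup.lift (Subtype.val : B → N)).ker ≤ (FreeGroup.lift f).ker := by
    rw [hB.2]
    intro a ha
    rw [MonoidHom.mem_ker, ← Subgroup.mem_bot, ← hG]
    exact map_mem_lcs _ ha
  refine ⟨(FreeGroup.lift Subtype.val).liftOfSurjective (lift_surjective hB.1)
    ⟨FreeGroup.lift f, hker⟩, fun b => ?_⟩
  have := MonoidHom.liftOfRightInverse_comp_apply (FreeGroup.lift (Subtype.val : B → N)) _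
    (Function.rightInverse_surjInv (lift_surjective hB.1)) ⟨FreeGroup.lift f, hker⟩
    (FreeGroup.of b)
  simpa using this

theorem IsBasisOf.center_le {c : ℕ} {B : Set N} (hB : IsBasisOf c B ⊤) (hnt : B.Nontrivial) :
    Subgroup.center N ≤ lcs N (c - 1) := by
  intro z hz
  have : Nontrivial B := hnt.coe_sort
  obtain ⟨w, rfl⟩ := lift_surjective hB.1 z
  refine map_mem_lcs _ (mem_lowerCentralSeries_of_commutator_mem (c := c) fun b => ?_)
  rw [← hB.2, MonoidHom.mem_ker, map_commutatorElement, commutatorElement_eq_one_iff_mul_comm]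
  exact ((Subgroup.mem_center_iff.1 hz) _).symm

theorem IsBasisOf.exists_hom_int {c : ℕ} (hc : 1 ≤ c) {B : Set N} (hB : IsBasisOf c B ⊤) (b : B) :
    ∃ φ : N →* Multiplicative ℤ, φ b = Multiplicative.ofAdd 1 ∧ ∀ b' : B, b' ≠ b → φ b' = 1 := by
  classical
  obtain ⟨φ, hφ⟩ := hB.exists_hom (lcs_eq_bot_of_comm hc)
    (fun b' => if b' = b then Multiplicative.ofAdd (1 : ℤ) else 1)
  refine ⟨φ, by simp [hφ], fun b' hb' => by simp [hφ, hb']⟩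

/-- A finite set involves finitely many members of B only; the coordinate homomorphism of another
member is trivial on it, but not on N. -/
theorem not_finite_of_isInfinitelyGenerated {c : ℕ} (hc : 1 ≤ c) (hN : IsInfinitelyGenerated c N)
    {S : Set N} (hS : Subgroup.closure S = ⊤) : S.Infinite := by
  intro hfin
  obtain ⟨B, hBinf, hB⟩ := hN
  have h1 : ∀ a : N, ∃ s : Finset N, (s : Set N) ⊆ B ∧ a ∈ Subgroup.closure (s : Set N) := by
    intro a
    have ha : a ∈ Subgroup.closure (id '' B) := by
      rw [Set.image_id, hB.1]
      exact Subgroup.mem_top a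
    simpa using Lyndon.exists_finset_of_mem_closure id ha
  choose s hs ha using h1
  have hfin' : (⋃ a ∈ S, (s a : Set N)).Finite := hfin.biUnion fun a _ => (s a).finite_toSet
  obtain ⟨b, hb, hbn⟩ := hBinf.exists_notMem_finite hfin'
  obtain ⟨φ, hφ, hφ'⟩ := hB.exists_hom_int hc ⟨b, hb⟩
  have hle : Subgroup.closure S ≤ φ.ker := by
    rw [Subgroup.closure_le]
    intro a haS
    refine (Subgroup.closure_le φ.ker).2 ?_ (ha a)
    intro b' hb'
    refine hφ' ⟨b', hs a hb'⟩ ?_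
    intro e
    refine hbn (Set.mem_iUnion₂.2 ⟨a, haS, ?_⟩)
    have e' : b' = b := congrArg Subtype.val e
    rwa [← e']
  have : φ b = 1 := hle (hS ▸ Subgroup.mem_top b)
  rw [hφ] at this
  exact one_ne_zero (Multiplicative.ofAdd.injective this)

theorem conj_ker : (MulAut.conj : N →* MulAut N).ker = Subgroup.center N := by
  ext z
  rw [MonoidHom.mem_ker, Subgroup.mem_center_iff, MulEquiv.ext_iff]
  refine forall_congr' fun g => ?_
  rw [MulAut.conj_apply, MulAut.one_apply, mul_inv_eq_iff_eq_mul, eq_comm]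

theorem mem_center_iff_conj {z : N} : z ∈ Subgroup.center N ↔ MulAut.conj z = 1 := by
  rw [← MonoidHom.mem_ker, conj_ker]

/-- Conjugations by the elements of a basis form a basis of the inner automorphism group. -/
theorem IsBasisOf.isConjBasis {c : ℕ} (hc : 2 ≤ c) {B : Set N} (hB : IsBasisOf c B ⊤)
    (hnt : B.Nontrivial) : IsConjBasis c (MulAut.conj '' B) := by
  have hcenter := hB.center_le hnt
  have hinj : ∀ b b' : B, MulAut.conj (b : N) = MulAut.conj (b' : N) → b = b' := by
    intro b b' h
    by_contra hne
    obtain ⟨φ, hφ, hφ'⟩ := hB.exists_hom_int (by omega : 1 ≤ c) b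
    have h1 : (b : N)⁻¹ * b' ∈ Subgroup.center N := by
      rw [mem_center_iff_conj, map_mul, map_inv, h, inv_mul_cancel]
    have h2 := map_mem_lcs φ (lcs_le (by omega : 1 ≤ c - 1) (hcenter h1))
    rw [lcs_eq_bot_of_comm le_rfl, Subgroup.mem_bot, map_mul, map_inv, hφ,
      hφ' b' (Ne.symm hne)] at h2
    simp at h2
  have hex : ∀ t : (MulAut.conj '' B : Set (MulAut N)), ∃ b : B, MulAut.conj (b : N) = t := by
    rintro ⟨_, b, hb, rfl⟩
    exact ⟨⟨b, hb⟩, rfl⟩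
  choose e he using hex
  let d : B → (MulAut.conj '' B : Set (MulAut N)) := fun b => ⟨MulAut.conj (b : N), b, b.2, rfl⟩
  have hde : ∀ t, d (e t) = t := fun t => Subtype.ext (he t)
  have hcomp : (FreeGroup.lift (Subtype.val : (MulAut.conj '' B : Set (MulAut N)) → MulAut N)) =
      (MulAut.conj.comp (FreeGroup.lift (Subtype.val : B → N))).comp (FreeGroup.map e) := by
    ext1 t
    simp [he]
  refine ⟨?_, ?_⟩
  · rw [← MonoidHom.map_closure, hB.1, ← MonoidHom.range_eq_map]
  · ext w
    rw [MonoidHom.mem_ker, hcomp]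
    change MulAut.conj _ = 1 ↔ _
    rw [← mem_center_iff_conj]
    constructor
    · intro h
      -- A word with central value has its value in γ_c(N), hence lies in γ_c(F) up to the kernel
      -- γ_{c+1}(F) ≤ γ_c(F). The retraction `d` of `e` brings this back to the free group on the
      -- conjugations.
      have h1 := hcenter h
      rw [← lcs_map_of_surjective _ (lift_surjective hB.1)] at h1
      obtain ⟨v, hv, hvw⟩ := h1
      have h2 : v⁻¹ * FreeGroup.map e w ∈ lcs (FreeGroup B) (c - 1) := by
        refine lcs_le (Nat.sub_le c 1) ?_
        rw [lcs, ← hB.2, MonoidHom.mem_ker, map_mul, map_inv, hvw]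
        simp
      have h3 := map_mem_lcs (FreeGroup.map d) ((Subgroup.mul_mem_cancel_left _ (inv_mem hv)).1 h2)
      rw [FreeGroup.map.comp, show d ∘ e = id from funext hde, FreeGroup.map.id] at h3
      exact h3
    · intro h
      refine mem_center_of_lcs_succ_eq_bot (k := c - 1) ?_ (map_mem_lcs _ (map_mem_lcs _ h))
      rw [Nat.sub_add_cancel (by omega : 1 ≤ c)]
      exact hB.lcs_eq_bot

/-- A generating family of `N` such that any map from it to `N` extends to an endomorphism. -/
structure IsRelBasis {κ : Type*} (b : κ → N) : Prop where
  closure_eq : Subgroup.closure (Set.range b) = ⊤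
  exists_hom : ∀ f : κ → N, ∃ φ : N →* N, ∀ i, φ (b i) = f i

theorem IsRelBasis.hom_ext {κ : Type*} {b : κ → N} (hb : IsRelBasis b) {G : Type*} [Group G]
    {φ ψ : N →* G} (h : ∀ i, φ (b i) = ψ (b i)) : φ = ψ := by
  refine MonoidHom.eq_of_eqOn_dense hb.closure_eq ?_
  rintro _ ⟨i, rfl⟩
  exact h i

theorem IsRelBasis.comp_equiv {κ κ' : Type*} {b : κ → N} (hb : IsRelBasis b) (e : κ' ≃ κ) :
    IsRelBasis (b ∘ e) := by
  refine ⟨by rw [e.surjective.range_comp, hb.closure_eq], fun f => ?_⟩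
  obtain ⟨φ, hφ⟩ := hb.exists_hom (f ∘ e.symm)
  exact ⟨φ, fun i => by simp [hφ]⟩

/-- A relative basis of the inner automorphism group: a generating set such that any map from it
to inner automorphisms extends to a map which is multiplicative on inner automorphisms. -/
def IsInnBasis (X : Set (MulAut N)) : Prop :=
  Subgroup.closure X = (MulAut.conj : N →* MulAut N).range ∧
    ∀ f : MulAut N → MulAut N, (∀ t ∈ X, f t ∈ (MulAut.conj : N →* MulAut N).range) →
      ∃ φ : MulAut N → MulAut N,
        (∀ s ∈ (MulAut.conj : N →* MulAut N).range, ∀ t ∈ (MulAut.conj : N →* MulAut N).range,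
          φ (s * t) = φ s * φ t) ∧ ∀ t ∈ X, φ t = f t

/-- The relations of X lie in γ_c(F), and any lift to N maps γ_c(F) into the center. The weaker
notion is introduced because it speaks of subsets and maps of Aut N alone and is therefore
accessible to a formula. -/
theorem IsConjBasis.isInnBasis {c : ℕ} (hc : 1 ≤ c) (hN : lcs N c = ⊥) {X : Set (MulAut N)}
    (hX : IsConjBasis c X) : IsInnBasis X := by
  classical
  refine ⟨hX.1, fun f hf => ?_⟩
  have hrange : (FreeGroup.lift (Subtype.val : X → MulAut N)).range =
      (MulAut.conj : N →* MulAut N).range := by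
    rw [FreeGroup.range_lift_eq_closure, Subtype.range_val, hX.1]
  have hker : ∀ w, FreeGroup.lift (Subtype.val : X → MulAut N) w = 1 →
      FreeGroup.lift (fun t : X => f t) w = 1 := by
    intro w hw
    choose g hg using fun t : X => hf t t.2
    have e : FreeGroup.lift (fun t : X => f t) = MulAut.conj.comp (FreeGroup.lift g) := by
      ext1 t
      simp [hg]
    rw [← MonoidHom.mem_ker, hX.2] at hw
    rw [e]
    change MulAut.conj _ = 1
    rw [← mem_center_iff_conj]
    refine mem_center_of_lcs_succ_eq_bot (k := c - 1) ?_ (map_mem_lcs _ hw)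
    rwa [Nat.sub_add_cancel hc]
  have hker' : ∀ v w, FreeGroup.lift (Subtype.val : X → MulAut N) v =
      FreeGroup.lift (Subtype.val : X → MulAut N) w →
      FreeGroup.lift (fun t : X => f t) v = FreeGroup.lift (fun t : X => f t) w := by
    intro v w h
    have := hker (v⁻¹ * w) (by rw [map_mul, map_inv, h, inv_mul_cancel])
    rw [map_mul, map_inv, inv_mul_eq_one] at this
    exact this
  have hex : ∀ s ∈ (MulAut.conj : N →* MulAut N).range, ∃ w,
      FreeGroup.lift (Subtype.val : X → MulAut N) w = s := by
    intro s hs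
    rwa [← hrange] at hs
  choose! r hr using hex
  refine ⟨fun s => FreeGroup.lift (fun t : X => f t) (r s), fun s hs t ht => ?_, fun t ht => ?_⟩
  · change _ = FreeGroup.lift _ (r s) * FreeGroup.lift _ (r t)
    rw [← map_mul]
    refine hker' _ _ ?_
    rw [hr _ (mul_mem hs ht), map_mul, hr _ hs, hr _ ht]
  · have h1 : t ∈ (MulAut.conj : N →* MulAut N).range := hX.1 ▸ Subgroup.subset_closure ht
    have h2 := hker' (r t) (FreeGroup.of ⟨t, ht⟩) (by rw [hr _ h1]; simp)
    change FreeGroup.lift _ (r t) = _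
    rw [h2]
    simp

/-- The relations between the elements of a relative basis of the inner automorphism group lie in
the derived subgroup of the free group. -/
theorem IsInnBasis.mem_lcs_one {X : Set (MulAut N)} (hX : IsInnBasis X) {b : N}
    (hb : ∀ k : ℤ, MulAut.conj b ^ k = 1 → k = 0) {w : FreeGroup X}
    (hw : FreeGroup.lift (Subtype.val : X → MulAut N) w = 1) : w ∈ lcs (FreeGroup X) 1 := by
  obtain ⟨_, _⟩ := exists_wellFoundedLT X
  refine Lyndon.dimSubgroup_le_gam 2 ?_
  intro l hl
  rcases Nat.lt_or_ge l.length 1 with h | h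
  · exact NCSeries.mem_dimSubgroup_one w l h
  · obtain ⟨a, rfl⟩ := List.length_eq_one_iff.1 (by omega : l.length = 1)
    -- The extension of this map sends the value of a word to a power of an inner automorphism of
    -- infinite order. The exponent is the exponent sum of a, which is the Magnus coefficient at the
    -- letter a.
    obtain ⟨f, hfa, hf⟩ : ∃ f : MulAut N → MulAut N, f a = MulAut.conj b ∧ ∀ t ≠ ↑a, f t = 1 := by
      classical
      exact ⟨Function.update 1 a (MulAut.conj b), by simp, fun t ht => by simp [ht]⟩
    obtain ⟨φ, hφ, hφX⟩ := hX.2 f (by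
      intro t _
      by_cases h : t = a
      · exact ⟨b, by rw [h, hfa]⟩
      · rw [hf t h]
        exact one_mem _)
    have hXr : ∀ t ∈ X, t ∈ (MulAut.conj : N →* MulAut N).range := fun t ht =>
      hX.1 ▸ Subgroup.subset_closure ht
    let ψ : (MulAut.conj : N →* MulAut N).range →* MulAut N :=
      MonoidHom.mk' (fun s => φ s) fun s t => hφ s s.2 t t.2
    have hlift : FreeGroup.lift (Subtype.val : X → MulAut N) =
        (MulAut.conj : N →* MulAut N).range.subtype.comp
          (FreeGroup.lift fun t : X => (⟨t, hXr t t.2⟩ : (MulAut.conj : N →* MulAut N).range)) := by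
      ext1 t
      simp
    have h1 : FreeGroup.lift (fun t : X => (⟨t, hXr t t.2⟩ : (MulAut.conj : N →* MulAut N).range)) w
        = 1 := by
      rw [hlift] at hw
      exact Subtype.ext hw
    have key : ∀ v : FreeGroup X, ψ (FreeGroup.lift
        (fun t : X => (⟨t, hXr t t.2⟩ : (MulAut.conj : N →* MulAut N).range)) v) =
        MulAut.conj b ^ (NCSeries.dev v).coeff [a] := by
      have hmul : ∀ g h : FreeGroup X, (NCSeries.dev (g * h)).coeff [a] = _ := fun g h =>
        NCSeries.coeff_dev_mul (NCSeries.mem_dimSubgroup_one g) rfl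
      have hof : ∀ t : X, ψ ⟨t, hXr t t.2⟩ = MulAut.conj b ^ (NCSeries.dev (FreeGroup.of t)).coeff [a] := by
        intro t
        change φ t = _
        rw [hφX t t.2, NCSeries.dev_of]
        by_cases ht : t = a
        · simp [NCSeries.X, ht, hfa]
        · have ht' : ¬ ((t : MulAut N) = a) := fun e => ht (Subtype.ext e)
          have ht'' : a ≠ t := fun e => ht e.symm
          rw [hf _ ht']
          simp [NCSeries.X, ht'']
      intro v
      induction v using FreeGroup.induction_on with
      | C1 => simp [NCSeries.dev_one]
      | of t => simpa using hof t
      | inv_of t _ =>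
        rw [NCSeries.coeff_dev_inv (NCSeries.mem_dimSubgroup_one _) rfl, map_inv, map_inv, zpow_neg]
        simpa using hof t
      | mul g h hg hh => rw [hmul, map_mul, map_mul, hg, hh, zpow_add]
    have h2 := key w
    rw [h1, map_one] at h2
    exact hb _ h2.symm

/-- Lifts of a relative basis of the inner automorphism group form a relative basis. -/
theorem IsInnBasis.isRelBasis {c : ℕ} (hc : 2 ≤ c) {B : Set N} (hB : IsBasisOf c B ⊤)
    (hnt : B.Nontrivial) {X : Set (MulAut N)} (hX : IsInnBasis X) {y : X → N}
    (hy : ∀ t, MulAut.conj (y t) = t) : IsRelBasis y := by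
  have hcenter := hB.center_le hnt
  have hN := hB.lcs_eq_bot
  have hgen : Subgroup.closure (Set.range y) = ⊤ := by
    set H := Subgroup.closure (Set.range y) with hH
    have hmap : H.map MulAut.conj = (MulAut.conj : N →* MulAut N).range := by
      rw [hH, MonoidHom.map_closure, ← hX.1, ← Set.range_comp]
      congr 1
      ext t
      constructor
      · rintro ⟨s, rfl⟩
        change MulAut.conj (y s) ∈ X
        rw [hy]
        exact s.2
      · intro ht
        exact ⟨⟨t, ht⟩, hy _⟩
    have hsup : H ⊔ Subgroup.center N = ⊤ := by
      rw [← conj_ker, ← Subgroup.comap_map_eq, hmap, eq_top_iff]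
      exact fun a _ => ⟨a, rfl⟩
    -- Since HZ = N, the subgroup H is normal with abelian quotient, so it contains γ_2(N), hence
    -- γ_c(N), hence the center.
    have hnormal : H.Normal := by
      rw [← Subgroup.normalizer_eq_top_iff, eq_top_iff, ← hsup]
      refine sup_le Subgroup.le_normalizer ?_
      intro z hz
      rw [Subgroup.mem_normalizer_iff]
      intro h
      rw [← Subgroup.mem_center_iff.1 hz h, mul_inv_cancel_right]
    have hcomm := Subgroup.Normal.commutator_le_of_self_sup_commutative_eq_top hsup inferInstance
    rw [eq_top_iff, ← hsup]
    refine sup_le le_rfl (hcenter.trans ((lcs_le (by omega : 1 ≤ c - 1)).trans hcomm))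
  refine ⟨hgen, fun f => ?_⟩
  set φ : FreeGroup X →* N := FreeGroup.lift y with hφ
  have hφsurj : Function.Surjective φ := by
    rw [← MonoidHom.range_eq_top, FreeGroup.range_lift_eq_closure, hgen]
  have hconj : FreeGroup.lift (Subtype.val : X → MulAut N) = MulAut.conj.comp φ := by
    ext1 t
    simp [hφ, hy]
  obtain ⟨b, hbB⟩ := hnt.nonempty
  have hb : ∀ k : ℤ, MulAut.conj b ^ k = 1 → k = 0 := by
    intro k hk
    obtain ⟨ψ, hψ, -⟩ := hB.exists_hom_int (by omega : 1 ≤ c) ⟨b, hbB⟩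
    rw [← map_zpow, ← mem_center_iff_conj] at hk
    have h2 := map_mem_lcs ψ (lcs_le (by omega : 1 ≤ c - 1) (hcenter hk))
    rw [lcs_eq_bot_of_comm le_rfl, Subgroup.mem_bot, map_zpow, hψ, ← ofAdd_zsmul] at h2
    simpa using Multiplicative.ofAdd.injective h2
  have hker1 : ∀ w, φ w = 1 → w ∈ lcs (FreeGroup X) 1 := fun w hw =>
    hX.mem_lcs_one hb (by rw [hconj]; change MulAut.conj (φ w) = 1; rw [hw, map_one])
  set q := QuotientGroup.mk' (lcs (FreeGroup X) c) with hq
  have hM : lcs (FreeGroup X ⧸ lcs (FreeGroup X) c) c = ⊥ := gam_quotient (c + 1)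
  -- A homomorphism back to F/γ_{c+1}(F), supplied by the freeness of N on B. As ker φ ≤ γ_2(F), s ∘
  -- φ agrees with the projection modulo γ_2. By `hom_agree`, an element of ker φ in one term of the
  -- lower central series is in the next one, and so climbs to γ_{c+1}(F).
  obtain ⟨s, hs⟩ := hB.exists_hom hM (fun b => q (Function.surjInv hφsurj b))
  have hsq : ∀ n : N, ∃ w, φ w = n ∧ s n = q w := by
    intro n
    have hn : n ∈ Subgroup.closure B := hB.1 ▸ Subgroup.mem_top n
    induction hn using Subgroup.closure_induction with
    | mem b hb => exact ⟨_, Function.surjInv_eq hφsurj b, hs ⟨b, hb⟩⟩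
    | one => exact ⟨1, by simp, by simp⟩
    | mul a b _ _ ha hb =>
      obtain ⟨v, hv, hv'⟩ := ha
      obtain ⟨w, hw, hw'⟩ := hb
      exact ⟨v * w, by simp [hv, hw], by simp [hv', hw']⟩
    | inv a _ ha =>
      obtain ⟨v, hv, hv'⟩ := ha
      exact ⟨v⁻¹, by simp [hv], by simp [hv']⟩
  have hagree : ∀ w, (q w)⁻¹ * (s.comp φ) w ∈ lcs (FreeGroup X ⧸ lcs (FreeGroup X) c) 1 := by
    intro w
    obtain ⟨v, hv, hv'⟩ := hsq (φ w)
    change (q w)⁻¹ * s (φ w) ∈ _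
    rw [hv', ← map_inv, ← map_mul]
    exact map_mem_lcs q (hker1 _ (by rw [map_mul, map_inv, hv, inv_mul_cancel]))
  have hker : φ.ker ≤ lcs (FreeGroup X) c := by
    intro w hw
    suffices h : ∀ i ≤ c, w ∈ lcs (FreeGroup X) i from h c le_rfl
    intro i
    induction i with
    | zero => exact fun _ => Subgroup.mem_top w
    | succ i ih =>
      intro hi
      have h1 := hom_agree hagree i (ih (by omega))
      change (q w)⁻¹ * s (φ w) ∈ _ at h1
      rw [MonoidHom.mem_ker.1 hw, map_one, mul_one, inv_mem_iff,
        ← lcs_map_of_surjective q (QuotientGroup.mk'_surjective _)] at h1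
      obtain ⟨v, hv, hvw⟩ := h1
      have h2 : v⁻¹ * w ∈ lcs (FreeGroup X) (i + 1) := lcs_le hi (QuotientGroup.eq.1 hvw)
      exact (Subgroup.mul_mem_cancel_left _ (inv_mem hv)).1 h2
  have hkf : φ.ker ≤ (FreeGroup.lift f).ker := by
    intro w hw
    rw [MonoidHom.mem_ker, ← Subgroup.mem_bot, ← hN]
    exact map_mem_lcs _ (hker hw)
  refine ⟨φ.liftOfSurjective hφsurj ⟨FreeGroup.lift f, hkf⟩, fun t => ?_⟩
  have := MonoidHom.liftOfRightInverse_comp_apply φ _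
    (Function.rightInverse_surjInv hφsurj) ⟨FreeGroup.lift f, hkf⟩ (FreeGroup.of t)
  simpa [hφ] using this

end FreeNilpotent

/-! ### Stabilizers in the groups `IA_k(N)` -/

namespace FreeNilpotent

open LowerCentral

/-! ### Automorphisms acting on a relative basis -/

section Automorphisms

variable {N : Type*} [Group N]

theorem mem_IA_iff {k : ℕ} {σ : MulAut N} : σ ∈ IA N k ↔ ∀ a, a⁻¹ * σ a ∈ lcs N k := by
  rw [IA, MonoidHom.mem_ker, MulEquiv.ext_iff]
  constructor
  · intro h a
    exact QuotientGroup.eq.1 (h (a : N ⧸ lcs N k)).symm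
  · intro h a
    induction a using QuotientGroup.induction_on with
    | H a => exact (QuotientGroup.eq.2 (h a)).symm

theorem conj_mem_IA {k : ℕ} {σ : MulAut N} (hσ : σ ∈ IA N k) (ρ : MulAut N) :
    ρ * σ * ρ⁻¹ ∈ IA N k :=
  (inferInstance : (quotientAut (lcs N k)).ker.Normal).conj_mem σ hσ ρ

theorem IA_antitone : Antitone (IA N) := fun _ _ h _ hσ =>
  mem_IA_iff.2 fun a => lcs_le h (mem_IA_iff.1 hσ a)

theorem IA_agree {j : ℕ} {σ : MulAut N} (hσ : σ ∈ IA N j) (i : ℕ) {a : N} (ha : a ∈ lcs N i) :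
    a⁻¹ * σ a ∈ lcs N (i + j) :=
  hom_agree (f := MonoidHom.id N) (g := σ.toMonoidHom) (mem_IA_iff.1 hσ) i ha

/-- Elements of IA_k(N) move γ_c(N) by factors from γ_{c+k}(N) = 1. -/
theorem IA_apply_center {c k : ℕ} (hc : 1 ≤ c) (hN : lcs N c = ⊥)
    (hZ : Subgroup.center N ≤ lcs N (c - 1)) (hk : 1 ≤ k) {σ : MulAut N} (hσ : σ ∈ IA N k) {z : N}
    (hz : z ∈ Subgroup.center N) : σ z = z := by
  have h := lcs_le (by omega : c ≤ c - 1 + k) (IA_agree hσ _ (hZ hz))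
  rw [hN, Subgroup.mem_bot, inv_mul_eq_one] at h
  exact h.symm

theorem mul_conj_mul_inv (ρ : MulAut N) (a : N) :
    ρ * MulAut.conj a * ρ⁻¹ = MulAut.conj (ρ a) := by
  ext z
  simp [MulAut.mul_apply]

theorem conj_eq_conj_iff {a b : N} :
    MulAut.conj a = MulAut.conj b ↔ a⁻¹ * b ∈ Subgroup.center N := by
  rw [mem_center_iff_conj, map_mul, map_inv, inv_mul_eq_one]

variable {κ : Type*} {b : κ → N}

theorem IsRelBasis.aut_ext (hb : IsRelBasis b) {ρ σ : MulAut N} (h : ∀ i, ρ (b i) = σ (b i)) :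
    ρ = σ := by
  have := hb.hom_ext (φ := ρ.toMonoidHom) (ψ := σ.toMonoidHom) h
  ext a
  exact DFunLike.congr_fun this a

theorem IsRelBasis.exists_perm (hb : IsRelBasis b) (s : Equiv.Perm κ) :
    ∃ ρ : MulAut N, ∀ i, ρ (b i) = b (s i) := by
  obtain ⟨φ, hφ⟩ := hb.exists_hom (b ∘ s)
  obtain ⟨ψ, hψ⟩ := hb.exists_hom (b ∘ s.symm)
  have h1 : ψ.comp φ = MonoidHom.id N := hb.hom_ext fun i => by simp [hφ, hψ]
  have h2 : φ.comp ψ = MonoidHom.id N := hb.hom_ext fun i => by simp [hφ, hψ]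
  exact ⟨MonoidHom.toMulEquiv φ ψ h1 h2, hφ⟩

/-- The automorphism which permutes a relative basis. -/
noncomputable def IsRelBasis.permAut (hb : IsRelBasis b) (s : Equiv.Perm κ) : MulAut N :=
  Classical.choose (hb.exists_perm s)

theorem IsRelBasis.permAut_apply (hb : IsRelBasis b) (s : Equiv.Perm κ) (i : κ) :
    hb.permAut s (b i) = b (s i) :=
  Classical.choose_spec (hb.exists_perm s) i

/-- The endomorphism with these values is trivial modulo γ_{k+1}(N), and nilpotency makes it
bijective. Thus elements of IA_k(N) may be prescribed freely on the family. -/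
theorem IsRelBasis.exists_IA {c k : ℕ} (hN : lcs N c = ⊥) (hk : 1 ≤ k) (hb : IsRelBasis b)
    {u : κ → N} (hu : ∀ i, u i ∈ lcs N k) : ∃ σ ∈ IA N k, ∀ i, σ (b i) = b i * u i := by
  obtain ⟨φ, hφ⟩ := hb.exists_hom (fun i => b i * u i)
  have h : ∀ a, a⁻¹ * φ a ∈ lcs N k := by
    have e : QuotientGroup.mk' (lcs N k) = (QuotientGroup.mk' (lcs N k)).comp φ := by
      refine hb.hom_ext fun i => QuotientGroup.eq.2 ?_
      rw [hφ, inv_mul_cancel_left]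
      exact hu i
    exact fun a => QuotientGroup.eq.1 (DFunLike.congr_fun e a)
  refine ⟨MulEquiv.ofBijective φ (bijective_of_agree hN fun a => lcs_le hk (h a)),
    mem_IA_iff.2 h, hφ⟩

/-- Automorphisms which agree modulo the center agree on the derived subgroup. -/
theorem IsRelBasis.eq_on_lcs_one {c : ℕ} (hc : 1 ≤ c) (hN : lcs N c = ⊥)
    (hZ : Subgroup.center N ≤ lcs N (c - 1)) (hb : IsRelBasis b) {ρ σ : MulAut N}
    (h : ∀ i, (ρ (b i))⁻¹ * σ (b i) ∈ Subgroup.center N) {a : N} (ha : a ∈ lcs N 1) :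
    ρ a = σ a := by
  have e : (QuotientGroup.mk' (lcs N (c - 1))).comp ρ.toMonoidHom =
      (QuotientGroup.mk' (lcs N (c - 1))).comp σ.toMonoidHom :=
    hb.hom_ext fun i => QuotientGroup.eq.2 (hZ (h i))
  have h1 := hom_agree (f := ρ.toMonoidHom) (g := σ.toMonoidHom)
    (fun a => QuotientGroup.eq.1 (DFunLike.congr_fun e a)) 1 ha
  rw [show 1 + (c - 1) = c by omega, hN, Subgroup.mem_bot, inv_mul_eq_one] at h1
  exact h1

theorem hom_eq_on_closure {G : Type*} [Group G] {φ ψ : N →* G} {S : Set N}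
    (h : ∀ a ∈ S, φ a = ψ a) {a : N} (ha : a ∈ Subgroup.closure S) : φ a = ψ a :=
  (Subgroup.closure_le (φ.eqLocus ψ)).2 h ha

theorem IsRelBasis.exists_finset (hb : IsRelBasis b) (a : N) :
    ∃ s : Finset κ, a ∈ Subgroup.closure (b '' (s : Set κ)) := by
  have ha : a ∈ Subgroup.closure (b '' Set.univ) := by
    rw [Set.image_univ, hb.closure_eq]
    exact Subgroup.mem_top a
  obtain ⟨s, -, hs⟩ := Lyndon.exists_finset_of_mem_closure b ha
  exact ⟨s, hs⟩

end Automorphisms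

/-! ### Shifts of a basis and their fixed points -/

section Shift

variable {N : Type*} [Group N] {J : Type*}

/-- The shift of the second coordinate. -/
def shift (J : Type*) : Equiv.Perm (J × ℤ) := Equiv.prodCongr (Equiv.refl J) (Equiv.addRight 1)

@[simp] theorem shift_apply (j : J) (n : ℤ) : shift J (j, n) = (j, n + 1) := rfl

theorem shift_pow_apply (m : ℕ) (j : J) (n : ℤ) : (shift J ^ m) (j, n) = (j, n + m) := by
  induction m with
  | zero => simp
  | succ m ih =>
    rw [pow_succ', Equiv.Perm.mul_apply, ih, shift_apply]
    push_cast
    rw [add_assoc]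

variable {ι : Type*} {b : Option ι → N}

/-- The automorphism which permutes the members of a relative basis with the exception of one
of them. -/
noncomputable def IsRelBasis.optAut (hb : IsRelBasis b) (s : Equiv.Perm ι) : MulAut N :=
  hb.permAut s.optionCongr

@[simp] theorem IsRelBasis.optAut_none (hb : IsRelBasis b) (s : Equiv.Perm ι) :
    hb.optAut s (b none) = b none := hb.permAut_apply _ _

@[simp] theorem IsRelBasis.optAut_some (hb : IsRelBasis b) (s : Equiv.Perm ι) (i : ι) :
    hb.optAut s (b (some i)) = b (some (s i)) := hb.permAut_apply _ _

theorem IsRelBasis.opt_ext (hb : IsRelBasis b) {ρ σ : MulAut N} (h0 : ρ (b none) = σ (b none))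
    (h : ∀ i, ρ (b (some i)) = σ (b (some i))) : ρ = σ :=
  hb.aut_ext fun o => by cases o <;> simp [h0, h]

theorem IsRelBasis.optAut_mul (hb : IsRelBasis b) (s t : Equiv.Perm ι) :
    hb.optAut (s * t) = hb.optAut s * hb.optAut t :=
  hb.opt_ext (by simp [MulAut.mul_apply]) (by simp [MulAut.mul_apply])

theorem IsRelBasis.optAut_one (hb : IsRelBasis b) : hb.optAut 1 = 1 :=
  hb.opt_ext (by simp) (by simp)

theorem IsRelBasis.optAut_inv (hb : IsRelBasis b) (s : Equiv.Perm ι) :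
    hb.optAut s⁻¹ = (hb.optAut s)⁻¹ := by
  rw [eq_inv_iff_mul_eq_one, ← hb.optAut_mul, inv_mul_cancel, hb.optAut_one]

theorem IsRelBasis.optAut_pow (hb : IsRelBasis b) (s : Equiv.Perm ι) (n : ℕ) :
    hb.optAut (s ^ n) = hb.optAut s ^ n := by
  induction n with
  | zero => simp [hb.optAut_one]
  | succ n ih => rw [pow_succ, pow_succ, hb.optAut_mul, ih]

theorem IsRelBasis.optAut_mem_symConjStab (hb : IsRelBasis b) (s : Equiv.Perm ι) :
    hb.optAut s ∈ symConjStab (Set.range fun o => MulAut.conj (b o)) (MulAut.conj (b none)) := by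
  refine ⟨?_, by rw [mul_conj_mul_inv, hb.optAut_none]⟩
  rw [symConj, Subgroup.mem_normalizer_iff_conj_image_eq, ← Set.range_comp]
  have : (MulAut.conj (hb.optAut s) ∘ fun o => MulAut.conj (b o)) =
      (fun o => MulAut.conj (b o)) ∘ s.optionCongr := by
    funext o
    simp only [Function.comp_apply, MulAut.conj_apply, mul_conj_mul_inv]
    exact congrArg _ (hb.permAut_apply _ _)
  rw [this, s.optionCongr.surjective.range_comp]

/-- The shift of a relative basis has no nontrivial fixed points in the derived subgroup. -/
theorem IsRelBasis.eq_one_of_shift_fixed {b : Option (J × ℤ) → N} (hb : IsRelBasis b) {z : N}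
    (hz : z ∈ lcs N 1) (h : hb.optAut (shift J) z = z) : z = 1 := by
  classical
  obtain ⟨S, hS⟩ := hb.exists_finset z
  -- Twice the largest index in the support, plus one: this power of the shift moves all support
  -- letters except the distinguished one out of the support.
  obtain ⟨n, hn⟩ : ∃ n : ℕ, ∀ o ∈ S, ∀ j m, o = some (j, m) → some (j, m + n) ∉ S := by
    let B : ℕ := S.sup fun o => o.elim 0 fun i => i.2.natAbs
    have hB : ∀ j m, some (j, m) ∈ S → m.natAbs ≤ B := fun j m ho =>
      Finset.le_sup (f := fun o : Option (J × ℤ) => o.elim 0 fun i => i.2.natAbs) ho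
    refine ⟨2 * B + 1, ?_⟩
    rintro o ho j m rfl h'
    have h1 := hB _ _ ho
    have h2 := hB _ _ h'
    omega
  obtain ⟨r, hr⟩ := hb.exists_hom fun o => if o ∈ S then b o else 1
  have hr1 : r z = z := by
    refine hom_eq_on_closure (ψ := MonoidHom.id N) ?_ hS
    rintro _ ⟨o, ho, rfl⟩
    have ho' : o ∈ S := ho
    simp [hr, ho']
  have hpow : (hb.optAut (shift J ^ n)) z = z := by
    rw [hb.optAut_pow]
    generalize n = m
    induction m with
    | zero => simp
    | succ m ih => rw [pow_succ, MulAut.mul_apply, h, ih]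
  -- Retracting the shifted z onto the support kills all its letters but the distinguished one. So z
  -- is the image of itself under a map with cyclic range, and such a map is trivial on γ_2(N).
  obtain ⟨ε, hε⟩ := hb.exists_hom fun o => o.elim (r (b none)) fun _ => 1
  have hrε : r (hb.optAut (shift J ^ n) z) = ε z := by
    refine hom_eq_on_closure (φ := r.comp (hb.optAut (shift J ^ n)).toMonoidHom) ?_ hS
    rintro _ ⟨o, ho, rfl⟩
    change r (hb.optAut (shift J ^ n) (b o)) = ε (b o)
    cases o with
    | none => simp [hε]
    | some i =>
      obtain ⟨j, m⟩ := i
      rw [hb.optAut_some, shift_pow_apply, hr, if_neg (hn _ ho j m rfl), hε]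
      rfl
  rw [hpow, hr1] at hrε
  have hrange : ε.range ≤ Subgroup.zpowers (r (b none)) := by
    rw [MonoidHom.range_eq_map, ← hb.closure_eq, MonoidHom.map_closure, Subgroup.closure_le]
    rintro _ ⟨_, ⟨o, rfl⟩, rfl⟩
    cases o with
    | none => rw [hε]; exact Subgroup.mem_zpowers _
    | some i => rw [hε]; exact one_mem _
  have hker : lcs N 1 ≤ ε.ker := by
    change ⁅(⊤ : Subgroup N), ⊤⁆ ≤ _
    rw [Subgroup.commutator_le]
    intro u _ v _
    obtain ⟨p, hp⟩ := Subgroup.mem_zpowers_iff.1 (hrange ⟨u, rfl⟩)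
    obtain ⟨q, hq⟩ := Subgroup.mem_zpowers_iff.1 (hrange ⟨v, rfl⟩)
    rw [MonoidHom.mem_ker, map_commutatorElement, commutatorElement_eq_one_iff_mul_comm, ← hp, ← hq,
      ← zpow_add, ← zpow_add, add_comm]
  rw [hrε]
  exact hker hz

end Shift

/-! ### The swindle for automorphisms acting on a moiety -/

section Swindle

variable {N : Type*} [Group N] {J : Type*} {b : Option (J × ℤ) → N}

/-- The injection of the nonnegative integers which avoids `0`, extended to a permutation. -/
def skip : Equiv.Perm (ℤ × Bool) where
  -- The half-line `true` moves up by one, and the half-line `false` moves down to fill the gap at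
  -- `(0, true)`.
  toFun t := if t.2 then (if 0 ≤ t.1 then (t.1 + 1, true) else t)
    else (if 0 < t.1 then (t.1 - 1, false) else if t.1 = 0 then (0, true) else t)
  invFun t := if t.2 then (if 0 < t.1 then (t.1 - 1, true) else if t.1 = 0 then (0, false) else t)
    else (if 0 ≤ t.1 then (t.1 + 1, false) else t)
  left_inv := by
    rintro ⟨n, _ | _⟩ <;> simp only [] <;> split_ifs <;> simp_all <;> omega
  right_inv := by
    rintro ⟨n, _ | _⟩ <;> simp only [] <;> split_ifs <;> simp_all <;> omega

/-- This makes repeating σ on all copies labelled `true` conjugate to repeating it on all of them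
but one. -/
theorem skip_mem (t : ℤ × Bool) :
    ((skip t).2 = true ∧ skip t ≠ (0, true)) ↔ t.2 = true := by
  obtain ⟨n, _ | _⟩ := t
  · simp only [skip, Equiv.coe_fn_mk]
    split_ifs <;> simp_all
  · simp only [skip, Equiv.coe_fn_mk]
    split_ifs <;> simp_all <;> omega

/-- If `H` contains the elements of `IA_k(N)_(x)` which commute with the shift and is invariant
under permutations of the basis, then it contains all elements which act on a moiety of the
basis. -/
theorem IsRelBasis.mem_of_moiety {c k : ℕ} (hN : lcs N c = ⊥) (hk : 1 ≤ k) (hb : IsRelBasis b)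
    {H : Subgroup (MulAut N)}
    (h1 : ∀ η ∈ IA N k, η (b none) = b none →
      η * hb.optAut (shift J) = hb.optAut (shift J) * η → η ∈ H)
    (h2 : ∀ s, ∀ η ∈ H, hb.optAut s * η * (hb.optAut s)⁻¹ ∈ H)
    {D : Set (J × ℤ)} (e : D × (ℤ × Bool) ≃ J × ℤ) (he : ∀ d, e (d, (0, true)) = d)
    (eJ : D × Bool ≃ J) {σ : MulAut N} (hσ : σ ∈ IA N k) (hσ0 : σ (b none) = b none)
    (hσD : ∀ i ∉ D, σ (b (some i)) = b (some i))
    (hσD' : ∀ i ∈ D, σ (b (some i)) ∈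
      Subgroup.closure (insert (b none) ((fun i => b (some i)) '' D))) : σ ∈ H := by
  classical
  -- The basis is split into copies of D indexed by ℤ × Bool, with D as copy `(0, true)`. The map κ
  -- t renames the letters of D into those of copy t and kills the other letters outside D, keeping
  -- the distinguished one.
  have hcopy : ∀ t : ℤ × Bool, ∃ κ : N →* N, ∀ o, κ (b o) =
      o.elim (b none) fun i => if h : i ∈ D then b (some (e (⟨i, h⟩, t))) else 1 :=
    fun t => hb.exists_hom _
  choose κ hκ using hcopy
  have hκ0 : ∀ t, κ t (b none) = b none := fun t => hκ t none
  have hκD : ∀ t (d : D), κ t (b (some d)) = b (some (e (d, t))) := fun t d => by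
    simp [hκ]
  have hκn : ∀ t, ∀ i ∉ D, κ t (b (some i)) = 1 := fun t i hi => by simp [hκ, hi]
  -- S Q repeats σ on each copy in Q and fixes the letters of the others.
  have hS : ∀ Q : Set (ℤ × Bool), ∃ τ ∈ IA N k, τ (b none) = b none ∧ ∀ d t,
      τ (b (some (e (d, t)))) = if t ∈ Q then κ t (σ (b (some d))) else b (some (e (d, t))) := by
    intro Q
    obtain ⟨τ, hτ, hτb⟩ := hb.exists_IA hN hk
      (u := fun o => o.elim 1 fun i => if (e.symm i).2 ∈ Q then
        κ (e.symm i).2 ((b (some (e.symm i).1))⁻¹ * σ (b (some (e.symm i).1))) else 1) (by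
        intro o
        cases o with
        | none => exact one_mem _
        | some i =>
          simp only [Option.elim_some]
          split_ifs
          · exact map_mem_lcs _ (mem_IA_iff.1 hσ _)
          · exact one_mem _)
    refine ⟨τ, hτ, by simp [hτb], fun d t => ?_⟩
    rw [hτb]
    simp only [Option.elim_some, Equiv.symm_apply_apply]
    split_ifs
    · rw [map_mul, map_inv, hκD, mul_inv_cancel_left]
    · rw [mul_one]
  choose S hSIA hS0 hSe using hS
  let ext (ω : Equiv.Perm (ℤ × Bool)) : Equiv.Perm (J × ℤ) :=
    (e.symm.trans (Equiv.prodCongr (Equiv.refl D) ω)).trans e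
  have hext : ∀ ω d t, ext ω (e (d, t)) = e (d, ω t) := fun ω d t => by simp [ext]
  have hextκ : ∀ ω t a, hb.optAut (ext ω) (κ t a) = κ (ω t) a := by
    intro ω t a
    have : (hb.optAut (ext ω)).toMonoidHom.comp (κ t) = κ (ω t) := by
      refine hb.hom_ext fun o => ?_
      change hb.optAut (ext ω) (κ t (b o)) = _
      cases o with
      | none => rw [hκ0, hκ0, hb.optAut_none]
      | some i =>
        by_cases hi : i ∈ D
        · rw [hκD t ⟨i, hi⟩, hκD (ω t) ⟨i, hi⟩, hb.optAut_some, hext]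
        · rw [hκn t i hi, hκn _ i hi, map_one]
    exact DFunLike.congr_fun this a
  have hcomm : ∀ (ω : Equiv.Perm (ℤ × Bool)) (Q Q' : Set (ℤ × Bool)),
      (∀ t, ω t ∈ Q' ↔ t ∈ Q) → hb.optAut (ext ω) * S Q = S Q' * hb.optAut (ext ω) := by
    intro ω Q Q' hQ
    refine hb.opt_ext (by simp [MulAut.mul_apply, hS0]) fun i => ?_
    obtain ⟨⟨d, t⟩, rfl⟩ := e.surjective i
    rw [MulAut.mul_apply, MulAut.mul_apply, hSe, hb.optAut_some, hext, hSe]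
    by_cases ht : t ∈ Q
    · rw [if_pos ht, if_pos ((hQ t).2 ht), hextκ]
    · rw [if_neg ht, if_neg (fun h => ht ((hQ t).1 h)), hb.optAut_some, hext]
  let Q₁ : Set (ℤ × Bool) := {t | t.2 = true}
  let Q₂ : Set (ℤ × Bool) := {t | t.2 = true ∧ t ≠ (0, true)}
  have hH1 : S Q₁ ∈ H := by
    -- Translation of the copies preserves Q₁. Its orbits on the basis are infinite and indexed by D
    -- × Bool ≃ J, so g conjugates it into the given shift.
    let ω : Equiv.Perm (ℤ × Bool) := Equiv.prodCongr (Equiv.addRight 1) (Equiv.refl Bool)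
    let g : Equiv.Perm (J × ℤ) :=
      (((Equiv.prodCongr eJ.symm (Equiv.refl ℤ)).trans (Equiv.prodAssoc D Bool ℤ)).trans
        (Equiv.prodCongr (Equiv.refl D) (Equiv.prodComm Bool ℤ))).trans e
    have hg : g * shift J = ext ω * g := by
      ext1 ⟨j, n⟩
      simp [g, hext, ω]
    have hgaut : hb.optAut g * hb.optAut (shift J) = hb.optAut (ext ω) * hb.optAut g := by
      rw [← hb.optAut_mul, ← hb.optAut_mul, hg]
    have hωS := hcomm ω Q₁ Q₁ (fun t => Iff.rfl)
    have hmem : (hb.optAut g)⁻¹ * S Q₁ * hb.optAut g ∈ H := by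
      refine h1 _ ?_ ?_ ?_
      · simpa using conj_mem_IA (hSIA Q₁) (hb.optAut g)⁻¹
      · rw [← hb.optAut_inv]
        simp [MulAut.mul_apply, hS0]
      · calc (hb.optAut g)⁻¹ * S Q₁ * hb.optAut g * hb.optAut (shift J)
            = (hb.optAut g)⁻¹ * S Q₁ * (hb.optAut g * hb.optAut (shift J)) := by group
          _ = (hb.optAut g)⁻¹ * (S Q₁ * hb.optAut (ext ω)) * hb.optAut g := by rw [hgaut]; group
          _ = (hb.optAut g)⁻¹ * (hb.optAut (ext ω) * hb.optAut g) * (hb.optAut g)⁻¹ * S Q₁ *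
                hb.optAut g := by rw [← hωS]; group
          _ = hb.optAut (shift J) * ((hb.optAut g)⁻¹ * S Q₁ * hb.optAut g) := by
                rw [← hgaut]; group
    have h3 := h2 g _ hmem
    have h4 : hb.optAut g * ((hb.optAut g)⁻¹ * S Q₁ * hb.optAut g) * (hb.optAut g)⁻¹ = S Q₁ := by
      group
    rwa [h4] at h3
  have hH2 : S Q₂ ∈ H := by
    have h3 := h2 (ext skip) _ hH1
    rwa [hcomm skip Q₁ Q₂ skip_mem, mul_inv_cancel_right] at h3
  have hfix : ∀ φ : N →* N, φ (b none) = b none → (∀ d : D, φ (b (some d)) = b (some d)) →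
      ∀ d : D, φ (σ (b (some d))) = σ (b (some d)) := by
    intro φ hφ0 hφ d
    refine hom_eq_on_closure (ψ := MonoidHom.id N) ?_ (hσD' d d.2)
    rintro _ (rfl | ⟨i, hi, rfl⟩)
    · exact hφ0
    · exact hφ ⟨i, hi⟩
  -- The two repetitions differ in the copy D alone, where they differ by σ. The values of σ on D
  -- involve only D and the distinguished letter, so S Q₂ fixes them.
  have hfinal : S Q₂ * σ = S Q₁ := by
    refine hb.opt_ext (by rw [MulAut.mul_apply, hσ0, hS0, hS0]) fun i => ?_
    obtain ⟨⟨d, t⟩, rfl⟩ := e.surjective i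
    rw [MulAut.mul_apply]
    by_cases ht : t = (0, true)
    · subst ht
      have hQ₁ : ((0, true) : ℤ × Bool) ∈ Q₁ := rfl
      have hQ₂ : ((0, true) : ℤ × Bool) ∉ Q₂ := fun h => h.2 rfl
      rw [hSe Q₁, if_pos hQ₁, he,
        hfix (κ (0, true)) (hκ0 _) (fun d => by rw [hκD, he])]
      refine hfix (S Q₂).toMonoidHom (hS0 Q₂) (fun d => ?_) d
      have := hSe Q₂ d (0, true)
      rwa [if_neg hQ₂, he] at this
    · have hnD : e (d, t) ∉ D := by
        intro hD
        have := he ⟨_, hD⟩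
        have h3 := e.injective this
        exact ht (Prod.ext_iff.1 h3).2.symm
      have hQ : t ∈ Q₂ ↔ t ∈ Q₁ := ⟨fun h => h.1, fun h => ⟨h, ht⟩⟩
      rw [hσD _ hnD, hSe, hSe, hQ]
  rw [eq_inv_mul_of_mul_eq hfinal]
  exact mul_mem (inv_mem hH2) hH1

end Swindle

end FreeNilpotent

/-! ### Generation of the stabilizers -/

namespace FreeNilpotent

open LowerCentral

/-! ### Commutators that avoid a color -/

section Colors

variable {N : Type*} [Group N]

/-- The left-normed commutators of weight `k + 1` in the members of a family. -/
def comWords {κ : Type*} (b : κ → N) : ℕ → Set N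
  | 0 => Set.range b
  | k + 1 => {w | ∃ v ∈ comWords b k, ∃ i, w = ⁅v, b i⁆}

theorem comWords_subset {κ : Type*} (b : κ → N) (k : ℕ) : comWords b k ⊆ lcs N k := by
  induction k with
  | zero => exact fun _ _ => Subgroup.mem_top _
  | succ k ih =>
    rintro _ ⟨v, hv, i, rfl⟩
    exact commutator_mem_lcs (j := 0) le_rfl (ih hv) (Subgroup.mem_top _)

theorem lcs_le_closure_comWords {κ : Type*} {b : κ → N}
    (hb : Subgroup.closure (Set.range b) = ⊤) (k : ℕ) :
    lcs N k ≤ Subgroup.closure (comWords b k) ⊔ lcs N (k + 1) := by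
  induction k with
  | zero => exact hb.symm.le.trans le_sup_left
  | succ k ih =>
    change ⁅lcs N k, ⊤⁆ ≤ _
    rw [Subgroup.commutator_le]
    intro a ha c _
    refine commutator_closure_left_mem (i := k + 1) (j := 1) (by omega) le_rfl
      (T := Subgroup.closure (comWords b (k + 1)) ⊔ lcs N (k + 1 + 1)) le_sup_right
      (comWords_subset b k) (Subgroup.mem_top c) (fun v hv => ?_) (ih ha)
    refine commutator_closure_right_mem (i := k + 1) (j := 1) (B := Set.range b) (by omega) le_rfl
      (T := Subgroup.closure (comWords b (k + 1)) ⊔ lcs N (k + 1 + 1)) le_sup_right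
      (fun _ _ => Subgroup.mem_top _) (comWords_subset b k hv) ?_
      (Subgroup.mem_sup_left (hb ▸ Subgroup.mem_top c))
    rintro _ ⟨i, rfl⟩
    exact Subgroup.mem_sup_left (Subgroup.subset_closure ⟨v, hv, i, rfl⟩)

variable {ι C : Type*} (b : Option ι → N) (m : ι → C)

/-- The subgroup generated by the distinguished member of a family and the members which are
not of the color `j`. -/
def avoid (j : C) : Subgroup N :=
  Subgroup.closure (insert (b none) ((fun i => b (some i)) '' {i | m i ≠ j}))

/-- Each of the k + 1 letters contributes at most one color, and the distinguished letter none. -/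
theorem exists_colors_of_comWords [DecidableEq C] (k : ℕ) {w : N} (hw : w ∈ comWords b k) :
    ∃ E : Finset C, E.card ≤ k + 1 ∧ ∀ j ∉ E, w ∈ avoid b m j := by
  have hletter : ∀ o, ∃ E : Finset C, E.card ≤ 1 ∧ ∀ j ∉ E, b o ∈ avoid b m j := by
    intro o
    cases o with
    | none => exact ⟨∅, by simp, fun j _ => Subgroup.subset_closure (Set.mem_insert _ _)⟩
    | some i =>
      refine ⟨{m i}, by simp, fun j hj => Subgroup.subset_closure (Set.mem_insert_of_mem _ ?_)⟩
      exact ⟨i, fun h => hj (by simp [h]), rfl⟩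
  induction k generalizing w with
  | zero =>
    obtain ⟨o, rfl⟩ := hw
    exact hletter o
  | succ k ih =>
    obtain ⟨v, hv, o, rfl⟩ := hw
    obtain ⟨E, hE, hvE⟩ := ih hv
    obtain ⟨E', hE', hoE⟩ := hletter o
    refine ⟨E ∪ E', (Finset.card_union_le _ _).trans (by omega), fun j hj => ?_⟩
    rw [Finset.mem_union, not_or] at hj
    have h1 := hvE j hj.1
    have h2 := hoE j hj.2
    rw [commutatorElement_def]
    exact mul_mem (mul_mem (mul_mem h1 h2) (inv_mem h1)) (inv_mem h2)

/-- The elements of `γ_{k+1}(N)` which avoid the color `j`, for `j` other than `j₀`. -/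
def avoidLcs [DecidableEq C] (k : ℕ) (j₀ j : C) : Subgroup N :=
  if j = j₀ then ⊥ else lcs N k ⊓ avoid b m j

variable {b m}

theorem avoidLcs_le [DecidableEq C] (k : ℕ) (j₀ j : C) : avoidLcs b m k j₀ j ≤ lcs N k := by
  rw [avoidLcs]
  split_ifs
  · exact bot_le
  · exact inf_le_left

/-- A commutator uses at most k + 1 colors; with j₀ this excludes k + 2, so one color remains. The
color j₀ is barred because the factor belonging to a color must fix the letters of that color. -/
theorem lcs_le_sup_avoidLcs [DecidableEq C] [Fintype C]
    (hb : Subgroup.closure (Set.range b) = ⊤) {k : ℕ} (hk : k + 3 ≤ Fintype.card C) (j₀ : C) :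
    lcs N k ≤ Finset.univ.sup (avoidLcs b m k j₀) ⊔ lcs N (k + 1) := by
  refine (lcs_le_closure_comWords hb k).trans (sup_le_sup_right ?_ _)
  rw [Subgroup.closure_le]
  intro w hw
  obtain ⟨E, hE, hwE⟩ := exists_colors_of_comWords b m k hw
  obtain ⟨j, hj⟩ : ∃ j, j ∉ insert j₀ E := by
    by_contra! h
    have h1 := Finset.card_le_card (fun j _ => h j : Finset.univ ⊆ insert j₀ E)
    have h2 := Finset.card_insert_le j₀ E
    rw [Finset.card_univ] at h1
    omega
  rw [Finset.mem_insert, not_or] at hj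
  refine Finset.le_sup (f := avoidLcs b m k j₀) (Finset.mem_univ j) ?_
  rw [avoidLcs, if_neg hj.1]
  exact ⟨comWords_subset b k hw, hwE j hj.2⟩

end Colors

/-! ### Factoring the stabilizer into automorphisms of moieties -/

section Generation

variable {N : Type*} [Group N]

theorem normal_of_lcs_le {k : ℕ} {T : Subgroup N} (h1 : lcs N (k + 1) ≤ T) (h2 : T ≤ lcs N k) :
    T.Normal :=
  ⟨fun _ hx y => conj_mem_of_gam_le (n := k + 1) (by omega) h1 (h2 hx) hx y⟩

/-- If `H` contains all elements of `IA_k(N)_(x)` which act on a moiety, and `IA_{k+1}(N)_(x)`,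
then it contains `IA_k(N)_(x)`. -/
theorem IsRelBasis.stabIA_le_of_colors {ι C : Type*} [DecidableEq C] [Fintype C]
    {b : Option ι → N} {c k : ℕ} (hN : lcs N c = ⊥) (hk : 1 ≤ k) (hb : IsRelBasis b) {m : ι → C}
    (hC : k + 3 ≤ Fintype.card C) {H : Subgroup (MulAut N)}
    (h1 : ∀ j, ∀ σ ∈ IA N k, σ (b none) = b none → (∀ i, m i = j → σ (b (some i)) = b (some i)) →
      (∀ i, m i ≠ j → σ (b (some i)) ∈ avoid b m j) → σ ∈ H)
    (h2 : stabIA (k + 1) (b none) ≤ H) : stabIA k (b none) ≤ H := by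
  -- Here s holds the colors not yet split off. The factor η takes the part v of the color j, and
  -- η⁻¹σ is left with the part w.
  have key : ∀ s : Finset C, ∀ σ ∈ IA N k, σ (b none) = b none →
      (∀ i, (b (some i))⁻¹ * σ (b (some i)) ∈ s.sup (avoidLcs b m k (m i)) ⊔ lcs N (k + 1)) →
      σ ∈ H := by
    intro s
    induction s using Finset.induction_on with
    | empty =>
      intro σ hσ hσ0 hσs
      refine h2 ⟨?_, hσ0⟩
      obtain ⟨σ', hσ', hσb⟩ := hb.exists_IA hN (by omega : 1 ≤ k + 1)
        (u := fun o => (b o)⁻¹ * σ (b o)) (by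
          intro o
          cases o with
          | none => rw [hσ0, inv_mul_cancel]; exact one_mem _
          | some i => simpa using hσs i)
      have e : σ = σ' := hb.aut_ext fun o => by rw [hσb, mul_inv_cancel_left]
      rwa [e]
    | insert j s _ ih =>
      intro σ hσ hσ0 hσs
      have hT : ∀ i, s.sup (avoidLcs b m k (m i)) ⊔ lcs N (k + 1) ≤ lcs N k := fun i =>
        sup_le (Finset.sup_le fun j' _ => avoidLcs_le k _ j') (lcs_le (Nat.le_succ k))
      have hdec : ∀ i, ∃ v ∈ avoidLcs b m k (m i) j,
          ∃ w ∈ s.sup (avoidLcs b m k (m i)) ⊔ lcs N (k + 1),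
            v * w = (b (some i))⁻¹ * σ (b (some i)) := by
        intro i
        have := hσs i
        rw [Finset.sup_insert, sup_assoc] at this
        have hn := normal_of_lcs_le le_sup_right (hT i)
        exact Subgroup.mem_sup_of_normal_right.1 this
      choose v hv w hw hvw using hdec
      obtain ⟨η, hη, hηb⟩ := hb.exists_IA hN hk (u := fun o => o.elim 1 v) (by
        intro o
        cases o with
        | none => exact one_mem _
        | some i => exact avoidLcs_le k _ _ (hv i))
      have hη0 : η (b none) = b none := by simp [hηb]
      have hηs : ∀ i, η (b (some i)) = b (some i) * v i := fun i => hηb (some i)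
      have hηH : η ∈ H := by
        refine h1 j η hη hη0 (fun i hi => ?_) fun i hi => ?_
        · have h3 := hv i
          rw [avoidLcs, if_pos hi.symm, Subgroup.mem_bot] at h3
          rw [hηs, h3, mul_one]
        · have h3 := hv i
          rw [avoidLcs, if_neg (Ne.symm hi)] at h3
          rw [hηs]
          exact mul_mem (Subgroup.subset_closure (Set.mem_insert_of_mem _ ⟨i, hi, rfl⟩)) h3.2
      have hηinv : ∀ a, η⁻¹ (η a) = a := fun a => by
        rw [← MulAut.mul_apply, inv_mul_cancel, MulAut.one_apply]
      have h4 : η⁻¹ * σ ∈ H := by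
        refine ih _ (mul_mem (inv_mem hη) hσ) ?_ fun i => ?_
        · rw [MulAut.mul_apply, hσ0]
          conv_lhs => rw [← hη0]
          rw [hηinv]
        · have e : σ (b (some i)) = η (b (some i)) * w i := by
            rw [hηs, mul_assoc, hvw, mul_inv_cancel_left]
          rw [MulAut.mul_apply, e, map_mul, hηinv, inv_mul_cancel_left]
          -- η⁻¹ changes w only by elements of γ_{2k+1}(N), and 2k ≥ k + 1 as k ≥ 1.
          have h5 : (w i)⁻¹ * η⁻¹ (w i) ∈ lcs N (k + 1) :=
            lcs_le (by omega) (IA_agree (inv_mem hη) k (hT i (hw i)))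
          have h6 := mul_mem (hw i) (Subgroup.mem_sup_right
            (S := s.sup (avoidLcs b m k (m i))) h5)
          rwa [mul_inv_cancel_left] at h6
      have := mul_mem hηH h4
      rwa [mul_inv_cancel_left] at this
  rintro σ ⟨hσ, hσ0⟩
  exact key Finset.univ σ hσ hσ0 fun i =>
    lcs_le_sup_avoidLcs hb.closure_eq hC (m i) (mem_IA_iff.1 hσ _)

theorem nonempty_prod_countable_equiv (α T : Type*) [Infinite α] [Countable T] [Nonempty T] :
    Nonempty (α × T ≃ α) := by
  rw [← Cardinal.lift_mk_eq']
  rw [Cardinal.mk_prod, Cardinal.lift_mul, Cardinal.lift_lift, Cardinal.lift_lift]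
  rw [Cardinal.mul_eq_left]
  · simp
  · refine le_trans (b := Cardinal.aleph0) ?_ ?_ <;> simp
  · simp

/-- The complement has the cardinality of D, hence room for all the copies other than D itself. -/
theorem exists_moiety_equiv {ι : Type*} {D : Set ι} [Infinite D] (h : Nonempty (D ≃ (Dᶜ : Set ι))) :
    ∃ e : D × (ℤ × Bool) ≃ ι, ∀ d, e (d, (0, true)) = d := by
  classical
  have hne : Nonempty {t : ℤ × Bool // t ≠ (0, true)} := ⟨⟨(0, false), by simp⟩⟩
  obtain ⟨f⟩ := nonempty_prod_countable_equiv D {t : ℤ × Bool // t ≠ (0, true)}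
  obtain ⟨g⟩ := h
  let F : D × (ℤ × Bool) → ι := fun p => if h : p.2 = (0, true) then p.1 else g (f (p.1, ⟨p.2, h⟩))
  have hF0 : ∀ d, F (d, (0, true)) = d := fun d => by simp [F]
  have hF1 : ∀ d t (h : t ≠ (0, true)), F (d, t) = g (f (d, ⟨t, h⟩)) := fun d t h => by
    simp only [F]
    rw [dif_neg h]
  have hF : Function.Bijective F := by
    constructor
    · rintro ⟨d, t⟩ ⟨d', t'⟩ h
      by_cases ht : t = (0, true) <;> by_cases ht' : t' = (0, true)
      · subst ht ht'
        rw [hF0, hF0] at h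
        rw [Subtype.ext h]
      · subst ht
        rw [hF0, hF1 _ _ ht'] at h
        exact absurd (h ▸ d.2) (g _).2
      · subst ht'
        rw [hF0, hF1 _ _ ht] at h
        exact absurd (h ▸ d'.2) (g _).2
      · rw [hF1 _ _ ht, hF1 _ _ ht'] at h
        have h1 := f.injective (g.injective (Subtype.ext h))
        have h2 : d = d' := congrArg Prod.fst h1
        have h3 : t = t' := congrArg (fun p => (p.2 : ℤ × Bool)) h1
        rw [h2, h3]
    · intro i
      by_cases hi : i ∈ D
      · exact ⟨(⟨i, hi⟩, (0, true)), hF0 _⟩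
      · refine ⟨((f.symm (g.symm ⟨i, hi⟩)).1, (f.symm (g.symm ⟨i, hi⟩)).2), ?_⟩
        rw [hF1 _ _ (f.symm (g.symm ⟨i, hi⟩)).2.2]
        simp
  exact ⟨Equiv.ofBijective F hF, hF0⟩

/-- With at least two colors, each of full size, both a color class and its complement are
equinumerous with ι. -/
theorem exists_coloring {ι : Type*} [Infinite ι] (r : ℕ) :
    ∃ m : ι → Fin (r + 2), ∀ j, Nonempty ({i | m i ≠ j} ≃ ι) ∧
      Nonempty ({i | m i ≠ j} ≃ ({i | m i ≠ j}ᶜ : Set ι)) := by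
  obtain ⟨f⟩ := nonempty_prod_countable_equiv ι (Fin (r + 2))
  refine ⟨fun i => (f.symm i).2, fun j => ?_⟩
  have h1 : Nonempty ({i | (f.symm i).2 ≠ j} ≃ ι) := by
    have hne : Nonempty {j' : Fin (r + 2) // j' ≠ j} := by
      obtain ⟨j', hj'⟩ := exists_ne j
      exact ⟨⟨j', hj'⟩⟩
    obtain ⟨g⟩ := nonempty_prod_countable_equiv ι {j' : Fin (r + 2) // j' ≠ j}
    refine ⟨Equiv.trans ?_ g⟩
    exact
      { toFun := fun i => ((f.symm i).1, ⟨(f.symm i).2, i.2⟩)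
        invFun := fun p => ⟨f (p.1, p.2), by simpa using p.2.2⟩
        left_inv := fun i => by simp
        right_inv := fun p => by simp }
  obtain ⟨g⟩ := h1
  refine ⟨⟨g⟩, ⟨g.trans ?_⟩⟩
  exact
    { toFun := fun i => ⟨f (i, j), by simp⟩
      invFun := fun i => (f.symm i).1
      left_inv := fun i => by simp
      right_inv := fun i => by
        have hi : (f.symm i).2 = j := not_not.1 i.2
        ext
        simp [← hi] }

/-- A group of automorphisms which contains the elements of `IA_k(N)_(x)` commuting with the
shift, and is invariant under permutations of the basis, contains `IA_k(N)_(x)`. -/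
theorem IsRelBasis.stabIA_le {J : Type*} [Infinite J] {b : Option (J × ℤ) → N} {c k : ℕ}
    (hN : lcs N c = ⊥) (hk : 1 ≤ k) (hb : IsRelBasis b) {H : Subgroup (MulAut N)}
    (h1 : ∀ η ∈ IA N k, η (b none) = b none →
      η * hb.optAut (shift J) = hb.optAut (shift J) * η → η ∈ H)
    (h2 : ∀ s, ∀ η ∈ H, hb.optAut s * η * (hb.optAut s)⁻¹ ∈ H) : stabIA k (b none) ≤ H := by
  -- Descending induction on l, with n bounding the distance to c, where IA_c(N) is trivial.
  suffices hs : ∀ n l, k ≤ l → c ≤ l + n → stabIA l (b none) ≤ H from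
    hs c k le_rfl (by omega)
  intro n
  induction n with
  | zero =>
    intro l _ hcl σ hσ
    have : σ = 1 := by
      ext a
      have h3 := mem_IA_iff.1 hσ.1 a
      rw [lcs_eq_bot_of_le (by omega) hN, Subgroup.mem_bot, inv_mul_eq_one] at h3
      exact h3.symm
    rw [this]
    exact one_mem _
  | succ n ih =>
    intro l hkl hcl
    rcases Nat.lt_or_ge c l with hlt | hge
    · refine le_trans ?_ (ih (l + 1) (by omega) (by omega))
      rintro σ ⟨hσ, hσ0⟩
      refine ⟨mem_IA_iff.2 fun a => ?_, hσ0⟩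
      rw [lcs_eq_bot_of_le (by omega) hN, ← lcs_eq_bot_of_le hlt.le hN]
      exact mem_IA_iff.1 hσ a
    -- This gives c + 3 colors, enough for each l ≤ c.
    · obtain ⟨m, hm⟩ := exists_coloring (ι := J × ℤ) (c + 1)
      refine hb.stabIA_le_of_colors hN (by omega) (m := m) (by simpa using hge) ?_
        (ih (l + 1) (by omega) (by omega))
      intro j σ hσ hσ0 hσj hσj'
      obtain ⟨⟨g⟩, hDc⟩ := hm j
      have : Infinite {i | m i ≠ j} := Infinite.of_injective _ g.symm.injective
      obtain ⟨e, he⟩ := exists_moiety_equiv hDc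
      obtain ⟨f⟩ := nonempty_prod_countable_equiv (J × ℤ) Bool
      obtain ⟨f'⟩ := nonempty_prod_countable_equiv J ℤ
      refine hb.mem_of_moiety hN (by omega : 1 ≤ l) (fun η hη => h1 η (IA_antitone hkl hη)) h2 e he
        (((Equiv.prodCongr g (Equiv.refl Bool)).trans f).trans f') hσ hσ0
        (fun i hi => hσj i (not_not.1 hi)) hσj'

end Generation

end FreeNilpotent

/-! ### The stabilizers and the permutations of a basis of conjugations -/

namespace FreeNilpotent

open LowerCentral

variable {N : Type*} [Group N]

theorem IsInnBasis.isRelBasis_of_equiv {c : ℕ} (hc : 2 ≤ c) {B : Set N} (hB : IsBasisOf c B ⊤)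
    (hnt : B.Nontrivial) {X : Set (MulAut N)} (hX : IsInnBasis X) {κ : Type*} (E : κ ≃ X)
    {b : κ → N} (h : ∀ i, MulAut.conj (b i) = E i) : IsRelBasis b := by
  have h1 := (hX.isRelBasis hc hB hnt (y := b ∘ E.symm) (fun t => by simp [h])).comp_equiv E
  have e : (b ∘ E.symm) ∘ E = b := by
    funext i
    simp
  rwa [e] at h1

theorem exists_apply_eq_of_mem_symConjStab {X : Set (MulAut N)} {x : N} {ρ : MulAut N}
    (hρ : ρ ∈ symConjStab X (MulAut.conj x)) : x⁻¹ * ρ x ∈ Subgroup.center N := by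
  have h := hρ.2
  rw [mul_conj_mul_inv] at h
  exact conj_eq_conj_iff.1 h.symm

theorem conj_mem_closure_of_mem_symConjStab {X : Set (MulAut N)} {τ π ρ : MulAut N} {k : ℕ}
    (hρ : ρ ∈ symConjStab X τ) {σ : MulAut N}
    (hσ : σ ∈ Subgroup.closure {σ | ∃ ρ ∈ symConjStab X τ, ∃ η ∈ IA N k,
      η * π = π * η ∧ σ = ρ * η * ρ⁻¹}) :
    ρ * σ * ρ⁻¹ ∈ Subgroup.closure {σ | ∃ ρ ∈ symConjStab X τ, ∃ η ∈ IA N k,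
      η * π = π * η ∧ σ = ρ * η * ρ⁻¹} := by
  induction hσ using Subgroup.closure_induction with
  | mem σ hσ =>
    obtain ⟨ρ', hρ', η, hη, hc, rfl⟩ := hσ
    exact Subgroup.subset_closure ⟨ρ * ρ', mul_mem hρ hρ', η, hη, hc, by group⟩
  | one => simp [one_mem]
  | mul σ τ _ _ hσ hτ =>
    have e : ρ * (σ * τ) * ρ⁻¹ = (ρ * σ * ρ⁻¹) * (ρ * τ * ρ⁻¹) := by group
    rw [e]
    exact mul_mem hσ hτ
  | inv σ _ hσ =>
    have e : ρ * σ⁻¹ * ρ⁻¹ = (ρ * σ * ρ⁻¹)⁻¹ := by group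
    rw [e]
    exact inv_mem hσ

/-- The description of `IA_k(N)_(x)` with the help of an automorphism which shifts a basis. -/
theorem IsRelBasis.stabIA_eq_closure {J : Type*} [Infinite J] {b : Option (J × ℤ) → N} {c k : ℕ}
    (hc : 2 ≤ c) (hN : lcs N c = ⊥) (hZ : Subgroup.center N ≤ lcs N (c - 1)) (hk : 1 ≤ k)
    (hb : IsRelBasis b) {π : MulAut N}
    (hπ : ∀ j n, π (b (some (j, n))) = b (some (j, n + 1)))
    (hπ0 : (b none)⁻¹ * π (b none) ∈ Subgroup.center N) :
    stabIA k (b none) = Subgroup.closure {σ |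
      ∃ ρ ∈ symConjStab (Set.range fun o => MulAut.conj (b o)) (MulAut.conj (b none)),
        ∃ η ∈ IA N k, η * π = π * η ∧ σ = ρ * η * ρ⁻¹} := by
  have hfix : ∀ η ∈ IA N k, ∀ z ∈ Subgroup.center N, η z = z := fun η hη z hz =>
    IA_apply_center (by omega) hN hZ hk hη hz
  have hπsome : ∀ i, π (b (some i)) = hb.optAut (shift J) (b (some i)) := by
    rintro ⟨j, n⟩
    rw [hπ, hb.optAut_some, shift_apply]
  -- π need not fix the distinguished letter, but it differs from the pure shift only by a central
  -- factor there.
  have hagree : ∀ a ∈ lcs N 1, π a = hb.optAut (shift J) a := by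
    intro a ha
    refine hb.eq_on_lcs_one (by omega) hN hZ (fun o => ?_) ha
    cases o with
    | none =>
      rw [hb.optAut_none]
      simpa using inv_mem hπ0
    | some i =>
      rw [hπsome, inv_mul_cancel]
      exact one_mem _
  obtain ⟨z, hz, hzπ⟩ : ∃ z ∈ Subgroup.center N, π (b none) = b none * z :=
    ⟨_, hπ0, by rw [mul_inv_cancel_left]⟩
  refine le_antisymm (hb.stabIA_le hN hk ?_ ?_) ?_
  · intro η hη hη0 hcomm
    refine Subgroup.subset_closure ⟨1, one_mem _, η, hη, hb.opt_ext ?_ fun i => ?_, by simp⟩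
    · rw [MulAut.mul_apply, MulAut.mul_apply, hη0, hzπ, map_mul, hη0, hfix η hη z hz]
    · obtain ⟨u, hu, hηu⟩ : ∃ u ∈ lcs N k, η (b (some i)) = b (some i) * u :=
        ⟨_, mem_IA_iff.1 hη _, by rw [mul_inv_cancel_left]⟩
      rw [MulAut.mul_apply, MulAut.mul_apply, hπsome, ← MulAut.mul_apply, hcomm, MulAut.mul_apply,
        hηu, map_mul, map_mul, hπsome, hagree u (lcs_le hk hu)]
  · exact fun s η hη => conj_mem_closure_of_mem_symConjStab (hb.optAut_mem_symConjStab s) hη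
  · rw [Subgroup.closure_le]
    rintro _ ⟨ρ, hρ, η, hη, hcomm, rfl⟩
    refine ⟨conj_mem_IA hη ρ, ?_⟩
    -- The central z with π(x) = xz is fixed by η and cancels, so π fixes x⁻¹η(x), which lies in
    -- γ_2(N), where π is the shift.
    have hη0 : η (b none) = b none := by
      have h1 : (b none)⁻¹ * η (b none) ∈ lcs N 1 := lcs_le hk (mem_IA_iff.1 hη _)
      have h2 : π ((b none)⁻¹ * η (b none)) = (b none)⁻¹ * η (b none) := by
        rw [map_mul, map_inv, ← MulAut.mul_apply, ← hcomm, MulAut.mul_apply, hzπ, map_mul,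
          hfix η hη z hz, mul_inv_rev, mul_assoc]
        rw [← mul_assoc (b none)⁻¹, Subgroup.mem_center_iff.1 hz, inv_mul_cancel_left]
      have h3 := hb.eq_one_of_shift_fixed h1 (by rw [← hagree _ h1, h2])
      exact (inv_mul_eq_one.1 h3).symm
    -- ρ⁻¹ moves x by a central factor, which η fixes, so ρηρ⁻¹ also fixes x.
    obtain ⟨z', hz', hρz⟩ : ∃ z' ∈ Subgroup.center N, ρ⁻¹ (b none) = b none * z' :=
      ⟨_, exists_apply_eq_of_mem_symConjStab (inv_mem hρ), by rw [mul_inv_cancel_left]⟩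
    change (ρ * η * ρ⁻¹) (b none) = b none
    rw [MulAut.mul_apply, MulAut.mul_apply, hρz, map_mul, hη0, hfix η hη z' hz', ← hρz,
      ← MulAut.mul_apply, mul_inv_cancel, MulAut.one_apply]

/-- A permutation all of whose orbits are infinite is a shift. -/
theorem exists_shift_equiv {ι : Type*} (p : Equiv.Perm ι)
    (hp : ∀ i, ∀ n : ℤ, (p ^ n) i = i → n = 0) :
    ∃ e : Quotient (Equiv.Perm.SameCycle.setoid p) × ℤ ≃ ι,
      ∀ j n, e (j, n) = (p ^ n) j.out := by
  refine ⟨Equiv.ofBijective (fun q => (p ^ q.2) q.1.out) ⟨?_, ?_⟩, fun j n => rfl⟩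
  · rintro ⟨j, n⟩ ⟨j', n'⟩ h
    have h : (p ^ n) j.out = (p ^ n') j'.out := h
    have hs : p.SameCycle j.out j'.out :=
      (Equiv.Perm.sameCycle_zpow_left.1 (h ▸ Equiv.Perm.sameCycle_zpow_left.2
        (Equiv.Perm.SameCycle.refl p j'.out)))
    have hj : j = j' := by
      rw [← Quotient.out_eq j, ← Quotient.out_eq j']
      exact Quotient.sound hs
    subst hj
    have h0 := hp j.out (-n' + n) (by
      rw [zpow_add, Equiv.Perm.mul_apply, h, ← Equiv.Perm.mul_apply, ← zpow_add]
      simp)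
    rw [show n = n' by omega]
  · intro i
    obtain ⟨n, hn⟩ : p.SameCycle (Quotient.mk (Equiv.Perm.SameCycle.setoid p) i).out i :=
      Quotient.mk_out (s := Equiv.Perm.SameCycle.setoid p) i
    exact ⟨(Quotient.mk _ i, n), hn⟩

theorem conjOrbit_finite {π τ : MulAut N} {n : ℤ} (hn : n ≠ 0)
    (h : π ^ n * τ * (π ^ n)⁻¹ = τ) : (conjOrbit π τ).Finite := by
  have hcomm : Commute (π ^ n) τ := by
    rw [mul_inv_eq_iff_eq_mul] at h
    exact h
  refine ((Set.finite_Ico 0 |n|).image fun m : ℤ => π ^ m * τ * (π ^ m)⁻¹).subset ?_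
  rintro _ ⟨m, rfl⟩
  refine ⟨m % n, ⟨Int.emod_nonneg _ hn, Int.emod_lt_abs _ hn⟩, ?_⟩
  have e : π ^ m = π ^ (m % n) * (π ^ n) ^ (m / n) := by
    rw [← zpow_mul, ← zpow_add, Int.emod_add_mul_ediv]
  have h1 : (π ^ n) ^ (m / n) * τ * ((π ^ n) ^ (m / n))⁻¹ = τ := by
    rw [(hcomm.zpow_left (m / n)).eq, mul_inv_cancel_right]
  change π ^ (m % n) * τ * (π ^ (m % n))⁻¹ = π ^ m * τ * (π ^ m)⁻¹
  calc π ^ (m % n) * τ * (π ^ (m % n))⁻¹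
      = π ^ (m % n) * ((π ^ n) ^ (m / n) * τ * ((π ^ n) ^ (m / n))⁻¹) * (π ^ (m % n))⁻¹ := by
        rw [h1]
    _ = π ^ m * τ * (π ^ m)⁻¹ := by rw [e]; group

theorem conjOrbit_conj (π τ : MulAut N) (m : ℤ) :
    conjOrbit π (π ^ m * τ * (π ^ m)⁻¹) = conjOrbit π τ := by
  have : ∀ (π τ : MulAut N) (m : ℤ),
      conjOrbit π (π ^ m * τ * (π ^ m)⁻¹) ⊆ conjOrbit π τ := by
    rintro π τ m _ ⟨n, rfl⟩
    exact ⟨n + m, by dsimp only; rw [zpow_add]; group⟩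
  refine (this π τ m).antisymm ?_
  have h := this π (π ^ m * τ * (π ^ m)⁻¹) (-m)
  have e : π ^ (-m) * (π ^ m * τ * (π ^ m)⁻¹) * (π ^ (-m))⁻¹ = τ := by group
  rwa [e] at h

/-- Lifts of a relative basis of the inner automorphism group, with a prescribed lift of one of
its members. -/
theorem IsInnBasis.isRelBasis_elim {c : ℕ} (hc : 2 ≤ c) {B : Set N} (hB : IsBasisOf c B ⊤)
    (hnt : B.Nontrivial) {X : Set (MulAut N)} (hX : IsInnBasis X) {x : N}
    (hx : MulAut.conj x ∈ X) {κ : Type*} (e : κ ≃ (X \ {MulAut.conj x} : Set (MulAut N)))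
    {y : κ → N} (hy : ∀ q, MulAut.conj (y q) = e q) :
    IsRelBasis (fun o : Option κ => o.elim x y) ∧
      (Set.range fun o : Option κ => MulAut.conj (o.elim x y)) = X := by
  set b : Option κ → N := fun o => o.elim x y with hbdef
  have hbsome : ∀ q, MulAut.conj (b (some q)) = e q := hy
  have hbmem : ∀ o, MulAut.conj (b o) ∈ X := by
    intro o
    cases o with
    | none => exact hx
    | some q => rw [hbsome]; exact (e q).2.1
  have hE : Function.Bijective fun o => (⟨MulAut.conj (b o), hbmem o⟩ : X) := by
    constructor
    · intro o o' h
      have h : MulAut.conj (b o) = MulAut.conj (b o') := congrArg Subtype.val h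
      cases o with
      | none =>
        cases o' with
        | none => rfl
        | some q =>
          rw [hbsome] at h
          exact absurd h.symm (e q).2.2
      | some q =>
        cases o' with
        | none =>
          rw [hbsome] at h
          exact absurd h (e q).2.2
        | some q' =>
          rw [hbsome, hbsome] at h
          rw [e.injective (Subtype.ext h)]
    · rintro ⟨t, ht⟩
      by_cases h : t = MulAut.conj x
      · exact ⟨none, Subtype.ext h.symm⟩
      · obtain ⟨q, hq⟩ := e.surjective ⟨t, ht, h⟩
        exact ⟨some q, Subtype.ext ((hbsome q).trans (congrArg Subtype.val hq))⟩
  refine ⟨hX.isRelBasis_of_equiv hc hB hnt (Equiv.ofBijective _ hE) fun o => rfl, ?_⟩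
  ext t
  constructor
  · rintro ⟨o, rfl⟩
    exact hbmem o
  · intro ht
    obtain ⟨o, ho⟩ := hE.2 ⟨t, ht⟩
    exact ⟨o, congrArg Subtype.val ho⟩

theorem stabIA_eq_closure {c k : ℕ} (hc : 2 ≤ c) {B : Set N} (hB : IsBasisOf c B ⊤)
    (hnt : B.Nontrivial) {X : Set (MulAut N)} (hX : IsInnBasis X) {x : N} (hx : MulAut.conj x ∈ X)
    (hk : 1 ≤ k) {π : MulAut N} (hπ : IsPiStar X (MulAut.conj x) π) :
    stabIA k x = Subgroup.closure {σ | ∃ ρ ∈ symConjStab X (MulAut.conj x), ∃ η ∈ IA N k,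
      η * π = π * η ∧ σ = ρ * η * ρ⁻¹} := by
  set τ := MulAut.conj x with hτ
  obtain ⟨hπX, hinf, horb⟩ := hπ
  have hmem : ∀ ρ ∈ symConjStab X τ, ∀ t, t ∈ X \ {τ} ↔ ρ * t * ρ⁻¹ ∈ X \ {τ} := by
    intro ρ hρ t
    have h1 : t = τ ↔ ρ * t * ρ⁻¹ = τ := by
      constructor
      · rintro rfl
        exact hρ.2
      · intro h
        have h2 := h.trans hρ.2.symm
        simpa using h2
    rw [Set.mem_sdiff, Set.mem_sdiff, hρ.1 t, Set.mem_singleton_iff, Set.mem_singleton_iff, h1]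
  let p : Equiv.Perm (X \ {τ} : Set (MulAut N)) :=
    { toFun := fun t => ⟨π * t * π⁻¹, (hmem π hπX t).1 t.2⟩
      invFun := fun t => ⟨π⁻¹ * t * π⁻¹⁻¹, (hmem π⁻¹ (inv_mem hπX) t).1 t.2⟩
      left_inv := fun t => Subtype.ext (by simp [mul_assoc])
      right_inv := fun t => Subtype.ext (by simp [mul_assoc]) }
  have hp1 : ∀ t, ((p t : _) : MulAut N) = π * t * π⁻¹ := fun t => rfl
  have hpsymm : ∀ t, ((p⁻¹ t : _) : MulAut N) = π⁻¹ * t * π := fun t => by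
    change π⁻¹ * (t : MulAut N) * π⁻¹⁻¹ = _
    rw [inv_inv]
  have hpn : ∀ (n : ℤ) t, (((p ^ n) t : _) : MulAut N) = π ^ n * t * (π ^ n)⁻¹ := by
    intro n t
    induction n using Int.induction_on generalizing t with
    | zero => simp
    | succ n ih =>
      rw [zpow_add_one, Equiv.Perm.mul_apply, ih, hp1, zpow_add_one]
      group
    | pred n ih =>
      rw [zpow_sub_one, Equiv.Perm.mul_apply, ih, hpsymm, zpow_sub_one]
      group
  obtain ⟨e, he⟩ := exists_shift_equiv p (by
    intro t n h
    by_contra hn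
    refine hinf t t.2 (conjOrbit_finite hn ?_)
    rw [← hpn, h])
  have hJ : Infinite (Quotient (Equiv.Perm.SameCycle.setoid p)) := by
    by_contra hfin
    rw [not_infinite_iff_finite] at hfin
    refine horb ((Set.finite_range fun j : Quotient (Equiv.Perm.SameCycle.setoid p) =>
      conjOrbit π (j.out : MulAut N)).subset ?_)
    rintro _ ⟨t, ht, rfl⟩
    obtain ⟨⟨j, n⟩, hjn⟩ := e.surjective ⟨t, ht⟩
    refine ⟨j, ?_⟩
    have h1 := congrArg Subtype.val hjn
    rw [he, hpn] at h1
    change _ = t at h1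
    rw [← h1, conjOrbit_conj]
  have hl : ∀ t : (X \ {τ} : Set (MulAut N)), ∃ a : N, MulAut.conj a = t := fun t => by
    have h1 : (t : MulAut N) ∈ (MulAut.conj : N →* MulAut N).range :=
      hX.1 ▸ Subgroup.subset_closure t.2.1
    exact h1
  choose l hl using hl
  -- One representative per orbit is lifted arbitrarily and the rest is transported by π, so that π
  -- shifts the lifts exactly and not just modulo the center.
  let y : Quotient (Equiv.Perm.SameCycle.setoid p) × ℤ → N := fun q => (π ^ q.2) (l q.1.out)
  obtain ⟨hb, hrange⟩ := hX.isRelBasis_elim hc hB hnt hx e (y := y) (by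
    rintro ⟨j, n⟩
    rw [he, hpn]
    change MulAut.conj ((π ^ n) (l j.out)) = _
    rw [← mul_conj_mul_inv, hl])
  have := hb.stabIA_eq_closure hc hB.lcs_eq_bot (hB.center_le hnt) hk (π := π) (fun j n => by
    change π ((π ^ n) (l j.out)) = (π ^ (n + 1)) (l j.out)
    rw [← MulAut.mul_apply, add_comm, zpow_add, zpow_one])
    (exists_apply_eq_of_mem_symConjStab hπX)
  rwa [hrange] at this

theorem IsInnBasis.infinite {c : ℕ} (hc : 2 ≤ c) (hN : IsInfinitelyGenerated c N) {B : Set N}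
    (hB : IsBasisOf c B ⊤) (hnt : B.Nontrivial) {X : Set (MulAut N)} (hX : IsInnBasis X) :
    X.Infinite := by
  have hl : ∀ t : X, ∃ a : N, MulAut.conj a = t := fun t => by
    have h1 : (t : MulAut N) ∈ (MulAut.conj : N →* MulAut N).range :=
      hX.1 ▸ Subgroup.subset_closure t.2
    exact h1
  choose l hl using hl
  have hinf := not_finite_of_isInfinitelyGenerated (by omega) hN
    (hX.isRelBasis hc hB hnt hl).closure_eq
  intro hfin
  have := hfin.to_subtype
  exact hinf (Set.finite_range l)

theorem IsRelBasis.optAut_zpow {ι : Type*} {b : Option ι → N} (hb : IsRelBasis b)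
    (s : Equiv.Perm ι) (n : ℤ) : hb.optAut (s ^ n) = hb.optAut s ^ n :=
  map_zpow (MonoidHom.mk' hb.optAut hb.optAut_mul) s n

theorem shift_zpow_apply {J : Type*} (n : ℤ) (j : J) (m : ℤ) :
    (shift J ^ n) (j, m) = (j, m + n) := by
  induction n using Int.induction_on generalizing m with
  | zero => simp
  | succ n ih =>
    rw [zpow_add_one, Equiv.Perm.mul_apply, shift_apply, ih]
    congr 1
    ring
  | pred n ih =>
    have e : (shift J)⁻¹ (j, m) = (j, m - 1) := by
      rw [Equiv.Perm.inv_eq_iff_eq, shift_apply, sub_add_cancel]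
    rw [zpow_sub_one, Equiv.Perm.mul_apply, e, ih]
    congr 1
    ring

/-- The infinite set Y = X \ {τ_x} is equinumerous with Y × ℤ, and permutations of lifts extend to
automorphisms; the shift of the ℤ-coordinate serves. -/
theorem exists_isPiStar {c : ℕ} (hc : 2 ≤ c) (hN : IsInfinitelyGenerated c N) {B : Set N}
    (hB : IsBasisOf c B ⊤) (hnt : B.Nontrivial) {X : Set (MulAut N)} (hX : IsInnBasis X) {x : N}
    (hx : MulAut.conj x ∈ X) : ∃ π, IsPiStar X (MulAut.conj x) π := by
  have hXinf : (X \ {MulAut.conj x}).Infinite :=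
    (hX.infinite hc hN hB hnt).sdiff (Set.finite_singleton _)
  have := hXinf.to_subtype
  obtain ⟨f⟩ := nonempty_prod_countable_equiv (X \ {MulAut.conj x} : Set (MulAut N)) ℤ
  have hl : ∀ q, ∃ a : N, MulAut.conj a = f q := fun q => by
    have h1 : (f q : MulAut N) ∈ (MulAut.conj : N →* MulAut N).range :=
      hX.1 ▸ Subgroup.subset_closure (f q).2.1
    exact h1
  choose y hy using hl
  obtain ⟨hb, hrange⟩ := hX.isRelBasis_elim hc hB hnt hx f hy
  have hπn : ∀ (n : ℤ) q, hb.optAut (shift _) ^ n * (f q : MulAut N) *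
      (hb.optAut (shift _) ^ n)⁻¹ = f (q.1, q.2 + n) := by
    rintro n ⟨j, m⟩
    have h := hb.optAut_some (shift _ ^ n) (j, m)
    rw [shift_zpow_apply] at h
    change (hb.optAut (shift _ ^ n)) (y (j, m)) = y (j, m + n) at h
    rw [← hb.optAut_zpow, ← hy, mul_conj_mul_inv, h, hy]
  refine ⟨hb.optAut (shift _), ?_, ?_, ?_⟩
  · have h := hb.optAut_mem_symConjStab (shift _)
    rwa [hrange] at h
  · intro υ hυ
    obtain ⟨q, hq⟩ := f.surjective ⟨υ, hυ⟩
    have hq : (f q : MulAut N) = υ := congrArg Subtype.val hq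
    rw [← hq]
    refine Set.infinite_range_of_injective fun n n' h => ?_
    simp only [hπn] at h
    have h1 := congrArg Prod.snd (f.injective (Subtype.ext h))
    exact add_left_cancel h1
  · refine Set.Infinite.mono (s := Set.range fun j => conjOrbit (hb.optAut (shift _)) (f (j, 0))) ?_
      (Set.infinite_range_of_injective fun j j' h => ?_)
    · rintro _ ⟨j, rfl⟩
      exact ⟨_, (f (j, 0)).2, rfl⟩
    · have h1 : (f (j, 0) : MulAut N) ∈ conjOrbit (hb.optAut (shift _)) (f (j, 0)) :=
        ⟨0, by simp⟩
      have h : conjOrbit (hb.optAut (shift _)) (f (j, 0)) =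
        conjOrbit (hb.optAut (shift _)) (f (j', 0)) := h
      rw [h] at h1
      obtain ⟨n, hn⟩ := h1
      simp only [hπn] at hn
      exact (congrArg Prod.fst (f.injective (Subtype.ext hn))).symm

end FreeNilpotent

/-! ### Definable predicates -/

namespace SecondOrder

variable {G : Type*}

/-- Assignments of elements and relations to the variables. -/
abbrev Ctx (G : Type*) (n : ℕ) (Γ : List ℕ) : Type _ := (Fin n → G) × RelAssignment G Γ

namespace Ctx

variable {n m : ℕ} {Γ : List ℕ}

/-- Forget the element variable `0`. -/
def tailE (c : Ctx G (n + 1) Γ) : Ctx G n Γ := (fun i => c.1 i.succ, c.2)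

/-- Forget the relation variable `0`. -/
def tailR (c : Ctx G n (m :: Γ)) : Ctx G n Γ := (c.1, fun i => c.2 i.succ)

/-- The value of the element variable `0`. -/
def hd (c : Ctx G (n + 1) Γ) : G := c.1 0

/-- The value of the relation variable `0`, read as a set. -/
def hdS (c : Ctx G n (1 :: Γ)) : Set G := {a | (fun _ => a) ∈ c.2 ⟨0, Nat.succ_pos _⟩}

/-- The value of the relation variable `0`, read as a binary relation. -/
def hdB (c : Ctx G n (2 :: Γ)) (a b : G) : Prop :=
  (fun k => if k.1 = 0 then a else b) ∈ c.2 ⟨0, Nat.succ_pos _⟩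

end Ctx

open Ctx

variable {n : ℕ} {Γ : List ℕ}

/-- The set is given by a relation variable. -/
def SetDef (A : Ctx G n Γ → Set G) : Prop :=
  ∃ i : Fin Γ.length, ∀ c a, a ∈ A c ↔ (fun _ => a) ∈ c.2 i

/-- The binary relation is given by a relation variable. -/
def BinDef (F : Ctx G n Γ → G → G → Prop) : Prop :=
  ∃ i : Fin Γ.length, ∀ c a b, F c a b ↔ (fun k => if k.1 = 0 then a else b) ∈ c.2 i

/-- The map of contexts forgets some variables. -/
def Weak {n' : ℕ} {Γ' : List ℕ} (f : Ctx G n Γ → Ctx G n' Γ') : Prop :=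
  -- Tuples are taken as restrictions of sequences ℕ → G, so the two arities can be compared without
  -- casts.
  (∀ i, ∃ j, ∀ c, (f c).1 i = c.1 j) ∧
    ∀ i : Fin Γ'.length, ∃ j : Fin Γ.length, ∀ c, ∀ u : ℕ → G,
      (fun k : Fin (Γ'.get i) => u k) ∈ (f c).2 i ↔ (fun k : Fin (Γ.get j) => u k) ∈ c.2 j

theorem Weak.id : Weak (fun c : Ctx G n Γ => c) :=
  ⟨fun i => ⟨i, fun _ => rfl⟩, fun i => ⟨i, fun _ _ => Iff.rfl⟩⟩

theorem Weak.tailE {n' : ℕ} {Γ' : List ℕ} {f : Ctx G n Γ → Ctx G (n' + 1) Γ'} (hf : Weak f) :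
    Weak (fun c => tailE (f c)) :=
  ⟨fun i => hf.1 i.succ, hf.2⟩

theorem Weak.tailR {n' m : ℕ} {Γ' : List ℕ} {f : Ctx G n Γ → Ctx G n' (m :: Γ')} (hf : Weak f) :
    Weak (fun c => tailR (f c)) :=
  ⟨hf.1, fun i => hf.2 i.succ⟩

variable {n' : ℕ} {Γ' : List ℕ}

theorem SetDef.comp {A : Ctx G n' Γ' → Set G} (hA : SetDef A) {f : Ctx G n Γ → Ctx G n' Γ'}
    (hf : Weak f) : SetDef (fun c => A (f c)) := by
  obtain ⟨i, hi⟩ := hA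
  obtain ⟨j, hj⟩ := hf.2 i
  exact ⟨j, fun c a => (hi _ a).trans (hj c fun _ => a)⟩

theorem BinDef.comp {F : Ctx G n' Γ' → G → G → Prop} (hF : BinDef F)
    {f : Ctx G n Γ → Ctx G n' Γ'} (hf : Weak f) : BinDef (fun c => F (f c)) := by
  obtain ⟨i, hi⟩ := hF
  obtain ⟨j, hj⟩ := hf.2 i
  exact ⟨j, fun c a b => (hi _ a b).trans (hj c fun k => if k = 0 then a else b)⟩

theorem SetDef.hdS {f : Ctx G n Γ → Ctx G n' (1 :: Γ')} (hf : Weak f) :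
    SetDef (fun c => hdS (f c)) :=
  SetDef.comp (A := Ctx.hdS) ⟨⟨0, Nat.succ_pos _⟩, fun _ _ => Iff.rfl⟩ hf

theorem BinDef.hdB {f : Ctx G n Γ → Ctx G n' (2 :: Γ')} (hf : Weak f) :
    BinDef (fun c => hdB (f c)) :=
  BinDef.comp (F := Ctx.hdB) ⟨⟨0, Nat.succ_pos _⟩, fun _ _ _ => Iff.rfl⟩ hf

/-- `A` is the set of the elements with the property `ψ`. -/
def IsExt (A : Set G) (ψ : G → Prop) : Prop := ∀ g, g ∈ A ↔ ψ g

theorem isExt_iff {A : Set G} {ψ : G → Prop} : IsExt A ψ ↔ A = {g | ψ g} := Set.ext_iff.symm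

/-- `A` carries a transitive irreflexive relation without maximal elements. -/
def IsInf (A : Set G) : Prop :=
  ∃ F : G → G → Prop, (∀ a b, F a b → ∀ d, F b d → F a d) ∧ (∀ a, ¬ F a a) ∧ (∃ a, a ∈ A) ∧
    ∀ a, a ∈ A → ∃ b, b ∈ A ∧ F a b

/-- A transitive irreflexive relation on a nonempty finite set has a maximal element; an injection
of ℕ into A transports the order of ℕ. -/
theorem isInf_iff {A : Set G} : IsInf A ↔ A.Infinite := by
  constructor
  · rintro ⟨F, htrans, hirr, ⟨a, ha⟩, h⟩ hfin
    have := hfin.to_subtype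
    let R : A → A → Prop := fun s t => F t s
    have : IsTrans A R := ⟨fun s t u h1 h2 => htrans _ _ h2 _ h1⟩
    have : Std.Irrefl R := ⟨fun s => hirr s⟩
    obtain ⟨m, -, hm⟩ := (Finite.wellFounded_of_trans_of_irrefl R).has_min Set.univ
      ⟨⟨a, ha⟩, trivial⟩
    obtain ⟨b, hb, hF⟩ := h m m.2
    exact hm ⟨b, hb⟩ trivial hF
  · intro hA
    have := hA.to_subtype
    obtain ⟨f, hf, hfA⟩ : ∃ f : ℕ → G, Function.Injective f ∧ ∀ i, f i ∈ A :=
      ⟨fun i => Infinite.natEmbedding A i, fun i j h =>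
        (Infinite.natEmbedding A).injective (Subtype.ext h), fun i => Subtype.prop _⟩
    refine ⟨fun a b => Function.invFun f a < Function.invFun f b, fun a b h1 d h2 => h1.trans h2,
      fun a => lt_irrefl _, ⟨f 0, hfA 0⟩, fun a _ => ⟨f (Function.invFun f a + 1), hfA _, ?_⟩⟩
    change _ < Function.invFun f (f _)
    rw [Function.leftInverse_invFun hf (Function.invFun f a + 1)]
    exact Nat.lt_succ_self _

variable [Group G]

/-- The predicate is given by a second-order formula. -/
def Def (P : Ctx G n Γ → Prop) : Prop :=
  ∃ φ : Formula groupLanguage n Γ, ∀ c, φ.Realize c.1 c.2 ↔ P c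

/-- The element is given by a term. -/
def ElemDef (t : Ctx G n Γ → G) : Prop :=
  ∃ τ : groupLanguage.Term (Fin n), ∀ c, τ.realize c.1 = t c

theorem ElemDef.comp {t : Ctx G n' Γ' → G} (ht : ElemDef t) {f : Ctx G n Γ → Ctx G n' Γ'}
    (hf : Weak f) : ElemDef (fun c => t (f c)) := by
  obtain ⟨τ, hτ⟩ := ht
  choose j hj using hf.1
  refine ⟨τ.relabel j, fun c => ?_⟩
  have e : c.1 ∘ j = (f c).1 := funext fun i => (hj i c).symm
  rw [FirstOrder.Language.Term.realize_relabel, e]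
  exact hτ (f c)

theorem ElemDef.hd {f : Ctx G n Γ → Ctx G (n' + 1) Γ'} (hf : Weak f) :
    ElemDef (fun c => hd (f c)) :=
  ElemDef.comp (t := Ctx.hd) ⟨FirstOrder.Language.Term.var 0, fun _ => rfl⟩ hf

theorem ElemDef.mul {s t : Ctx G n Γ → G} (hs : ElemDef s) (ht : ElemDef t) :
    ElemDef (fun c => s c * t c) := by
  obtain ⟨σ, hσ⟩ := hs
  obtain ⟨τ, hτ⟩ := ht
  refine ⟨FirstOrder.Language.Term.func (l := 2) GroupFunc.mul ![σ, τ], fun c => ?_⟩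
  change σ.realize c.1 * τ.realize c.1 = s c * t c
  rw [hσ, hτ]

theorem ElemDef.inv {s : Ctx G n Γ → G} (hs : ElemDef s) : ElemDef (fun c => (s c)⁻¹) := by
  obtain ⟨σ, hσ⟩ := hs
  refine ⟨FirstOrder.Language.Term.func (l := 1) GroupFunc.inv ![σ], fun c => ?_⟩
  exact congrArg (·⁻¹) (hσ c)

theorem ElemDef.one : ElemDef (fun _ : Ctx G n Γ => 1) :=
  ⟨FirstOrder.Language.Term.func (l := 0) GroupFunc.one ![], fun _ => rfl⟩

theorem Def.eq {s t : Ctx G n Γ → G} (hs : ElemDef s) (ht : ElemDef t) :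
    Def (fun c => s c = t c) := by
  obtain ⟨σ, hσ⟩ := hs
  obtain ⟨τ, hτ⟩ := ht
  refine ⟨.equal σ τ, fun c => ?_⟩
  change σ.realize c.1 = τ.realize c.1 ↔ s c = t c
  rw [hσ, hτ]

theorem Def.mem {t : Ctx G n Γ → G} {A : Ctx G n Γ → Set G} (ht : ElemDef t) (hA : SetDef A) :
    Def (fun c => t c ∈ A c) := by
  obtain ⟨τ, hτ⟩ := ht
  obtain ⟨i, hi⟩ := hA
  refine ⟨.mem i fun _ => τ, fun c => ?_⟩
  change (fun _ => τ.realize c.1) ∈ c.2 i ↔ t c ∈ A c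
  rw [hi, hτ]

theorem Def.bin {s t : Ctx G n Γ → G} {F : Ctx G n Γ → G → G → Prop} (hF : BinDef F)
    (hs : ElemDef s) (ht : ElemDef t) : Def (fun c => F c (s c) (t c)) := by
  obtain ⟨σ, hσ⟩ := hs
  obtain ⟨τ, hτ⟩ := ht
  obtain ⟨i, hi⟩ := hF
  refine ⟨.mem i fun k => if k.1 = 0 then σ else τ, fun c => ?_⟩
  change (fun k : Fin (Γ.get i) => FirstOrder.Language.Term.realize c.1
    (if k.1 = 0 then σ else τ)) ∈ c.2 i ↔ F c (s c) (t c)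
  have e : (fun k : Fin (Γ.get i) => FirstOrder.Language.Term.realize c.1
      (if k.1 = 0 then σ else τ)) = fun k : Fin (Γ.get i) =>
        if k.1 = 0 then s c else t c := by
    funext k
    split_ifs
    · exact hσ c
    · exact hτ c
  rw [e, hi]

theorem Def.congr {P Q : Ctx G n Γ → Prop} (hP : Def P) (h : ∀ c, Q c ↔ P c) : Def Q := by
  obtain ⟨φ, hφ⟩ := hP
  exact ⟨φ, fun c => (hφ c).trans (h c).symm⟩

theorem Def.imp {P Q : Ctx G n Γ → Prop} (hP : Def P) (hQ : Def Q) :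
    Def (fun c => P c → Q c) := by
  obtain ⟨φ, hφ⟩ := hP
  obtain ⟨ψ, hψ⟩ := hQ
  exact ⟨.imp φ ψ, fun c => imp_congr (hφ c) (hψ c)⟩

theorem Def.not {P : Ctx G n Γ → Prop} (hP : Def P) : Def (fun c => ¬ P c) :=
  hP.imp ⟨.falsum, fun _ => Iff.rfl⟩

theorem Def.and {P Q : Ctx G n Γ → Prop} (hP : Def P) (hQ : Def Q) :
    Def (fun c => P c ∧ Q c) :=
  (hP.imp hQ.not).not.congr fun c => by tauto

theorem Def.iff {P Q : Ctx G n Γ → Prop} (hP : Def P) (hQ : Def Q) :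
    Def (fun c => P c ↔ Q c) :=
  ((hP.imp hQ).and (hQ.imp hP)).congr fun c => by tauto

theorem Def.allE {Q : G → Ctx G n Γ → Prop}
    (hQ : Def (fun c : Ctx G (n + 1) Γ => Q (hd c) (tailE c))) :
    Def (fun c => ∀ a, Q a c) := by
  obtain ⟨φ, hφ⟩ := hQ
  refine ⟨.allElem φ, fun c => forall_congr' fun a => ?_⟩
  exact hφ (Fin.cons a c.1, c.2)

theorem Def.allS {Q : Set G → Ctx G n Γ → Prop}
    (hQ : Def (fun c : Ctx G n (1 :: Γ) => Q (hdS c) (tailR c))) :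
    Def (fun c => ∀ A, Q A c) := by
  obtain ⟨φ, hφ⟩ := hQ
  refine ⟨.allRel 1 φ, fun c => ⟨fun h A => ?_, fun h R => ?_⟩⟩
  · exact (hφ (c.1, c.2.cons (m := 1) {f | f 0 ∈ A})).1 (h {f | f 0 ∈ A})
  · exact (hφ (c.1, c.2.cons R)).2 (h _)

theorem Def.allB {Q : (G → G → Prop) → Ctx G n Γ → Prop}
    (hQ : Def (fun c : Ctx G n (2 :: Γ) => Q (hdB c) (tailR c))) :
    Def (fun c => ∀ F, Q F c) := by
  obtain ⟨φ, hφ⟩ := hQ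
  refine ⟨.allRel 2 φ, fun c => ⟨fun h F => ?_, fun h R => ?_⟩⟩
  · exact (hφ (c.1, c.2.cons (m := 2) {f | F (f 0) (f 1)})).1 (h {f | F (f 0) (f 1)})
  · exact (hφ (c.1, c.2.cons R)).2 (h _)

theorem Def.exE {Q : G → Ctx G n Γ → Prop}
    (hQ : Def (fun c : Ctx G (n + 1) Γ => Q (hd c) (tailE c))) : Def (fun c => ∃ a, Q a c) :=
  (Def.allE (Q := fun a c => ¬ Q a c) hQ.not).not.congr fun c => by simp

theorem Def.exS {Q : Set G → Ctx G n Γ → Prop}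
    (hQ : Def (fun c : Ctx G n (1 :: Γ) => Q (hdS c) (tailR c))) : Def (fun c => ∃ A, Q A c) :=
  (Def.allS (Q := fun a c => ¬ Q a c) hQ.not).not.congr fun c => by simp

theorem Def.exB {Q : (G → G → Prop) → Ctx G n Γ → Prop}
    (hQ : Def (fun c : Ctx G n (2 :: Γ) => Q (hdB c) (tailR c))) : Def (fun c => ∃ F, Q F c) :=
  (Def.allB (Q := fun a c => ¬ Q a c) hQ.not).not.congr fun c => by simp

/-! ### Closures, lower central series, infinite sets -/

/-- `g` belongs to the subgroup generated by the elements with the property `ψ`. -/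
def InGen (ψ : G → Prop) (g : G) : Prop :=
  ∀ S : Set G, 1 ∈ S → (∀ a, a ∈ S → ∀ b, b ∈ S → a * b ∈ S) → (∀ a, a ∈ S → a⁻¹ ∈ S) →
    (∀ h, ψ h → h ∈ S) → g ∈ S

theorem inGen_iff {ψ : G → Prop} {g : G} : InGen ψ g ↔ g ∈ Subgroup.closure {h | ψ h} := by
  constructor
  · intro h
    exact h (Subgroup.closure {h | ψ h} : Subgroup G) (one_mem _) (fun a ha b hb => mul_mem ha hb)
      (fun a ha => inv_mem ha) fun a ha => Subgroup.subset_closure ha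
  · intro hg S h1 hmul hinv hψ
    let K : Subgroup G :=
      { carrier := S
        one_mem' := h1
        mul_mem' := fun {a b} ha hb => hmul a ha b hb
        inv_mem' := fun {a} ha => hinv a ha }
    exact (Subgroup.closure_le K).2 hψ hg

theorem Def.inGen {ψ : G → Ctx G n Γ → Prop} {t : Ctx G n Γ → G} (ht : ElemDef t)
    (hψ : Def (fun c : Ctx G (n + 1) (1 :: Γ) => ψ (hd c) (tailR (tailE c)))) :
    Def (fun c => InGen (fun g => ψ g c) (t c)) := by
  refine .allS (.imp (.mem .one (.hdS .id)) (.imp ?_ (.imp ?_ (.imp ?_ ?_))))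
  · exact .allE (.imp (.mem (.hd .id) (.hdS (.tailE .id))) (.allE (.imp
      (.mem (.hd .id) (.hdS (.tailE (.tailE .id)))) (.mem (.mul (.hd (.tailE .id)) (.hd .id))
        (.hdS (.tailE (.tailE .id)))))))
  · exact .allE (.imp (.mem (.hd .id) (.hdS (.tailE .id)))
      (.mem (.inv (.hd .id)) (.hdS (.tailE .id))))
  · exact .allE (.imp hψ (.mem (.hd .id) (.hdS (.tailE .id))))
  · exact .mem (ht.comp (.tailR .id)) (.hdS .id)

/-- `A` is the term with number `k` of the lower central series of `I`. -/
def IsLcs : ℕ → Set G → Set G → Prop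
  | 0, I, A => IsExt A fun g => g ∈ I
  | k + 1, I, A => ∃ B, IsLcs k I B ∧
      IsExt A (InGen fun g => ∃ a, a ∈ B ∧ ∃ b, b ∈ I ∧ g = a * b * a⁻¹ * b⁻¹)

theorem isLcs_iff {I : Subgroup G} {k : ℕ} {A : Set G} :
    IsLcs k I A ↔ A = (I.lowerCentralSeries k : Set G) := by
  induction k generalizing A with
  | zero => exact isExt_iff
  | succ k ih =>
    simp only [IsLcs, ih, exists_eq_left, isExt_iff, inGen_iff]
    have e : {g | ∃ a, a ∈ (I.lowerCentralSeries k : Set G) ∧ ∃ b, b ∈ (I : Set G) ∧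
        g = a * b * a⁻¹ * b⁻¹} = {g | ∃ a ∈ I.lowerCentralSeries k, ∃ b ∈ I, ⁅a, b⁆ = g} := by
      ext g
      simp [commutatorElement_def, eq_comm]
    rw [e]
    rfl

theorem Def.isLcs (k : ℕ) {I A : Ctx G n Γ → Set G} (hI : SetDef I) (hA : SetDef A) :
    Def (fun c => IsLcs k (I c) (A c)) := by
  induction k generalizing Γ with
  | zero =>
    exact .allE (.iff (.mem (.hd .id) (hA.comp (.tailE .id)))
      (.mem (.hd .id) (hI.comp (.tailE .id))))
  | succ k ih =>
    refine .exS (.and (ih (hI.comp (.tailR .id)) (.hdS .id)) (.allE (.iff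
      (.mem (.hd .id) (hA.comp (.tailR (.tailE .id)))) (.inGen (.hd .id) ?_))))
    refine .exE (.and (.mem (.hd .id) (.hdS (.tailE (.tailR (.tailE (.tailE .id)))))) (.exE (.and
      (.mem (.hd .id) (hI.comp (.tailR (.tailE (.tailR (.tailE (.tailE (.tailE .id))))))))
      (.eq (.hd (.tailE (.tailE .id))) (.mul (.mul (.mul (.hd (.tailE .id)) (.hd .id))
        (.inv (.hd (.tailE .id)))) (.inv (.hd .id)))))))

theorem Def.isInf {A : Ctx G n Γ → Set G} (hA : SetDef A) : Def (fun c => IsInf (A c)) := by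
  refine .exB (.and ?_ (.and ?_ (.and ?_ ?_)))
  · exact .allE (.allE (.imp (.bin (.hdB (.tailE (.tailE .id))) (.hd (.tailE .id)) (.hd .id))
      (.allE (.imp (.bin (.hdB (.tailE (.tailE (.tailE .id)))) (.hd (.tailE .id)) (.hd .id))
        (.bin (.hdB (.tailE (.tailE (.tailE .id)))) (.hd (.tailE (.tailE .id))) (.hd .id))))))
  · exact .allE (.not (.bin (.hdB (.tailE .id)) (.hd .id) (.hd .id)))
  · exact .exE (.mem (.hd .id) (hA.comp (.tailR (.tailE .id))))
  · exact .allE (.imp (.mem (.hd .id) (hA.comp (.tailR (.tailE .id)))) (.exE (.and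
      (.mem (.hd .id) (hA.comp (.tailR (.tailE (.tailE .id)))))
      (.bin (.hdB (.tailE (.tailE .id))) (.hd (.tailE .id)) (.hd .id)))))

end SecondOrder

/-! ### A second-order description of the stabilizer -/

namespace SecondOrder

/-- `ω` is in the orbit of `υ` under the conjugation action of the powers of `π`. -/
def InOrbit {G : Type*} [Group G] (π υ ω : G) : Prop :=
  ∀ S : Set G, υ ∈ S → (∀ a, a ∈ S → π * a * π⁻¹ ∈ S ∧ π⁻¹ * a * π ∈ S) → ω ∈ S

variable {G : Type*} [Group G] {n : ℕ} {Γ : List ℕ}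

open Ctx

theorem Def.isExt {ψ : G → Ctx G n Γ → Prop} {A : Ctx G n Γ → Set G} (hA : SetDef A)
    (hψ : Def (fun c : Ctx G (n + 1) Γ => ψ (hd c) (tailE c))) :
    Def (fun c => IsExt (A c) fun g => ψ g c) :=
  .allE (.iff (.mem (.hd .id) (hA.comp (.tailE .id))) hψ)

theorem Def.inOrbit {s t u : Ctx G n Γ → G} (hs : ElemDef s) (ht : ElemDef t) (hu : ElemDef u) :
    Def (fun c => InOrbit (s c) (t c) (u c)) := by
  have hs' := hs.comp (f := fun c : Ctx G (n + 1) (1 :: Γ) => tailR (tailE c))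
    (.tailR (.tailE .id))
  refine .allS (.imp (.mem (ht.comp (.tailR .id)) (.hdS .id)) (.imp (.allE (.imp
    (.mem (.hd .id) (.hdS (.tailE .id))) (.and (.mem (.mul (.mul hs' (.hd .id)) hs'.inv)
      (.hdS (.tailE .id))) (.mem (.mul (.mul hs'.inv (.hd .id)) hs') (.hdS (.tailE .id))))))
    (.mem (hu.comp (.tailR .id)) (.hdS .id))))

/-- `ρ` permutes `X` and fixes `τ` under the conjugation action. -/
def SymFix (X : Set G) (τ ρ : G) : Prop := (∀ h, h ∈ X ↔ ρ * h * ρ⁻¹ ∈ X) ∧ ρ * τ * ρ⁻¹ = τ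

theorem Def.symFix {X : Ctx G n Γ → Set G} {s t : Ctx G n Γ → G} (hX : SetDef X) (hs : ElemDef s)
    (ht : ElemDef t) : Def (fun c => SymFix (X c) (s c) (t c)) := by
  have hX' := hX.comp (f := fun c : Ctx G (n + 1) Γ => tailE c) (.tailE .id)
  have ht' := ht.comp (f := fun c : Ctx G (n + 1) Γ => tailE c) (.tailE .id)
  exact .and (.allE (.iff (.mem (.hd .id) hX') (.mem (.mul (.mul ht' (.hd .id)) ht'.inv) hX')))
    (.eq (.mul (.mul ht hs) ht.inv) hs)

/-- The relation `IsPiStar`, in the language of groups. -/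
def PiStarRel (X : Set G) (τ π : G) : Prop :=
  SymFix X τ π ∧
    (∀ υ, υ ∈ X → ¬ υ = τ → ∀ O, IsExt O (InOrbit π υ) → IsInf O) ∧
    -- An infinite set meeting each orbit at most once stands for an infinite set of orbits.
    ∃ T, IsInf T ∧ (∀ a, a ∈ T → a ∈ X ∧ ¬ a = τ) ∧
      ∀ a, a ∈ T → ∀ b, b ∈ T → InOrbit π a b → a = b

theorem Def.piStarRel {X : Ctx G n Γ → Set G} {s t : Ctx G n Γ → G} (hX : SetDef X)
    (hs : ElemDef s) (ht : ElemDef t) : Def (fun c => PiStarRel (X c) (s c) (t c)) := by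
  refine .and (.symFix hX hs ht) (.and ?_ ?_)
  · refine .allE (.imp (.mem (.hd .id) (hX.comp (.tailE .id))) (.imp (.not (.eq (.hd .id)
      (hs.comp (.tailE .id)))) (.allS (.imp (.isExt (.hdS .id) ?_) (.isInf (.hdS .id))))))
    exact .inOrbit (ht.comp (.tailE (.tailR (.tailE .id)))) (.hd (.tailR (.tailE .id))) (.hd .id)
  · refine .exS (.and (.isInf (.hdS .id)) (.and (.allE (.imp (.mem (.hd .id) (.hdS (.tailE .id)))
      (.and (.mem (.hd .id) (hX.comp (.tailR (.tailE .id)))) (.not (.eq (.hd .id)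
        (hs.comp (.tailR (.tailE .id)))))))) (.allE (.imp (.mem (.hd .id) (.hdS (.tailE .id)))
      (.allE (.imp (.mem (.hd .id) (.hdS (.tailE (.tailE .id)))) (.imp ?_
        (.eq (.hd (.tailE .id)) (.hd .id)))))))))
    exact .inOrbit (ht.comp (.tailR (.tailE (.tailE .id)))) (.hd (.tailE .id)) (.hd .id)

/-- `X` generates `I`, and every map `X → I` extends to a multiplicative map on `I`. -/
def BasisRel (I X : Set G) : Prop :=
  IsExt I (InGen fun g => g ∈ X) ∧
    -- Maps are coded by relations. F may be multivalued, and Φ has to extend one of its choices,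
    -- which saves stating that F is a map.
    ∀ F : G → G → Prop, (∀ a, a ∈ X → ∃ b, b ∈ I ∧ F a b) →
      ∃ Φ : G → G → Prop, (∀ a, ∃ b, Φ a b) ∧ (∀ a b, Φ a b → ∀ d, Φ a d → b = d) ∧
        (∀ a, a ∈ I → ∀ b, b ∈ I → ∀ u, Φ a u → ∀ v, Φ b v → Φ (a * b) (u * v)) ∧
        ∀ a, a ∈ X → ∃ b, F a b ∧ Φ a b

theorem Def.basisRel {I X : Ctx G n Γ → Set G} (hI : SetDef I) (hX : SetDef X) :
    Def (fun c => BasisRel (I c) (X c)) := by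
  refine .and (.isExt hI (.inGen (.hd .id)
    (.mem (.hd .id) (hX.comp (.tailE (.tailR (.tailE .id))))))) (.allB (.imp (.allE (.imp
      (.mem (.hd .id) (hX.comp (.tailR (.tailE .id)))) (.exE (.and
        (.mem (.hd .id) (hI.comp (.tailR (.tailE (.tailE .id)))))
        (.bin (.hdB (.tailE (.tailE .id))) (.hd (.tailE .id)) (.hd .id))))))
      (.exB (.and ?_ (.and ?_ (.and ?_ ?_))))))
  · exact .allE (.exE (.bin (.hdB (.tailE (.tailE .id))) (.hd (.tailE .id)) (.hd .id)))
  · exact .allE (.allE (.imp (.bin (.hdB (.tailE (.tailE .id))) (.hd (.tailE .id)) (.hd .id))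
      (.allE (.imp (.bin (.hdB (.tailE (.tailE (.tailE .id)))) (.hd (.tailE (.tailE .id)))
        (.hd .id)) (.eq (.hd (.tailE .id)) (.hd .id))))))
  · exact .allE (.imp (.mem (.hd .id) (hI.comp (.tailR (.tailR (.tailE .id))))) (.allE (.imp
      (.mem (.hd .id) (hI.comp (.tailR (.tailR (.tailE (.tailE .id)))))) (.allE (.imp
        (.bin (.hdB (.tailE (.tailE (.tailE .id)))) (.hd (.tailE (.tailE .id))) (.hd .id))
        (.allE (.imp (.bin (.hdB (.tailE (.tailE (.tailE (.tailE .id)))))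
          (.hd (.tailE (.tailE .id))) (.hd .id))
          (.bin (.hdB (.tailE (.tailE (.tailE (.tailE .id)))))
            (.mul (.hd (.tailE (.tailE (.tailE .id)))) (.hd (.tailE (.tailE .id))))
            (.mul (.hd (.tailE .id)) (.hd .id))))))))))
  · exact .allE (.imp (.mem (.hd .id) (hX.comp (.tailR (.tailR (.tailE .id))))) (.exE (.and
      (.bin (.hdB (.tailR (.tailE (.tailE .id)))) (.hd (.tailE .id)) (.hd .id))
      (.bin (.hdB (.tailE (.tailE .id))) (.hd (.tailE .id)) (.hd .id)))))

/-- `h` is a conjugate, by an element that permutes `X` and fixes `τ`, of an element that commutes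
with `π` and acts on `I` trivially modulo `A`. -/
def GenRel (I A X : Set G) (τ π h : G) : Prop :=
  ∃ ρ, SymFix X τ ρ ∧ ∃ η, (∀ t, t ∈ I → η * t * η⁻¹ * t⁻¹ ∈ A) ∧ η * π = π * η ∧ h = ρ * η * ρ⁻¹

theorem Def.genRel {I A X : Ctx G n Γ → Set G} {s t u : Ctx G n Γ → G} (hI : SetDef I)
    (hA : SetDef A) (hX : SetDef X) (hs : ElemDef s) (ht : ElemDef t) (hu : ElemDef u) :
    Def (fun c => GenRel (I c) (A c) (X c) (s c) (t c) (u c)) := by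
  have ht' := ht.comp (f := fun c : Ctx G (n + 1 + 1) Γ => tailE (tailE c)) (.tailE (.tailE .id))
  exact .exE (.and (.symFix (hX.comp (.tailE .id)) (hs.comp (.tailE .id)) (.hd .id)) (.exE (.and
    (.allE (.imp (.mem (.hd .id) (hI.comp (.tailE (.tailE (.tailE .id))))) (.mem
      (.mul (.mul (.mul (.hd (.tailE .id)) (.hd .id)) (.inv (.hd (.tailE .id)))) (.inv (.hd .id)))
      (hA.comp (.tailE (.tailE (.tailE .id)))))))
    (.and (.eq (.mul (.hd .id) ht') (.mul ht' (.hd .id)))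
      (.eq (hu.comp (.tailE (.tailE .id))) (.mul (.mul (.hd (.tailE .id)) (.hd .id))
        (.inv (.hd (.tailE .id)))))))))

/-- The description of the elements `σ` of `IA_k(N)_(x)` in the group `Aut N` in terms of the
conjugation `τ` by `x`. -/
def StabRel (k : ℕ) (σ τ : G) : Prop :=
  -- I stands for Inn N, A for γ_{k+1}(Inn N); both are determined by τ.
  ∀ I, IsExt I (InGen fun g => ∃ ρ, g = ρ * τ * ρ⁻¹) → ∀ A, IsLcs k I A →
    ∀ X, BasisRel I X → τ ∈ X → ∀ π, PiStarRel X τ π → InGen (GenRel I A X τ π) σ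

theorem Def.stabRel (k : ℕ) {s t : Ctx G n Γ → G} (hs : ElemDef s) (ht : ElemDef t) :
    Def (fun c => StabRel k (s c) (t c)) := by
  refine .allS (.imp (.isExt (.hdS .id) (.inGen (.hd .id) (.exE (.eq (.hd (.tailE .id)) ?_))))
    (.allS (.imp (.isLcs k (.hdS (.tailR .id)) (.hdS .id)) (.allS (.imp
      (.basisRel (.hdS (.tailR (.tailR .id))) (.hdS .id)) (.imp
      (.mem (ht.comp (.tailR (.tailR (.tailR .id)))) (.hdS .id)) (.allE (.imp
        (.piStarRel (.hdS (.tailE .id)) (ht.comp (.tailR (.tailR (.tailR (.tailE .id)))))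
          (.hd .id))
        (.inGen (hs.comp (.tailR (.tailR (.tailR (.tailE .id))))) ?_)))))))))
  · have ht' := ht.comp (f := fun c : Ctx G (n + 1 + 1 + 1) (1 :: 1 :: Γ) =>
      tailR (tailE (tailR (tailE (tailE c))))) (.tailR (.tailE (.tailR (.tailE (.tailE .id)))))
    exact .mul (.mul (.hd .id) ht') (.inv (.hd .id))
  · exact .genRel (.hdS (.tailR (.tailR (.tailE (.tailR (.tailE .id))))))
      (.hdS (.tailR (.tailE (.tailR (.tailE .id))))) (.hdS (.tailE (.tailR (.tailE .id))))
      (ht.comp (.tailR (.tailR (.tailR (.tailE (.tailR (.tailE .id)))))))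
      (.hd (.tailR (.tailE .id))) (.hd .id)

theorem definableWith_of_def {P : G → G → Prop}
    (hP : Def (fun c : Ctx G 2 [] => P (c.1 0) (c.1 1))) (a : G) :
    DefinableWith groupLanguage ![a] {b | P b a} := by
  obtain ⟨φ, hφ⟩ := hP
  exact ⟨φ, fun b => (hφ (Fin.cons b ![a], RelAssignment.nil G)).symm⟩

theorem definableWith_stabRel (k : ℕ) (τ : G) :
    DefinableWith groupLanguage ![τ] {σ | StabRel k σ τ} :=
  definableWith_of_def (.stabRel k ⟨.var 0, fun _ => rfl⟩ ⟨.var 1, fun _ => rfl⟩) τ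

end SecondOrder

/-! ### The formula defines the stabilizer -/

namespace FreeNilpotent

open SecondOrder LowerCentral

variable {N : Type*} [Group N]

theorem symFix_iff {X : Set (MulAut N)} {τ ρ : MulAut N} :
    SymFix X τ ρ ↔ ρ ∈ symConjStab X τ :=
  and_congr_left' Subgroup.mem_set_normalizer_iff.symm

theorem inOrbit_iff {π υ ω : MulAut N} : InOrbit π υ ω ↔ ω ∈ conjOrbit π υ := by
  constructor
  · intro h
    refine h (conjOrbit π υ) ⟨0, by simp⟩ ?_
    rintro _ ⟨m, rfl⟩
    refine ⟨⟨m + 1, ?_⟩, ⟨m - 1, ?_⟩⟩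
    · dsimp only
      rw [add_comm, zpow_add, zpow_one]
      group
    · dsimp only
      rw [sub_eq_add_neg, add_comm, zpow_add, zpow_neg_one]
      group
  · rintro ⟨m, rfl⟩ S hυ hS
    dsimp only
    induction m using Int.induction_on with
    | zero => simpa using hυ
    | succ m ih =>
      have h := (hS _ ih).1
      rw [add_comm, zpow_add, zpow_one]
      convert h using 1
      group
    | pred m ih =>
      have h := (hS _ ih).2
      rw [sub_eq_add_neg, add_comm, zpow_add, zpow_neg_one]
      convert h using 1
      group

theorem piStarRel_iff {X : Set (MulAut N)} {τ π : MulAut N} :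
    PiStarRel X τ π ↔ IsPiStar X τ π := by
  have hself : ∀ υ, υ ∈ conjOrbit π υ := fun υ => ⟨0, by simp⟩
  refine and_congr symFix_iff (and_congr ?_ ?_)
  · simp only [isExt_iff, inOrbit_iff, forall_eq, isInf_iff, Set.ofPred_mem_eq, Set.mem_sdiff,
      Set.mem_singleton_iff, and_imp]
  · simp only [isInf_iff, inOrbit_iff]
    constructor
    · rintro ⟨T, hT, hTX, hinj⟩
      refine Set.Infinite.mono (Set.image_mono (f := conjOrbit π) (s := T) fun a ha => hTX a ha)
        (hT.image fun a ha b hb h => hinj a ha b hb ?_)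
      rw [h]
      exact hself b
    · intro h
      -- T is a set of representatives of the orbits.
      obtain ⟨T, hTX, hT⟩ := Set.SurjOn.exists_bijOn_subset (Set.surjOn_image (conjOrbit π)
        (X \ {τ}))
      refine ⟨T, fun hfin => h (hT.image_eq ▸ hfin.image _), fun a ha => hTX ha,
        fun a ha b hb hab => hT.injOn ha hb ?_⟩
      obtain ⟨m, rfl⟩ := hab
      exact (conjOrbit_conj π a m).symm

theorem basisRel_iff {X : Set (MulAut N)} :
    BasisRel ((MulAut.conj : N →* MulAut N).range : Set (MulAut N)) X ↔ IsInnBasis X := by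
  refine and_congr ?_ ⟨fun h f hf => ?_, fun h F hF => ?_⟩
  · rw [isExt_iff]
    simp only [inGen_iff]
    rw [eq_comm]
    exact SetLike.coe_set_eq (p := Subgroup.closure X)
  · obtain ⟨Φ, h1, h2, h3, h4⟩ := h (fun a b => b = f a) fun a ha => ⟨f a, hf a ha, rfl⟩
    choose φ hφ using h1
    refine ⟨φ, fun s hs t ht => h2 _ _ (hφ _) _ (h3 s hs t ht _ (hφ s) _ (hφ t)), fun t ht => ?_⟩
    obtain ⟨b, rfl, hb⟩ := h4 t ht
    exact h2 _ _ (hφ t) _ hb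
  · have : ∀ a, ∃ b, a ∈ X → b ∈ (MulAut.conj : N →* MulAut N).range ∧ F a b := fun a => by
      by_cases ha : a ∈ X
      · obtain ⟨b, hb⟩ := hF a ha
        exact ⟨b, fun _ => hb⟩
      · exact ⟨1, fun h => (ha h).elim⟩
    choose f hf using this
    obtain ⟨φ, hmul, hφ⟩ := h f fun t ht => (hf t ht).1
    refine ⟨fun a b => b = φ a, fun a => ⟨_, rfl⟩, fun a b hb d hd => hb.trans hd.symm, ?_,
      fun a ha => ⟨f a, (hf a ha).2, (hφ a ha).symm⟩⟩
    rintro a ha b hb _ rfl _ rfl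
    exact (hmul a ha b hb).symm

theorem map_conj_lcs (k : ℕ) :
    (MulAut.conj : N →* MulAut N).range.lowerCentralSeries k = (lcs N k).map MulAut.conj := by
  rw [Subgroup.map_lowerCentralSeries, ← MonoidHom.range_eq_map]

/-- The center is contained in γ_{k+1}(N), so this subgroup is the full preimage of γ_{k+1}(Inn N),
and no information is lost in passing to conjugations. -/
theorem mem_IA_iff_conj {k : ℕ} (hZ : Subgroup.center N ≤ lcs N k) {η : MulAut N} :
    η ∈ IA N k ↔ ∀ t ∈ (MulAut.conj : N →* MulAut N).range,
      η * t * η⁻¹ * t⁻¹ ∈ (MulAut.conj : N →* MulAut N).range.lowerCentralSeries k := by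
  rw [mem_IA_iff, map_conj_lcs]
  have h : ∀ a, η * MulAut.conj a * η⁻¹ * (MulAut.conj a)⁻¹ ∈ (lcs N k).map MulAut.conj ↔
      a⁻¹ * η a ∈ lcs N k := fun a => by
    rw [mul_conj_mul_inv, ← map_inv, ← map_mul, ← Subgroup.mem_comap,
      Subgroup.comap_map_eq_self (by rwa [conj_ker]), Subgroup.Normal.mem_comm_iff inferInstance]
  constructor
  · rintro hη _ ⟨a, rfl⟩
    exact (h a).2 (hη a)
  · exact fun hη a => (h a).1 (hη _ ⟨a, rfl⟩)

/-- A transposition of lifts extends to an automorphism of N. This makes Inn N recoverable from τ_x,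
as the subgroup generated by its conjugates. -/
theorem IsInnBasis.exists_conj_eq {c : ℕ} (hc : 2 ≤ c) {B : Set N} (hB : IsBasisOf c B ⊤)
    (hnt : B.Nontrivial) {X : Set (MulAut N)} (hX : IsInnBasis X) {τ t : MulAut N} (hτ : τ ∈ X)
    (ht : t ∈ X) : ∃ ρ, t = ρ * τ * ρ⁻¹ := by
  classical
  have hl : ∀ s : X, ∃ a : N, MulAut.conj a = s := fun s => by
    have h1 : (s : MulAut N) ∈ (MulAut.conj : N →* MulAut N).range :=
      hX.1 ▸ Subgroup.subset_closure s.2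
    exact h1
  choose y hy using hl
  have hb := hX.isRelBasis hc hB hnt hy
  refine ⟨hb.permAut (Equiv.swap ⟨τ, hτ⟩ ⟨t, ht⟩), ?_⟩
  have h := mul_conj_mul_inv (hb.permAut (Equiv.swap ⟨τ, hτ⟩ ⟨t, ht⟩)) (y ⟨τ, hτ⟩)
  rw [hb.permAut_apply, Equiv.swap_apply_left, hy, hy] at h
  exact h.symm

theorem IsInnBasis.closure_conj_eq {c : ℕ} (hc : 2 ≤ c) {B : Set N} (hB : IsBasisOf c B ⊤)
    (hnt : B.Nontrivial) {X : Set (MulAut N)} (hX : IsInnBasis X) {x : N}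
    (hx : MulAut.conj x ∈ X) :
    Subgroup.closure {g | ∃ ρ, g = ρ * MulAut.conj x * ρ⁻¹} =
      (MulAut.conj : N →* MulAut N).range := by
  refine le_antisymm ((Subgroup.closure_le _).2 ?_) (hX.1 ▸ Subgroup.closure_mono fun t ht =>
    hX.exists_conj_eq hc hB hnt hx ht)
  rintro _ ⟨ρ, rfl⟩
  exact ⟨ρ x, (mul_conj_mul_inv ρ x).symm⟩

/-- The generated group equals the stabilizer for every admissible X and π, so the universal
quantifiers are harmless. That some X and π exist keeps them from being vacuous. -/
theorem stabRel_iff {c k : ℕ} (hc : 2 ≤ c) (hN : IsInfinitelyGenerated c N) {B : Set N}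
    (hB : IsBasisOf c B ⊤) (hnt : B.Nontrivial) {x : N} (hx : x ∈ B) (hk : 1 ≤ k)
    (hkc : k ≤ c - 1) {σ : MulAut N} : StabRel k σ (MulAut.conj x) ↔ σ ∈ stabIA k x := by
  have hX := (hB.isConjBasis hc hnt).isInnBasis (by omega) hB.lcs_eq_bot
  have hxX : MulAut.conj x ∈ MulAut.conj '' B := ⟨x, hx, rfl⟩
  have hZ : Subgroup.center N ≤ lcs N k := (hB.center_le hnt).trans (lcs_le hkc)
  have hI : {g : MulAut N | g ∈ Subgroup.closure {g | ∃ ρ, g = ρ * MulAut.conj x * ρ⁻¹}} =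
      ((MulAut.conj : N →* MulAut N).range : Set (MulAut N)) :=
    congrArg (fun H : Subgroup (MulAut N) => (H : Set (MulAut N)))
      (hX.closure_conj_eq hc hB hnt hxX)
  have key : ∀ X, IsInnBasis X → MulAut.conj x ∈ X → ∀ π, IsPiStar X (MulAut.conj x) π →
      (InGen (GenRel ((MulAut.conj : N →* MulAut N).range : Set (MulAut N))
        ((MulAut.conj : N →* MulAut N).range.lowerCentralSeries k : Set (MulAut N)) X
        (MulAut.conj x) π) σ ↔ σ ∈ stabIA k x) := by
    intro X hX hxX π hπ
    rw [inGen_iff, stabIA_eq_closure hc hB hnt hX hxX hk hπ]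
    simp only [GenRel, symFix_iff, mem_IA_iff_conj hZ, SetLike.mem_coe]
  simp only [StabRel, isExt_iff, inGen_iff (G := MulAut N), hI, forall_eq, isLcs_iff,
    basisRel_iff, piStarRel_iff]
  simp only [← inGen_iff]
  constructor
  · intro h
    obtain ⟨π, hπ⟩ := exists_isPiStar hc hN hB hnt hX hxX
    exact (key _ hX hxX π hπ).1 (h _ hX hxX π hπ)
  · exact fun h X hX hxX π hπ => (key X hX hxX π hπ).2 h

end FreeNilpotent

theorem mainTheorem6 {N : Type*} [Group N] (c : ℕ) (hc : 2 ≤ c)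
    (hN : IsInfinitelyGenerated c N) (x : N) (hx : IsPrimitive c x)
    (k : ℕ) (hk : 1 ≤ k) (hkc : k ≤ c - 1) :
    SecondOrder.DefinableWith groupLanguage ![MulAut.conj x] (stabIA k x : Set (MulAut N)) ∧
    (∃ X : Set (MulAut N), IsConjBasis c X ∧ MulAut.conj x ∈ X) ∧
    ∀ X : Set (MulAut N), IsConjBasis c X → MulAut.conj x ∈ X →
      (∃ π : MulAut N, IsPiStar X (MulAut.conj x) π) ∧
      ∀ π : MulAut N, IsPiStar X (MulAut.conj x) π →
        stabIA k x = Subgroup.closure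
          {σ | ∃ ρ ∈ symConjStab X (MulAut.conj x), ∃ η ∈ IA N k,
            η * π = π * η ∧ σ = ρ * η * ρ⁻¹} := by
  obtain ⟨B, hB, hxB⟩ := hx
  have hnt : B.Nontrivial :=
    (not_finite_of_isInfinitelyGenerated (by omega) hN hB.1).nontrivial
  refine ⟨?_, ⟨MulAut.conj '' B, hB.isConjBasis hc hnt, x, hxB, rfl⟩, fun X hX hxX => ?_⟩
  · have h := SecondOrder.definableWith_stabRel k (MulAut.conj x)
    simp only [stabRel_iff hc hN hB hnt hxB hk hkc] at h
    exact h
  · have hX' := hX.isInnBasis (by omega) hB.lcs_eq_bot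
    exact ⟨exists_isPiStar hc hN hB hnt hX' hxX,
      fun π hπ => stabIA_eq_closure hc hB hnt hX' hxX hk hπ⟩
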